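/- **Setting.** Let $p\ge 20$, let $n$ be even, and let $y_i=\mathbf x_i^\top\beta_0+\epsilon_i$, $i=1,\dots,n$, where the pairs $(\mathbf x_i,\epsilon_i)\in\mathbb R^p\times\mathbb R$ are independent, $\epsilon_i$ is independent of $\mathbf x_i$, $\mathbb E[\epsilon_i]=0$ and $\epsilon_i$ is sub-Gaussian with variance parameter $\sigma_\epsilon^2>0$. The covariates have a common second moment matrix $\Sigma=\mathbb E[\mathbf x_i\mathbf x_i^\top]$ with $\Sigma_{jj}\le 1/2$ and all eigenvalues in $[C_{\min},C_{\max}]$, $0<C_{\min}\le C_{\max}$; put $C_{\mathrm{cond}}=C_{\max}/C_{\min}$. For some $\kappa\ge1$, $\mathbb E[e^{\mathbf v^\top \mathbf x_i}]\le e^{\kappa^2\|\Sigma^{1/2}\mathbf v\|_2^2/2}$ for all $\mathbf v\in\mathbb R^p$. Assume $\|\beta_0\|_\infty/\sigma_\epsilon\le K$. Let $x_\star\in\mathbb R^p$, $x_\star\neq0$, be fixed and let $\mathbf U=\|x_\star\|_2\begin{bmatrix}\mathbf u_1\\ \mathbf R\end{bmatrix}$, where $\mathbf u_1=x_\star/\|x_\star\|_2$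 and the rows of $\mathbf R\in\mathbb R^{(p-1)\times p}$ are an orthonormal basis of $x_\star^\perp$. Write $[t_i,\mathbf z_i]=(\mathbf U^{-1})^\top\mathbf x_i$ with $t_i\in\mathbb R$, $\mathbf z_i\in\mathbb R^{p-1}$. Assume that $\mathbb E[t_i\mid\mathbf z_i]=\mathbf z_i^\top\mathbf g_0$, where $\mathbf g_0$ minimizes $\mathbf g\mapsto\mathbb E[(t_i-\mathbf z_i^\top\mathbf g)^2]$, and that $\eta_i=t_i-\mathbf z_i^\top\mathbf g_0$ is independent of $\mathbf z_i$. Put $\sigma_\eta^2=\mathbb E[\eta_i^2]$ and $\bar\sigma_\eta^2=\|x_\star\|_2^2\,\sigma_\eta^2$ (so $\bar\sigma_\eta=\sigma_\eta$ if $\|x_\star\|_2=1$). **Estimator.** From the first fold ($i\le n/2$), let $\hat\beta=\arg\min_\beta\sum_{i\le n/2}(y_i-\mathbf x_i^\top\beta)^2+\lambda_\beta\|\beta\|_2^2$ and $\hat{\mathbf g}=\arg\min_{\mathbf g}\sum_{i\le n/2}(t_i-\mathbf z_i^\top\mathbf g)^2+\lambda_{\mathbf g}\|\mathbf g\|_2^2$,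 and let $\hat{\mathbf f}$ consist of the last $p-1$ coordinates of $\mathbf U\hat\beta$. With $\mu_2=\frac{1}{n/2}\sum_{i>n/2}t_i(t_i-\mathbf z_i^\top\hat{\mathbf g})$, set $\hat y_{\mathrm{OM}}=x_\star^\top\hat\beta$ if $\mu_2\le\frac14\sigma_\eta^2$, and otherwise $$\hat y_{\mathrm{OM}}=\frac1{\mu_2}\cdot\frac{1}{n/2}\sum_{i>n/2}(y_i-\mathbf z_i^\top\hat{\mathbf f})(t_i-\mathbf z_i^\top\hat{\mathbf g}).$$ **Claim.** There are universal constants $c_1,\dots,c_5>0$, and for all $\kappa,C_{\min},C_{\max},K$ a constant $C>0$ depending only on these four numbers, such that the following holds whenever $n\ge c_5\kappa^4C_{\mathrm{cond}}^2\,p$, $$c_1\frac{n^2C_{\min}}{p\,C_{\mathrm{cond}}}e^{-c_2n/(\kappa^4C_{\mathrm{cond}}^2)}\le\lambda_\beta\le c_3\,(C_{\mathrm{cond}}C_{\max}n)^{1/3},$$ $$c_4\frac{n^2C_{\min}}{p\,C_{\mathrm{cond}}}e^{-c_2n/(\kappa^4C_{\mathrm{cond}}^2)}\le\|x_\star\|_2^2\lambda_{\mathbf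 g}\le p\Big(\frac{C_{\max}}{C_{\mathrm{cond}}}\,\frac np\,\bar\sigma_\eta^4\Big)^{1/3}.$$ The risk $\mathcal R=\mathbb E[(\hat y_{\mathrm{OM}}-x_\star^\top\beta_0)^2]$ is finite, and $$\mathcal R\le C\|x_\star\|_2^2\Big[\frac{\sigma_\epsilon^2}{\bar\sigma_\eta^2n}+\frac{\sigma_\epsilon^2p^2}{\bar\sigma_\eta^4n^2}+\frac{\sigma_\epsilon^2\,p\,(\bar\sigma_\eta^2+1)}{\bar\sigma_\eta^4n^2}\Big].$$ In particular, if $\sigma_\epsilon^2\le S$ with $S\ge1$, then $$\mathcal R\le C S\,\|x_\star\|_2^2\Big[\frac{\sigma_\epsilon^2}{\bar\sigma_\eta^2n}+\frac{p^2}{\bar\sigma_\eta^4n^2}+\frac{p(\bar\sigma_\eta^2+\sigma_\epsilon^2)}{\bar\sigma_\eta^4n^2}\Big],$$ and if $n\ge a p^2$ with $a>0$, then $\mathcal R\le C(1+1/a)\,\|x_\star\|_2^2\,\sigma_\epsilon^2/n$. -/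

import Mathlib

open MeasureTheory ProbabilityTheory
open scoped Matrix

namespace OMRidge

noncomputable section

/-- Euclidean norm of a coordinate vector (the norm of the bare type `Fin k → ℝ` is the sup norm). -/
def l2norm {k : ℕ} (v : Fin k → ℝ) : ℝ := ‖WithLp.toLp 2 v‖

/-- The rows of `R` are orthonormal and orthogonal to `xs`; for `xs ≠ 0` there are `d` of them in
dimension `d + 1`, so they span the orthogonal complement of `xs`. -/
def IsOrthoComplement {d : ℕ} (xs : Fin (d + 1) → ℝ)
    (R : Matrix (Fin d) (Fin (d + 1)) ℝ) : Prop :=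
  R * Rᵀ = 1 ∧ R *ᵥ xs = 0

/-- `U = ‖xs‖₂ [u₁ ; R]` where `u₁ = xs / ‖xs‖₂` is the first row. -/
def reparam {d : ℕ} (xs : Fin (d + 1) → ℝ) (R : Matrix (Fin d) (Fin (d + 1)) ℝ) :
    Matrix (Fin (d + 1)) (Fin (d + 1)) ℝ :=
  l2norm xs • Matrix.of (Matrix.vecCons ((l2norm xs)⁻¹ • xs) R)

/-- The reparametrized covariate `x' = [t, z] = (U⁻¹)ᵀ x`. -/
def newCov {d : ℕ} (xs : Fin (d + 1) → ℝ) (R : Matrix (Fin d) (Fin (d + 1)) ℝ)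
    (x : Fin (d + 1) → ℝ) : Fin (d + 1) → ℝ :=
  ((reparam xs R)⁻¹)ᵀ *ᵥ x

/-- The treatment coordinate `t` of `x' = [t, z]`. -/
def tPart {d : ℕ} (xs : Fin (d + 1) → ℝ) (R : Matrix (Fin d) (Fin (d + 1)) ℝ)
    (x : Fin (d + 1) → ℝ) : ℝ :=
  newCov xs R x 0

/-- The remaining coordinates `z` of `x' = [t, z]`. -/
def zPart {d : ℕ} (xs : Fin (d + 1) → ℝ) (R : Matrix (Fin d) (Fin (d + 1)) ℝ)
    (x : Fin (d + 1) → ℝ) : Fin d → ℝ :=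
  Fin.tail (newCov xs R x)

/-- The nuisance part `f` of `U β = [θ, f]`. -/
def fPart {d : ℕ} (xs : Fin (d + 1) → ℝ) (R : Matrix (Fin d) (Fin (d + 1)) ℝ)
    (b : Fin (d + 1) → ℝ) : Fin d → ℝ :=
  Fin.tail (reparam xs R *ᵥ b)

/-- `‖y - X b‖₂² + lam ‖b‖₂²`, the sample being restricted to the indices in `s`. -/
def ridgeObjective {n k : ℕ} (s : Finset (Fin n)) (lam : ℝ) (X : Fin n → Fin k → ℝ)
    (y : Fin n → ℝ) (b : Fin k → ℝ) : ℝ :=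
  ∑ i ∈ s, (y i - X i ⬝ᵥ b) ^ 2 + lam * l2norm b ^ 2

/-- `b` is a ridge estimate from the observations `(X i, y i)`, `i ∈ s`. -/
def IsRidge {n k : ℕ} (s : Finset (Fin n)) (lam : ℝ) (X : Fin n → Fin k → ℝ)
    (y : Fin n → ℝ) (b : Fin k → ℝ) : Prop :=
  ∀ b' : Fin k → ℝ, ridgeObjective s lam X y b ≤ ridgeObjective s lam X y b'

/-- The first half of the sample. -/
def fold1 (n : ℕ) : Finset (Fin n) := Finset.univ.filter fun i => (i : ℕ) < n / 2

/-- The second half of the sample. -/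
def fold2 (n : ℕ) : Finset (Fin n) := Finset.univ.filter fun i => n / 2 ≤ (i : ℕ)

/-- `μ₂ = (n/2)⁻¹ ∑ tᵢ (tᵢ - zᵢᵀ ghat)`, the sum being over the second fold. -/
def secondMoment {n d : ℕ} (xs : Fin (d + 1) → ℝ) (R : Matrix (Fin d) (Fin (d + 1)) ℝ)
    (X : Fin n → Fin (d + 1) → ℝ) (ghat : Fin d → ℝ) : ℝ :=
  ((n : ℝ) / 2)⁻¹ *
    ∑ i ∈ fold2 n, tPart xs R (X i) * (tPart xs R (X i) - zPart xs R (X i) ⬝ᵥ ghat)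

/-- The thresholded orthogonal moment prediction at `xs` (based on the `f` moments), for
first-stage estimates `bhat` of `β₀` and `ghat` of `g₀` and threshold `τ`. -/
def omPrediction {n d : ℕ} (xs : Fin (d + 1) → ℝ) (R : Matrix (Fin d) (Fin (d + 1)) ℝ)
    (τ : ℝ) (X : Fin n → Fin (d + 1) → ℝ) (y : Fin n → ℝ)
    (bhat : Fin (d + 1) → ℝ) (ghat : Fin d → ℝ) : ℝ :=
  if secondMoment xs R X ghat ≤ τ then xs ⬝ᵥ bhat
  else
    ((n : ℝ) / 2)⁻¹ *
      (∑ i ∈ fold2 n, (y i - zPart xs R (X i) ⬝ᵥ fPart xs R bhat) *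
        (tPart xs R (X i) - zPart xs R (X i) ⬝ᵥ ghat)) / secondMoment xs R X ghat

/-- The residual `η = t - zᵀ g₀`. -/
def etaPart {d : ℕ} (xs : Fin (d + 1) → ℝ) (R : Matrix (Fin d) (Fin (d + 1)) ℝ)
    (g₀ : Fin d → ℝ) (x : Fin (d + 1) → ℝ) : ℝ :=
  tPart xs R x - zPart xs R x ⬝ᵥ g₀

/-- The random design linear model `yᵢ = xᵢᵀ β₀ + εᵢ`: independent data points, noise independent
of the covariates, common second moment matrix `Sig` with bounded spectrum, sub-Gaussian design and
sub-Gaussian noise with variance parameter `σε ^ 2`. -/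
structure LinearModel {Ω : Type*} [MeasurableSpace Ω] (P : Measure Ω) {n k : ℕ}
    (κ Cmin Cmax σε : ℝ) (Sig : Matrix (Fin k) (Fin k) ℝ) (β₀ : Fin k → ℝ)
    (x : Fin n → Ω → Fin k → ℝ) (ε y : Fin n → Ω → ℝ) : Prop where
  measurable_x : ∀ i, Measurable (x i)
  measurable_noise : ∀ i, Measurable (ε i)
  model : ∀ i ω, y i ω = x i ω ⬝ᵥ β₀ + ε i ω
  indep : iIndepFun (fun i ω => (x i ω, ε i ω)) P
  indep_noise : ∀ i, IndepFun (x i) (ε i) P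
  noise_mean : ∀ i, ∫ ω, ε i ω ∂P = 0
  cov : ∀ i j l, ∫ ω, x i ω j * x i ω l ∂P = Sig j l
  cov_diag : ∀ j, Sig j j ≤ 1 / 2
  /-- the least eigenvalue of the symmetric matrix `Sig` is at least `Cmin` -/
  cov_min : ∀ v : Fin k → ℝ, Cmin * l2norm v ^ 2 ≤ v ⬝ᵥ Sig *ᵥ v
  /-- the largest eigenvalue of the symmetric matrix `Sig` is at most `Cmax` -/
  cov_max : ∀ v : Fin k → ℝ, v ⬝ᵥ Sig *ᵥ v ≤ Cmax * l2norm v ^ 2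
  /-- `E exp (s vᵀ xᵢ) ≤ exp (κ² ‖Sig^{1/2} (s v)‖₂² / 2)` for all real `s` and all `v` -/
  design_subgaussian : ∀ i (v : Fin k → ℝ),
    HasSubgaussianMGF (fun ω => v ⬝ᵥ x i ω) (Real.toNNReal (κ ^ 2 * (v ⬝ᵥ Sig *ᵥ v))) P
  noise_subgaussian : ∀ i, HasSubgaussianMGF (ε i) (Real.toNNReal (σε ^ 2)) P

/-- The treatment model `tᵢ = g₀(zᵢ) + ηᵢ`, where `g₀(zᵢ) = E[tᵢ | zᵢ]` is the linear function
`zᵢᵀ g₀` given by the least squares coefficient `g₀`, where `ηᵢ` is independent of `zᵢ`, and where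
`E[ηᵢ²] = ση ^ 2`. -/
structure TreatmentModel {Ω : Type*} [MeasurableSpace Ω] (P : Measure Ω) {n d : ℕ} (ση : ℝ)
    (xs : Fin (d + 1) → ℝ) (R : Matrix (Fin d) (Fin (d + 1)) ℝ) (g₀ : Fin d → ℝ)
    (x : Fin n → Ω → Fin (d + 1) → ℝ) : Prop where
  argmin : ∀ i (g : Fin d → ℝ),
    ∫ ω, (tPart xs R (x i ω) - zPart xs R (x i ω) ⬝ᵥ g₀) ^ 2 ∂P ≤
      ∫ ω, (tPart xs R (x i ω) - zPart xs R (x i ω) ⬝ᵥ g) ^ 2 ∂P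
  condExp_eq : ∀ i,
    P[fun ω => tPart xs R (x i ω) |
        MeasurableSpace.comap (fun ω => zPart xs R (x i ω)) inferInstance]
      =ᵐ[P] fun ω => zPart xs R (x i ω) ⬝ᵥ g₀
  indep_eta : ∀ i,
    IndepFun (fun ω => etaPart xs R g₀ (x i ω)) (fun ω => zPart xs R (x i ω)) P
  eta_var : ∀ i, ∫ ω, etaPart xs R g₀ (x i ω) ^ 2 ∂P = ση ^ 2

end

end OMRidge

/-! Divide out `l2norm xs` and put T = u·x, Z = R x and H = T − Z·g₀, with u the unit vector along
`xs`. Let Δf = R(bhat − β₀) and Δg = ghat − g₀. Since β₀ splits along u and the rows of R, the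
prediction error is `l2norm xs` times N/M, where N is the second-fold average of (ε − Z·Δf)(H −
Z·Δg) and M that of T(H − Z·Δg); below the threshold N/M is replaced by u·(bhat − β₀)
(`IsOrthoComplement.omPrediction_sub`).

The moment is orthogonal: ε and H are both uncorrelated with Z. Expanding N, the average of εH has
size σ/√n. The averages of εZ and HZ have norms of order σ√(p/n) and √(p/n) and are paired with Δg
and Δf. The last term is bilinear in (Δf, Δg). Hence, once E‖bhat − β₀‖⁴ ≲ σ⁴p²/n² and E‖Δg‖⁴ ≲
p²/n², N² has expectation ≲ σ²(1/n + p²/n²). Falling below the threshold forces M far from its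
target s2 = E[TH], the residual variance, and is paid for by moments of the same kind. The
deterministic inequality `sq_error_le` records all this. Products are split by weighted AM-GM, so
bhat and ghat may depend on each other; independence of the folds is needed only for terms such as
(Z·Δf)⁴, where the fresh covariate is integrated out first.

The ridge fourth moments come from `expLe_ridge_error`. When the Gram matrix is bounded below by a
multiple of n, the usual basic inequality gives the rate, and the upper bounds on the penalties keep
the bias of the same order. On the exceptional event the penalty alone gives a crude bound with 1/λ;
the exponentially small lower bound on λ is just large enough for the probability of the event to
absorb it. That probability is bounded in `LinearModel.measure_gram_le` by Chernoff bounds for each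
fixed direction and a volume argument in place of a net.

The outcome is σ²(1/n + p²/n²) up to a constant. As Cmin ≤ s2 ≤ Cmax
(`TreatmentModel.residual_bounds`), the powers of s2 in the claimed bounds cost only constants
(`risk_bounds_of_le`). -/

namespace OMRidge

/-! ### Bounds on expectations, moments of independent sums and of sub-Gaussian variables. -/

variable {Ω : Type*} [MeasurableSpace Ω] {P : Measure Ω}

/-- `f` is integrable with expectation at most `B`. -/
def ExpLe (P : Measure Ω) (f : Ω → ℝ) (B : ℝ) : Prop :=
  Integrable f P ∧ ∫ ω, f ω ∂P ≤ B

theorem ExpLe.mono_bound {f : Ω → ℝ} {A B : ℝ} (h : ExpLe P f A) (hAB : A ≤ B) :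
    ExpLe P f B := ⟨h.1, h.2.trans hAB⟩

theorem ExpLe.add {f g : Ω → ℝ} {A B : ℝ} (hf : ExpLe P f A) (hg : ExpLe P g B) :
    ExpLe P (fun ω => f ω + g ω) (A + B) :=
  ⟨hf.1.add hg.1, by rw [integral_add hf.1 hg.1]; exact add_le_add hf.2 hg.2⟩

theorem ExpLe.const_mul {f : Ω → ℝ} {A c : ℝ} (hc : 0 ≤ c) (hf : ExpLe P f A) :
    ExpLe P (fun ω => c * f ω) (c * A) :=
  ⟨hf.1.const_mul c, by rw [integral_const_mul]; exact mul_le_mul_of_nonneg_left hf.2 hc⟩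

theorem ExpLe.sum {ι : Type*} {s : Finset ι} {f : ι → Ω → ℝ} {A : ℝ}
    (h : ∀ i ∈ s, ExpLe P (f i) A) : ExpLe P (fun ω => ∑ i ∈ s, f i ω) (s.card * A) := by
  refine ⟨integrable_finsetSum _ fun i hi => (h i hi).1, ?_⟩
  rw [integral_finsetSum _ fun i hi => (h i hi).1, ← nsmul_eq_mul]
  exact Finset.sum_le_card_nsmul _ _ _ fun i hi => (h i hi).2

theorem ExpLe.mono {f g : Ω → ℝ} {A : ℝ} (hg : ExpLe P g A) (hf : AEStronglyMeasurable f P)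
    (h0 : ∀ ω, 0 ≤ f ω) (hfg : ∀ ω, f ω ≤ g ω) : ExpLe P f A := by
  have hi : Integrable f P := hg.1.mono' hf
    (Filter.Eventually.of_forall fun ω => by rw [Real.norm_of_nonneg (h0 ω)]; exact hfg ω)
  exact ⟨hi, (integral_mono hi hg.1 hfg).trans hg.2⟩

theorem ExpLe.const [IsProbabilityMeasure P] (c : ℝ) : ExpLe P (fun _ => c) c :=
  ⟨integrable_const c, by simp⟩

theorem ExpLe.nonneg {f : Ω → ℝ} {A : ℝ} (h : ExpLe P f A) (h0 : ∀ ω, 0 ≤ f ω) : 0 ≤ A :=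
  (integral_nonneg h0).trans h.2

theorem integrable_pow_of_fourth [IsFiniteMeasure P] {f : Ω → ℝ} (hf : AEStronglyMeasurable f P)
    (h4 : Integrable (fun ω => f ω ^ 4) P) {q : ℕ} (hq : q ≤ 4) :
    Integrable (fun ω => f ω ^ q) P := by
  refine ((integrable_const (1 : ℝ)).add h4).mono' (hf.pow q) (Filter.Eventually.of_forall ?_)
  intro ω
  simp only [norm_pow, Real.norm_eq_abs, Pi.add_apply]
  have h4' : f ω ^ 4 = |f ω| ^ 4 := by rw [← abs_pow, abs_of_nonneg (by positivity)]
  rw [h4']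
  have ha := abs_nonneg (f ω)
  rcases le_total (|f ω|) 1 with h | h
  · have := pow_le_one₀ (n := q) ha h
    have : 0 ≤ |f ω| ^ 4 := by positivity
    linarith
  · have := pow_le_pow_right₀ h hq
    linarith

/-- Jensen's inequality in linear form: f² ≤ A/2 + f⁴/(2A), because (A − f²)² ≥ 0. -/
theorem ExpLe.sq_of_fourth [IsProbabilityMeasure P] {f : Ω → ℝ} {A : ℝ} (hA : 0 < A)
    (hf : AEStronglyMeasurable f P) (h4 : ExpLe P (fun ω => f ω ^ 4) (A ^ 2)) :
    ExpLe P (fun ω => f ω ^ 2) A := by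
  have h := ((ExpLe.const (P := P) (A / 2)).add (h4.const_mul (c := 1 / (2 * A)) (by positivity)))
  refine (h.mono (f := fun ω => f ω ^ 2) (hf.pow 2) (fun ω => by positivity) fun ω => ?_).mono_bound
    (le_of_eq (by field_simp; ring))
  have : A / 2 + 1 / (2 * A) * f ω ^ 4 - f ω ^ 2 = (A - f ω ^ 2) ^ 2 / (2 * A) := by
    field_simp; ring
  have h2 : 0 ≤ (A - f ω ^ 2) ^ 2 / (2 * A) := by positivity
  linarith

/-- Second and fourth moments of a sum of independent centred random variables. -/
theorem expLe_sum_fourth [IsProbabilityMeasure P] {ι : Type*} {W : ι → Ω → ℝ} {A : ℝ} (hA : 0 < A)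
    (hind : iIndepFun W P) (hmeas : ∀ i, Measurable (W i)) (hmean : ∀ i, ∫ ω, W i ω ∂P = 0)
    (h4 : ∀ i, ExpLe P (fun ω => W i ω ^ 4) (A ^ 2)) (s : Finset ι) :
    (∫ ω, (∑ i ∈ s, W i ω) ∂P = 0) ∧
    ExpLe P (fun ω => (∑ i ∈ s, W i ω) ^ 2) (s.card * A) ∧
    ExpLe P (fun ω => (∑ i ∈ s, W i ω) ^ 4) (3 * (s.card * A) ^ 2) := by
  classical
  induction s using Finset.induction_on with
  | empty => simp [ExpLe]
  | insert i s hi ih =>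
    obtain ⟨ih1, ih2, ih4⟩ := ih
    have hSm : Measurable (fun ω => ∑ j ∈ s, W j ω) := Finset.measurable_sum _ fun j _ => hmeas j
    have hI : IndepFun (fun ω => ∑ j ∈ s, W j ω) (W i) P := by
      have := hind.indepFun_finsetSum_of_notMem hmeas hi
      convert this using 1
      ext ω; simp
    set S : Ω → ℝ := fun ω => ∑ j ∈ s, W j ω with hS
    have hSi : ∀ q ≤ 4, Integrable (fun ω => S ω ^ q) P := fun q hq =>
      integrable_pow_of_fourth hSm.aestronglyMeasurable ih4.1 hq
    have hWi : ∀ q ≤ 4, Integrable (fun ω => W i ω ^ q) P := fun q hq =>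
      integrable_pow_of_fourth (hmeas i).aestronglyMeasurable (h4 i).1 hq
    have hW2 := ExpLe.sq_of_fourth hA (hmeas i).aestronglyMeasurable (h4 i)
    have hpow : ∀ a b : ℕ, IndepFun (fun ω => S ω ^ a) (fun ω => W i ω ^ b) P := fun a b =>
      hI.comp (φ := fun x : ℝ => x ^ a) (ψ := fun x : ℝ => x ^ b) (by fun_prop) (by fun_prop)
    have hint : ∀ a ≤ 4, ∀ b ≤ 4, Integrable (fun ω => S ω ^ a * W i ω ^ b) P := fun a ha b hb =>
      (hpow a b).integrable_mul (hSi a ha) (hWi b hb)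
    have hval : ∀ a ≤ 4, ∀ b ≤ 4, ∫ ω, S ω ^ a * W i ω ^ b ∂P =
        (∫ ω, S ω ^ a ∂P) * ∫ ω, W i ω ^ b ∂P := fun a ha b hb =>
      (hpow a b).integral_fun_mul_eq_mul_integral (hSi a ha).1 (hWi b hb).1
    have hS1 : ∫ ω, S ω ^ 1 ∂P = 0 := by simpa using ih1
    have hW1 : ∫ ω, W i ω ^ 1 ∂P = 0 := by simpa using hmean i
    have hc : ((insert i s).card : ℝ) = s.card + 1 := by
      rw [Finset.card_insert_of_notMem hi]; push_cast; ring
    have hsum : ∀ ω, ∑ j ∈ insert i s, W j ω = S ω + W i ω := fun ω => by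
      rw [Finset.sum_insert hi, add_comm]
    simp only [hsum, hc]
    refine ⟨?_, ?_, ?_⟩
    · rw [integral_add (by simpa using hSi 1 (by norm_num)) (by simpa using hWi 1 (by norm_num)),
        ih1, hmean i, add_zero]
    · have e : (fun ω => (S ω + W i ω) ^ 2) = fun ω =>
          S ω ^ 2 + (2 * (S ω ^ 1 * W i ω ^ 1) + W i ω ^ 2) := by ext ω; ring
      rw [e]
      have i1 := (hint 1 (by norm_num) 1 (by norm_num)).const_mul 2
      have i2 : Integrable (fun ω => 2 * (S ω ^ 1 * W i ω ^ 1) + W i ω ^ 2) P :=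
        i1.add (hWi 2 (by norm_num))
      refine ⟨(hSi 2 (by norm_num)).add i2, ?_⟩
      rw [integral_add (hSi 2 (by norm_num)) i2, integral_add i1 (hWi 2 (by norm_num)), integral_const_mul,
        hval 1 (by norm_num) 1 (by norm_num), hS1]
      linarith [ih2.2, hW2.2]
    · have e : (fun ω => (S ω + W i ω) ^ 4) = fun ω =>
          S ω ^ 4 + (4 * (S ω ^ 3 * W i ω ^ 1) + (6 * (S ω ^ 2 * W i ω ^ 2) +
            (4 * (S ω ^ 1 * W i ω ^ 3) + W i ω ^ 4))) := by ext ω; ring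
      rw [e]
      have i31 := (hint 3 (by norm_num) 1 (by norm_num)).const_mul 4
      have i22 := (hint 2 (by norm_num) 2 (by norm_num)).const_mul 6
      have i13 := (hint 1 (by norm_num) 3 (by norm_num)).const_mul 4
      have i4 := hWi 4 le_rfl
      have j1 : Integrable (fun ω => 4 * (S ω ^ 1 * W i ω ^ 3) + W i ω ^ 4) P := i13.add i4
      have j2 : Integrable (fun ω => 6 * (S ω ^ 2 * W i ω ^ 2) +
          (4 * (S ω ^ 1 * W i ω ^ 3) + W i ω ^ 4)) P := i22.add j1
      have j3 : Integrable (fun ω => 4 * (S ω ^ 3 * W i ω ^ 1) + (6 * (S ω ^ 2 * W i ω ^ 2) +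
          (4 * (S ω ^ 1 * W i ω ^ 3) + W i ω ^ 4))) P := i31.add j2
      refine ⟨(hSi 4 le_rfl).add j3, ?_⟩
      rw [integral_add (hSi 4 le_rfl) j3, integral_add i31 j2, integral_add i22 j1,
        integral_add i13 i4, integral_const_mul, integral_const_mul, integral_const_mul,
        hval 3 (by norm_num) 1 (by norm_num), hval 2 (by norm_num) 2 (by norm_num),
        hval 1 (by norm_num) 3 (by norm_num), hS1, hW1]
      have h22 : (∫ ω, S ω ^ 2 ∂P) * ∫ ω, W i ω ^ 2 ∂P ≤ (s.card * A) * A :=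
        mul_le_mul ih2.2 hW2.2 (integral_nonneg fun ω => by positivity) (by positivity)
      have := ih4.2
      have := (h4 i).2
      -- The odd cross terms vanish. With m = `s.card` what remains is 3m²A² + 6mA² + A² ≤ 3(m +
      -- 1)²A².
      nlinarith [sq_nonneg A]

theorem HasSubgaussianMGF.mgf_le_of_le {X : Ω → ℝ} {τ : NNReal} (h : HasSubgaussianMGF X τ P)
    {T : ℝ} (hτ : (τ : ℝ) ≤ T) (t : ℝ) :
    ExpLe P (fun ω => Real.exp (t * X ω)) (Real.exp (T * t ^ 2 / 2)) :=
  ⟨h.integrable_exp_mul t, (h.mgf_le t).trans (Real.exp_le_exp.2 (by gcongr))⟩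

/-- Even moments of a sub-Gaussian random variable. -/
theorem HasSubgaussianMGF.even_moment {X : Ω → ℝ} {τ : NNReal} (h : HasSubgaussianMGF X τ P)
    {T : ℝ} (hT : 0 < T) (hτ : (τ : ℝ) ≤ T) (q : ℕ) :
    ExpLe P (fun ω => X ω ^ (2 * q)) (4 * (2 * q).factorial * T ^ q) := by
  -- This scale makes T t² = 1, so the exponential moments at t and −t are both at most e^{1/2} ≤ 2,
  -- while |tX|^{2q} ≤ (2q)! (e^{tX} + e^{−tX}).
  set t : ℝ := (Real.sqrt T)⁻¹ with ht
  have hs : 0 < Real.sqrt T := Real.sqrt_pos.2 hT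
  have ht2 : T * t ^ 2 = 1 := by
    rw [ht, inv_pow, Real.sq_sqrt hT.le]; field_simp
  have h1 := HasSubgaussianMGF.mgf_le_of_le h hτ t
  have h2 := HasSubgaussianMGF.mgf_le_of_le h hτ (-t)
  have hexp : Real.exp (1 / 2) ≤ 2 := by
    have h9 := Real.exp_one_lt_d9
    have : Real.exp (1 / 2) ^ 2 = Real.exp 1 := by rw [← Real.exp_nat_mul]; norm_num
    nlinarith [Real.exp_pos (1 / 2)]
  have hg := ((h1.add h2).const_mul (c := (2 * q).factorial * T ^ q) (by positivity))
  have e1 : Real.exp (T * t ^ 2 / 2) ≤ 2 := by rw [ht2]; exact hexp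
  have e2 : Real.exp (T * (-t) ^ 2 / 2) ≤ 2 := by rw [neg_sq, ht2]; exact hexp
  refine (hg.mono (f := fun ω => X ω ^ (2 * q)) (h.aestronglyMeasurable.pow _) (fun ω => ?_) fun ω => ?_).mono_bound ?_
  · rw [pow_mul]; positivity
  · have hb := Real.pow_div_factorial_le_exp (|t * X ω|) (abs_nonneg _) (2 * q)
    have hb2 : Real.exp (|t * X ω|) ≤ Real.exp (t * X ω) + Real.exp (-t * X ω) := by
      rw [neg_mul]
      rcases abs_cases (t * X ω) with ⟨h, -⟩ | ⟨h, -⟩ <;> rw [h] <;>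
        linarith [Real.exp_pos (t * X ω), Real.exp_pos (-(t * X ω))]
    have hx : |t * X ω| ^ (2 * q) = t ^ (2 * q) * X ω ^ (2 * q) := by
      rw [pow_mul, sq_abs, mul_pow, mul_pow, ← pow_mul, ← pow_mul]
    rw [hx, div_le_iff₀ (by positivity)] at hb
    have hTt : T ^ q * t ^ (2 * q) = 1 := by rw [pow_mul, ← mul_pow, ht2, one_pow]
    calc X ω ^ (2 * q) = T ^ q * (t ^ (2 * q) * X ω ^ (2 * q)) := by
          rw [← mul_assoc, hTt, one_mul]
      _ ≤ T ^ q * (Real.exp (|t * X ω|) * (2 * q).factorial) := by gcongr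
      _ ≤ T ^ q * ((Real.exp (t * X ω) + Real.exp (-t * X ω)) * (2 * q).factorial) := by gcongr
      _ = _ := by ring
  · have : (0 : ℝ) ≤ (2 * q).factorial * T ^ q := by positivity
    nlinarith

/-- If `X` is sub-Gaussian with parameter at most `T`, then `E exp (X ^ 2 / (4 T)) ≤ √2`. -/
theorem HasSubgaussianMGF.exp_sq [SFinite P] {X : Ω → ℝ} {τ : NNReal}
    (h : HasSubgaussianMGF X τ P) (hX : Measurable X)
    {T : ℝ} (hT : 0 < T) (hτ : (τ : ℝ) ≤ T) :
    ExpLe P (fun ω => Real.exp (X ω ^ 2 / (4 * T))) (Real.sqrt 2) := by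
  have hs2T : 0 < Real.sqrt (2 * T) := Real.sqrt_pos.2 (by positivity)
  -- Gaussian linearisation: √(2π) exp(a²/2) is the integral of exp(a g − g²/2) over g, and a²/2 =
  -- X²/(4T). After exchanging integrals the sub-Gaussian bound leaves the integral of exp(−g²/4),
  -- which is √(4π).
  set a : Ω → ℝ := fun ω => X ω / Real.sqrt (2 * T) with ha
  have ham : Measurable a := by fun_prop
  have hgauss : ∀ b : ℝ, 0 < b → ∫⁻ g : ℝ, ENNReal.ofReal (Real.exp (-b * g ^ 2)) =
      ENNReal.ofReal (Real.sqrt (Real.pi / b)) := fun b hb => by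
    rw [← integral_gaussian, ofReal_integral_eq_lintegral_ofReal (integrable_exp_neg_mul_sq hb)]
    exact Filter.Eventually.of_forall fun g => (Real.exp_pos _).le
  have hinner : ∀ ω, ∫⁻ g : ℝ, ENNReal.ofReal (Real.exp (a ω * g - g ^ 2 / 2)) =
      ENNReal.ofReal (Real.exp (X ω ^ 2 / (4 * T))) * ENNReal.ofReal (Real.sqrt (2 * Real.pi)) := by
    intro ω
    have e : ∀ g : ℝ, ENNReal.ofReal (Real.exp (a ω * g - g ^ 2 / 2)) =
        ENNReal.ofReal (Real.exp (X ω ^ 2 / (4 * T))) *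
          ENNReal.ofReal (Real.exp (-(1 / 2) * (g - a ω) ^ 2)) := fun g => by
      rw [← ENNReal.ofReal_mul (Real.exp_pos _).le, ← Real.exp_add]
      congr 2
      have : a ω ^ 2 = X ω ^ 2 / (2 * T) := by
        rw [ha]; simp only [div_pow]; rw [Real.sq_sqrt (by positivity)]
      have h3 : X ω ^ 2 / (4 * T) = a ω ^ 2 / 2 := by rw [this]; field_simp; norm_num
      rw [h3]; ring
    simp_rw [e]
    rw [lintegral_const_mul _ (by fun_prop),
      lintegral_sub_right_eq_self (fun g => ENNReal.ofReal (Real.exp (-(1 / 2) * g ^ 2))) (a ω),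
      hgauss _ (by norm_num)]
    congr 3; ring
  have hswap : (∫⁻ ω, ENNReal.ofReal (Real.exp (X ω ^ 2 / (4 * T))) ∂P) *
      ENNReal.ofReal (Real.sqrt (2 * Real.pi)) ≤ ENNReal.ofReal (Real.sqrt (4 * Real.pi)) := by
    rw [← lintegral_mul_const _ (by fun_prop)]
    simp_rw [← hinner]
    rw [lintegral_lintegral_swap (by fun_prop)]
    have h4 : ENNReal.ofReal (Real.sqrt (4 * Real.pi)) =
        ∫⁻ g : ℝ, ENNReal.ofReal (Real.exp (-(1 / 4) * g ^ 2)) := by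
      rw [hgauss _ (by norm_num)]; congr 2; ring
    rw [h4]
    refine lintegral_mono fun g => ?_
    have hm := HasSubgaussianMGF.mgf_le_of_le h hτ (g / Real.sqrt (2 * T))
    have e : ∀ ω, ENNReal.ofReal (Real.exp (a ω * g - g ^ 2 / 2)) =
        ENNReal.ofReal (Real.exp (-(g ^ 2 / 2))) *
          ENNReal.ofReal (Real.exp (g / Real.sqrt (2 * T) * X ω)) := fun ω => by
      rw [← ENNReal.ofReal_mul (Real.exp_pos _).le, ← Real.exp_add]
      congr 2; rw [ha]; ring
    simp_rw [e]
    rw [lintegral_const_mul _ (by fun_prop), ← ofReal_integral_eq_lintegral_ofReal hm.1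
      (Filter.Eventually.of_forall fun ω => (Real.exp_pos _).le),
      ← ENNReal.ofReal_mul (Real.exp_pos _).le]
    refine ENNReal.ofReal_le_ofReal ?_
    refine (mul_le_mul_of_nonneg_left hm.2 (Real.exp_pos _).le).trans (le_of_eq ?_)
    rw [← Real.exp_add, div_pow, Real.sq_sqrt (by positivity)]
    congr 1; field_simp; ring
  have hpi : 0 < Real.sqrt (2 * Real.pi) := Real.sqrt_pos.2 (by positivity)
  have hfin : ∫⁻ ω, ENNReal.ofReal (Real.exp (X ω ^ 2 / (4 * T))) ∂P ≤
      ENNReal.ofReal (Real.sqrt 2) := by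
    have e : Real.sqrt (4 * Real.pi) = Real.sqrt 2 * Real.sqrt (2 * Real.pi) := by
      rw [← Real.sqrt_mul (by norm_num)]; congr 1; ring
    rw [e, ENNReal.ofReal_mul (Real.sqrt_nonneg _)] at hswap
    exact (ENNReal.mul_le_mul_iff_left (by simpa using hpi) ENNReal.ofReal_ne_top).1 hswap
  have hint : Integrable (fun ω => Real.exp (X ω ^ 2 / (4 * T))) P := by
    refine ⟨(by fun_prop), ?_⟩
    rw [hasFiniteIntegral_iff_ofReal (Filter.Eventually.of_forall fun ω => (Real.exp_pos _).le)]
    exact hfin.trans_lt ENNReal.ofReal_lt_top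
  refine ⟨hint, ?_⟩
  rw [← ENNReal.ofReal_le_ofReal_iff (Real.sqrt_nonneg _), ofReal_integral_eq_lintegral_ofReal hint
    (Filter.Eventually.of_forall fun ω => (Real.exp_pos _).le)]
  exact hfin

end OMRidge

/-! ### A volume argument for random sets, and Chernoff bounds for sums of squares. -/

namespace OMRidge

variable {Ω : Type*} [MeasurableSpace Ω] {P : Measure Ω}

/-- If every point of the shell `1/2 ≤ ‖v‖ ≤ 2` is covered by the random set `{v | (ω, v) ∈ A}` with
probability at most `q`, then this set contains a ball of radius `δ` around a unit vector with
probability at most `(2 / δ) ^ k * q`. -/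
theorem measure_exists_ball_subset_le [IsProbabilityMeasure P] {E : Type*} [NormedAddCommGroup E]
    [NormedSpace ℝ E] [FiniteDimensional ℝ E] [MeasurableSpace E] [BorelSpace E]
    {A : Set (Ω × E)} (hA : MeasurableSet A) {δ q : ℝ}
    (hδ : 0 < δ) (hδ' : δ ≤ 1 / 2) (hq0 : 0 ≤ q)
    (hq : ∀ v : E, 1 / 2 ≤ ‖v‖ → ‖v‖ ≤ 2 → P.real {ω | (ω, v) ∈ A} ≤ q) :
    P.real {ω | ∃ u : E, ‖u‖ = 1 ∧ ∀ v ∈ Metric.ball u δ, (ω, v) ∈ A} ≤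
      (2 / δ) ^ Module.finrank ℝ E * q := by
  let vol : Measure E := Measure.addHaar
  -- The product measure of this set is computed in both orders. Slices at fixed v give at most q
  -- times the volume of the ball of radius 2; slices at fixed ω have volume at least that of a
  -- δ-ball whenever the event occurs, since δ ≤ 1/2 keeps the ball inside the shell.
  set S : Set (Ω × E) := A ∩ {z | 1 / 2 ≤ ‖z.2‖ ∧ ‖z.2‖ ≤ 2} with hS
  have hSm : MeasurableSet S := by
    refine hA.inter ?_
    have h1 : MeasurableSet {z : Ω × E | 1 / 2 ≤ ‖z.2‖} :=
      measurableSet_le measurable_const (by fun_prop)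
    have h2 : MeasurableSet {z : Ω × E | ‖z.2‖ ≤ 2} :=
      measurableSet_le (by fun_prop) measurable_const
    exact h1.inter h2
  set V := vol (Metric.ball (0 : E) 1) with hV
  have hV0 : V ≠ 0 := (Metric.measure_ball_pos vol 0 one_pos).ne'
  have hVt : V ≠ ⊤ := measure_ball_lt_top.ne
  have hprod : P.prod vol S ≤ ENNReal.ofReal q * (ENNReal.ofReal (2 ^ Module.finrank ℝ E) * V) := by
    rw [Measure.prod_apply_symm hSm, ← Measure.addHaar_closedBall vol 0 (by norm_num : (0:ℝ) ≤ 2),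
      ← lintegral_indicator_const Metric.isClosed_closedBall.measurableSet]
    refine lintegral_mono fun v => ?_
    by_cases hv : 1 / 2 ≤ ‖v‖ ∧ ‖v‖ ≤ 2
    · rw [Set.indicator_of_mem (by simpa using hv.2)]
      have h := hq v hv.1 hv.2
      rw [measureReal_def] at h
      refine (measure_mono fun ω hω => hω.1).trans
        ((ENNReal.le_ofReal_iff_toReal_le (measure_ne_top _ _) hq0).2 h)
    · have : (fun ω => (ω, v)) ⁻¹' S = ∅ := by
        ext ω; simp only [hS, Set.mem_preimage, Set.mem_inter_iff, Set.mem_ofPred_eq,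
          Set.mem_empty_iff_false, iff_false]
        exact fun h => hv h.2
      rw [this]; simp
  -- Markov's inequality for the slice volume. The event itself need not be measurable: it is only
  -- included in the set where the slice volume is large.
  have hmark : ENNReal.ofReal (δ ^ Module.finrank ℝ E) * V *
      P {ω | ∃ u : E, ‖u‖ = 1 ∧ ∀ v ∈ Metric.ball u δ, (ω, v) ∈ A} ≤ P.prod vol S := by
    rw [Measure.prod_apply hSm]
    refine le_trans ?_ (mul_meas_ge_le_lintegral (measurable_measure_prodMk_left hSm)
      (ENNReal.ofReal (δ ^ Module.finrank ℝ E) * V))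
    refine mul_le_mul_right (measure_mono fun ω hω => ?_) _
    obtain ⟨u, hu, hball⟩ := hω
    simp only [Set.mem_ofPred_eq]
    rw [← Measure.addHaar_ball_of_pos vol u hδ]
    refine measure_mono fun v hv => ⟨hball v hv, ?_⟩
    rw [Metric.mem_ball, dist_eq_norm] at hv
    have h1 := norm_sub_norm_le u v
    have h2 := norm_sub_norm_le v u
    rw [norm_sub_rev] at h1
    constructor <;> simp only <;> linarith
  have hfin := hmark.trans hprod
  have e : ENNReal.ofReal (δ ^ Module.finrank ℝ E) *
      P {ω | ∃ u : E, ‖u‖ = 1 ∧ ∀ v ∈ Metric.ball u δ, (ω, v) ∈ A} ≤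
      ENNReal.ofReal q * ENNReal.ofReal (2 ^ Module.finrank ℝ E) := by
    rw [← ENNReal.mul_le_mul_iff_left hV0 hVt]
    calc _ = _ := by ring
      _ ≤ _ := hfin
      _ = _ := by ring
  rw [← ENNReal.ofReal_mul hq0, ← ofReal_measureReal, ← ENNReal.ofReal_mul (by positivity),
    ENNReal.ofReal_le_ofReal_iff (by positivity)] at e
  rw [div_pow, div_mul_eq_mul_div, le_div_iff₀ (by positivity)]
  linarith

section Tails

variable [IsProbabilityMeasure P] {ι : Type*} {X : ι → Ω → ℝ} {κ V : ℝ} {τ : ι → NNReal}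

/-- Chernoff's method at a negative parameter: e^{−y} ≤ 1 − y + y²/2 for y ≥ 0, so the fourth moment
suffices to control the exponential moment of X². -/
theorem measure_sum_sq_le_half (hκ : 1 ≤ κ) (hV : 0 < V) (hind : iIndepFun X P)
    (hm : ∀ i, Measurable (X i)) (hsub : ∀ i, HasSubgaussianMGF (X i) (τ i) P)
    (hτ : ∀ i, (τ i : ℝ) ≤ κ ^ 2 * V) (hV2 : ∀ i, ∫ ω, X i ω ^ 2 ∂P = V) (s : Finset ι) :
    P.real {ω | ∑ i ∈ s, X i ω ^ 2 ≤ s.card * V / 2} ≤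
      Real.exp (-(s.card / (768 * κ ^ 4))) := by
  have hT : 0 < κ ^ 2 * V := by positivity
  -- The minimiser of −tV/2 + 48 t² κ⁴ V²; the minimum is −1/(768 κ⁴).
  set t : ℝ := 1 / (192 * κ ^ 4 * V) with ht
  have ht0 : 0 < t := by positivity
  have hind2 : iIndepFun (fun i ω => X i ω ^ 2) P :=
    hind.comp (fun _ x => x ^ 2) fun _ => by fun_prop
  have hm2 : ∀ i, Measurable (fun ω => X i ω ^ 2) := fun i => (hm i).pow_const 2
  have hint : ∀ i, Integrable (fun ω => Real.exp (-t * X i ω ^ 2)) P := fun i => by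
    refine (integrable_const (1 : ℝ)).mono' (by have := hm i; fun_prop)
      (Filter.Eventually.of_forall fun ω => ?_)
    rw [Real.norm_of_nonneg (Real.exp_pos _).le]
    refine Real.exp_le_one_iff.2 ?_
    have : 0 ≤ t * X i ω ^ 2 := by positivity
    linarith
  have hmgf : ∀ i, mgf (fun ω => X i ω ^ 2) P (-t) ≤
      Real.exp (-t * V + 48 * t ^ 2 * (κ ^ 2 * V) ^ 2) := fun i => by
    have h2 := HasSubgaussianMGF.even_moment (hsub i) hT (hτ i) 1
    have h4 := HasSubgaussianMGF.even_moment (hsub i) hT (hτ i) 2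
    have hi2 : Integrable (fun ω => X i ω ^ 2) P := by simpa using h2.1
    have hi4 : Integrable (fun ω => X i ω ^ 4) P := by simpa using h4.1
    have hv4 : ∫ ω, X i ω ^ 4 ∂P ≤ 96 * (κ ^ 2 * V) ^ 2 := by
      have := h4.2
      norm_num [Nat.factorial] at this ⊢
      linarith
    have j1 : Integrable (fun ω => 1 + -t * X i ω ^ 2) P :=
      (integrable_const _).add (hi2.const_mul _)
    have hle : mgf (fun ω => X i ω ^ 2) P (-t) ≤
        ∫ ω, ((1 + -t * X i ω ^ 2) + t ^ 2 / 2 * X i ω ^ 4) ∂P := by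
      refine integral_mono (hint i) (j1.add (hi4.const_mul _)) fun ω => ?_
      have hy : 0 ≤ t * X i ω ^ 2 := by positivity
      have hq := Real.quadratic_le_exp_of_nonneg hy
      have : Real.exp (-t * X i ω ^ 2) ≤ 1 - t * X i ω ^ 2 + (t * X i ω ^ 2) ^ 2 / 2 := by
        rw [neg_mul, Real.exp_neg, inv_le_comm₀ (Real.exp_pos _) (by nlinarith)]
        refine le_trans ?_ hq
        rw [inv_le_iff_one_le_mul₀ (by nlinarith)]
        nlinarith [mul_nonneg hy hy, mul_nonneg (mul_nonneg hy hy) (mul_nonneg hy hy)]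
      calc _ ≤ _ := this
        _ = _ := by ring
    refine hle.trans ?_
    rw [integral_add j1 (hi4.const_mul _), integral_add (integrable_const _) (hi2.const_mul _),
      integral_const_mul, integral_const_mul, hV2 i]
    simp only [integral_const, probReal_univ, smul_eq_mul, mul_one]
    refine le_trans ?_ (Real.add_one_le_exp _)
    nlinarith [sq_nonneg t, mul_le_mul_of_nonneg_left hv4 (sq_nonneg t)]
  have hsum : ∀ ω, (∑ i ∈ s, fun ω => X i ω ^ 2) ω = ∑ i ∈ s, X i ω ^ 2 := fun ω => by simp
  have hch := measure_le_le_exp_mul_mgf (μ := P) (X := ∑ i ∈ s, fun ω => X i ω ^ 2)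
    (s.card * V / 2) (t := -t) (by linarith)
    (hind2.integrable_exp_mul_sum hm2 fun i _ => hint i)
  simp only [hsum] at hch
  refine hch.trans ?_
  rw [hind2.mgf_sum hm2]
  refine (mul_le_mul_of_nonneg_left (Finset.prod_le_prod (fun i _ => mgf_nonneg)
    fun i _ => hmgf i) (Real.exp_pos _).le).trans ?_
  rw [Finset.prod_const, ← Real.exp_nat_mul, ← Real.exp_add]
  refine Real.exp_le_exp.2 (le_of_eq ?_)
  rw [ht]; field_simp; ring

/-- Chernoff's method for the upper tail. Here the remainder in e^y ≤ 1 + y + y² e^y is itself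
exponential in X² and needs `HasSubgaussianMGF.exp_sq`. -/
theorem measure_two_mul_le_sum_sq (hκ : 1 ≤ κ) (hV : 0 < V) (hind : iIndepFun X P)
    (hm : ∀ i, Measurable (X i)) (hsub : ∀ i, HasSubgaussianMGF (X i) (τ i) P)
    (hτ : ∀ i, (τ i : ℝ) ≤ κ ^ 2 * V) (hV2 : ∀ i, ∫ ω, X i ω ^ 2 ∂P = V) (s : Finset ι) :
    P.real {ω | 2 * (s.card * V) ≤ ∑ i ∈ s, X i ω ^ 2} ≤
      Real.exp (-(s.card / (768 * κ ^ 4))) := by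
  set T : ℝ := κ ^ 2 * V with hTdef
  have hT : 0 < T := by positivity
  -- The minimiser of −tV + 192 t² T² with T = κ²V, giving again −1/(768 κ⁴). It lies below 1/(8T),
  -- so e^{tX²} and the polynomial factor each cost at most a multiple of e^{X²/(8T)}.
  set t : ℝ := 1 / (384 * κ ^ 2 * T) with ht
  have ht0 : 0 < t := by positivity
  have htT : t ≤ 1 / (8 * T) := by
    rw [ht]
    refine one_div_le_one_div_of_le (by positivity) ?_
    have : 1 ≤ κ ^ 2 := one_le_pow₀ hκ
    nlinarith
  have hind2 : iIndepFun (fun i ω => X i ω ^ 2) P :=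
    hind.comp (fun _ x => x ^ 2) fun _ => by fun_prop
  have hm2 : ∀ i, Measurable (fun ω => X i ω ^ 2) := fun i => (hm i).pow_const 2
  have hexp8 : ∀ i ω, Real.exp (t * X i ω ^ 2) ≤ Real.exp (X i ω ^ 2 / (8 * T)) := fun i ω => by
    refine Real.exp_le_exp.2 ?_
    have := mul_le_mul_of_nonneg_right htT (sq_nonneg (X i ω))
    calc _ ≤ _ := this
      _ = _ := by ring
  have hint : ∀ i, Integrable (fun ω => Real.exp (t * X i ω ^ 2)) P := fun i => by
    refine ((HasSubgaussianMGF.exp_sq (hsub i) (hm i) hT (hτ i)).1).mono'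
      (by have := hm i; fun_prop) (Filter.Eventually.of_forall fun ω => ?_)
    rw [Real.norm_of_nonneg (Real.exp_pos _).le]
    refine (hexp8 i ω).trans (Real.exp_le_exp.2 ?_)
    gcongr; norm_num
  have hmgf : ∀ i, mgf (fun ω => X i ω ^ 2) P t ≤
      Real.exp (t * V + 192 * t ^ 2 * T ^ 2) := fun i => by
    have h2 := HasSubgaussianMGF.even_moment (hsub i) hT (hτ i) 1
    have he := HasSubgaussianMGF.exp_sq (hsub i) (hm i) hT (hτ i)
    have hi2 : Integrable (fun ω => X i ω ^ 2) P := by simpa using h2.1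
    have j1 : Integrable (fun ω => 1 + t * X i ω ^ 2) P :=
      (integrable_const _).add (hi2.const_mul _)
    have hle : mgf (fun ω => X i ω ^ 2) P t ≤
        ∫ ω, ((1 + t * X i ω ^ 2) + 128 * t ^ 2 * T ^ 2 * Real.exp (X i ω ^ 2 / (4 * T))) ∂P := by
      refine integral_mono (hint i) (j1.add (he.1.const_mul _)) fun ω => ?_
      set y := t * X i ω ^ 2 with hy
      have hy0 : 0 ≤ y := by positivity
      have h1 : Real.exp y ≤ 1 + y + y ^ 2 * Real.exp y := by
        have h := mul_le_mul_of_nonneg_right (Real.one_sub_le_exp_neg y) (Real.exp_pos y).le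
        have e : Real.exp (-y) * Real.exp y = 1 := by rw [← Real.exp_add]; simp
        nlinarith [mul_le_mul_of_nonneg_left (by linarith : Real.exp y - 1 ≤ y * Real.exp y) hy0]
      set w := X i ω ^ 2 / (8 * T) with hw
      have hw0 : 0 ≤ w := by positivity
      have h2 : w ^ 2 / 2 ≤ Real.exp w := by
        have := Real.quadratic_le_exp_of_nonneg hw0; nlinarith
      have h3 : Real.exp y ≤ Real.exp w := hexp8 i ω
      have h4 : Real.exp w * Real.exp w = Real.exp (X i ω ^ 2 / (4 * T)) := by
        rw [← Real.exp_add]; congr 1; rw [hw]; field_simp; ring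
      have h5 : y ^ 2 = 64 * t ^ 2 * T ^ 2 * w ^ 2 := by
        rw [hy, hw]; field_simp; ring
      have h6 : w ^ 2 / 2 * Real.exp y ≤ Real.exp (X i ω ^ 2 / (4 * T)) := by
        rw [← h4]; exact mul_le_mul h2 h3 (Real.exp_pos _).le (Real.exp_pos _).le
      calc Real.exp y ≤ 1 + y + y ^ 2 * Real.exp y := h1
        _ = 1 + y + 128 * t ^ 2 * T ^ 2 * (w ^ 2 / 2 * Real.exp y) := by rw [h5]; ring
        _ ≤ _ := by gcongr
    refine hle.trans ?_
    rw [integral_add j1 (he.1.const_mul _), integral_add (integrable_const _) (hi2.const_mul _),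
      integral_const_mul, integral_const_mul, hV2 i]
    simp only [integral_const, probReal_univ, smul_eq_mul, mul_one]
    refine le_trans ?_ (Real.add_one_le_exp _)
    have hs : Real.sqrt 2 ≤ 3 / 2 := by
      rw [Real.sqrt_le_left (by norm_num)]; norm_num
    have := mul_le_mul_of_nonneg_left (he.2.trans hs) (by positivity : 0 ≤ 128 * t ^ 2 * T ^ 2)
    linarith
  have hsum : ∀ ω, (∑ i ∈ s, fun ω => X i ω ^ 2) ω = ∑ i ∈ s, X i ω ^ 2 := fun ω => by simp
  have hch := measure_ge_le_exp_mul_mgf (μ := P) (X := ∑ i ∈ s, fun ω => X i ω ^ 2)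
    (2 * (s.card * V)) (t := t) ht0.le
    (hind2.integrable_exp_mul_sum hm2 fun i _ => hint i)
  simp only [hsum] at hch
  refine hch.trans ?_
  rw [hind2.mgf_sum hm2]
  refine (mul_le_mul_of_nonneg_left (Finset.prod_le_prod (fun i _ => mgf_nonneg)
    fun i _ => hmgf i) (Real.exp_pos _).le).trans ?_
  rw [Finset.prod_const, ← Real.exp_nat_mul, ← Real.exp_add]
  refine Real.exp_le_exp.2 ?_
  have e : -t * (2 * (s.card * V)) + s.card * (t * V + 192 * t ^ 2 * T ^ 2) =
      -(s.card / (768 * κ ^ 4)) := by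
    rw [ht, hTdef]; field_simp; ring
  rw [e]

end Tails

end OMRidge

/-! ### Lower bound for the Gram matrix with high probability. -/

namespace OMRidge

variable {Ω : Type*} [MeasurableSpace Ω] {P : Measure Ω}

theorem l2norm_sq {k : ℕ} (v : Fin k → ℝ) : l2norm v ^ 2 = v ⬝ᵥ v := by
  rw [l2norm, EuclideanSpace.real_norm_sq_eq]
  simp [dotProduct, sq]

theorem dotProduct_self_nonneg' {k : ℕ} (v : Fin k → ℝ) : 0 ≤ v ⬝ᵥ v := by
  rw [← l2norm_sq]; positivity

theorem norm_sq_eq_dotProduct {k : ℕ} (v : EuclideanSpace ℝ (Fin k)) :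
    ‖v‖ ^ 2 = v.ofLp ⬝ᵥ v.ofLp := by
  rw [EuclideanSpace.real_norm_sq_eq]
  simp [dotProduct, sq]

theorem sum_sq_add_le {n k : ℕ} (s : Finset (Fin n)) (X : Fin n → Fin k → ℝ) (a b : Fin k → ℝ) :
    ∑ i ∈ s, ((a + b) ⬝ᵥ X i) ^ 2 ≤
      2 * ∑ i ∈ s, (a ⬝ᵥ X i) ^ 2 + 2 * ∑ i ∈ s, (b ⬝ᵥ X i) ^ 2 := by
  rw [Finset.mul_sum, Finset.mul_sum, ← Finset.sum_add_distrib]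
  refine Finset.sum_le_sum fun i _ => ?_
  rw [add_dotProduct]
  nlinarith [sq_nonneg (a ⬝ᵥ X i - b ⬝ᵥ X i)]

theorem sum_sq_smul {n k : ℕ} (s : Finset (Fin n)) (X : Fin n → Fin k → ℝ) (c : ℝ)
    (a : Fin k → ℝ) :
    ∑ i ∈ s, ((c • a) ⬝ᵥ X i) ^ 2 = c ^ 2 * ∑ i ∈ s, (a ⬝ᵥ X i) ^ 2 := by
  rw [Finset.mul_sum]
  refine Finset.sum_congr rfl fun i _ => ?_
  rw [smul_dotProduct, smul_eq_mul, mul_pow]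

/-- The quadratic form of a sample attains its maximum over the unit sphere. -/
theorem exists_unit_forall_sum_sq_le {n k : ℕ} (hk : 0 < k) (s : Finset (Fin n))
    (X : Fin n → Fin k → ℝ) :
    ∃ u : EuclideanSpace ℝ (Fin k), ‖u‖ = 1 ∧ ∀ v : EuclideanSpace ℝ (Fin k),
      ∑ i ∈ s, (v.ofLp ⬝ᵥ X i) ^ 2 ≤ ‖v‖ ^ 2 * ∑ i ∈ s, (u.ofLp ⬝ᵥ X i) ^ 2 := by
  have : Nonempty (Fin k) := ⟨⟨0, hk⟩⟩
  have hcont : Continuous fun v : EuclideanSpace ℝ (Fin k) => ∑ i ∈ s, (v.ofLp ⬝ᵥ X i) ^ 2 := by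
    simp only [dotProduct]; fun_prop
  obtain ⟨u, hu, hmax⟩ := (isCompact_sphere (0 : EuclideanSpace ℝ (Fin k)) 1).exists_isMaxOn
    (NormedSpace.sphere_nonempty.2 zero_le_one) hcont.continuousOn
  refine ⟨u, by simpa using hu, fun v => ?_⟩
  by_cases hv : v = 0
  · subst hv; simp
  · have hv' : 0 < ‖v‖ := norm_pos_iff.2 hv
    have hw : (‖v‖⁻¹ • v) ∈ Metric.sphere (0 : EuclideanSpace ℝ (Fin k)) 1 := by
      simp [norm_smul, hv'.ne']
    have h := hmax hw
    simp only [Set.mem_ofPred_eq, WithLp.ofLp_smul, sum_sq_smul] at h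
    rw [inv_pow, inv_mul_le_iff₀ (by positivity)] at h
    exact h

section

variable {n k : ℕ} {κ Cmin Cmax σε : ℝ} {Sig : Matrix (Fin k) (Fin k) ℝ} {β₀ : Fin k → ℝ}
  {x : Fin n → Ω → Fin k → ℝ} {ε y : Fin n → Ω → ℝ}

theorem LinearModel.subgaussian_le (h : LinearModel P κ Cmin Cmax σε Sig β₀ x ε y)
    (hCmin : 0 < Cmin) (v : Fin k → ℝ) :
    (Real.toNNReal (κ ^ 2 * (v ⬝ᵥ Sig *ᵥ v)) : ℝ) ≤ κ ^ 2 * (v ⬝ᵥ Sig *ᵥ v) := by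
  rw [Real.coe_toNNReal]
  have := h.cov_min v
  have h2 : 0 ≤ Cmin * l2norm v ^ 2 := by positivity
  exact mul_nonneg (sq_nonneg κ) (h2.trans this)

theorem LinearModel.even_moment (h : LinearModel P κ Cmin Cmax σε Sig β₀ x ε y)
    (hκ : 1 ≤ κ) (hCmin : 0 < Cmin) (hC : Cmin ≤ Cmax) (i : Fin n) (v : Fin k → ℝ) {q : ℕ}
    (hq : q ≠ 0) :
    ExpLe P (fun ω => (v ⬝ᵥ x i ω) ^ (2 * q))
      (4 * (2 * q).factorial * (κ ^ 2 * Cmax * (v ⬝ᵥ v)) ^ q) := by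
  by_cases hv : v = 0
  · subst hv; simp [hq, ExpLe]
  · have hv' : 0 < v ⬝ᵥ v := (dotProduct_self_nonneg' v).lt_of_ne'
      fun h0 => hv (dotProduct_self_eq_zero.1 h0)
    have hC' : 0 < Cmax := hCmin.trans_le hC
    refine HasSubgaussianMGF.even_moment (h.design_subgaussian i v) (by positivity)
      ((h.subgaussian_le hCmin v).trans ?_) q
    have := h.cov_max v
    rw [l2norm_sq] at this
    rw [mul_assoc]
    gcongr

theorem LinearModel.integral_mul (h : LinearModel P κ Cmin Cmax σε Sig β₀ x ε y)
    (hκ : 1 ≤ κ) (hCmin : 0 < Cmin) (hC : Cmin ≤ Cmax) (i : Fin n) (v w : Fin k → ℝ) :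
    ∫ ω, (v ⬝ᵥ x i ω) * (w ⬝ᵥ x i ω) ∂P = v ⬝ᵥ Sig *ᵥ w := by
  have hsq : ∀ v : Fin k → ℝ, Integrable (fun ω => (v ⬝ᵥ x i ω) ^ 2) P := fun v => by
    simpa using (h.even_moment hκ hCmin hC i v one_ne_zero).1
  have hcoord : ∀ j ω, x i ω j = Pi.single j (1 : ℝ) ⬝ᵥ x i ω := fun j ω => by simp
  have hmx : ∀ j, Measurable fun ω => x i ω j := fun j => (measurable_pi_apply j).comp
    (h.measurable_x i)
  have hint : ∀ j l, Integrable (fun ω => x i ω j * x i ω l) P := fun j l => by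
    have h1 := hsq (Pi.single j 1)
    have h2 := hsq (Pi.single l 1)
    simp only [← hcoord] at h1 h2
    refine (h1.add h2).mono' ((hmx j).mul (hmx l)).aestronglyMeasurable
      (Filter.Eventually.of_forall fun ω => ?_)
    simp only [Real.norm_eq_abs, Pi.add_apply, abs_le]
    constructor <;> nlinarith [sq_nonneg (x i ω j + x i ω l), sq_nonneg (x i ω j - x i ω l),
      sq_nonneg (x i ω j), sq_nonneg (x i ω l)]
  have e : ∀ ω, (v ⬝ᵥ x i ω) * (w ⬝ᵥ x i ω) =
      ∑ j, ∑ l, v j * w l * (x i ω j * x i ω l) := fun ω => by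
    simp only [dotProduct, Finset.sum_mul_sum]
    refine Finset.sum_congr rfl fun j _ => Finset.sum_congr rfl fun l _ => by ring
  simp_rw [e]
  rw [integral_finsetSum _ fun j _ => integrable_finsetSum _ fun l _ => (hint j l).const_mul _]
  simp only [dotProduct, Matrix.mulVec, Finset.mul_sum]
  refine Finset.sum_congr rfl fun j _ => ?_
  rw [integral_finsetSum _ fun l _ => (hint j l).const_mul _]
  refine Finset.sum_congr rfl fun l _ => ?_
  rw [integral_const_mul, h.cov]; ring

theorem LinearModel.indep_comp (h : LinearModel P κ Cmin Cmax σε Sig β₀ x ε y) {α : Type*}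
    [MeasurableSpace α] {F : (Fin k → ℝ) × ℝ → α} (hF : Measurable F) :
    iIndepFun (fun i ω => F (x i ω, ε i ω)) P :=
  h.indep.comp (fun _ => F) fun _ => hF

/-- With high probability the least eigenvalue of the Gram matrix of a subsample is at least
`Cmin / 32` times the size of the subsample. -/
theorem LinearModel.measure_gram_le [IsProbabilityMeasure P]
    (h : LinearModel P κ Cmin Cmax σε Sig β₀ x ε y)
    (hκ : 1 ≤ κ) (hCmin : 0 < Cmin) (hC : Cmin ≤ Cmax) (hk : 0 < k) (s : Finset (Fin n)) :
    P.real {ω | ¬ ∀ v : Fin k → ℝ,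
        s.card * Cmin / 32 * (v ⬝ᵥ v) ≤ ∑ i ∈ s, (v ⬝ᵥ x i ω) ^ 2} ≤
      (4 ^ k + (64 * (Cmax / Cmin)) ^ k) * Real.exp (-(s.card / (768 * κ ^ 4))) := by
  have hC' : 0 < Cmax := hCmin.trans_le hC
  set Q : Ω × EuclideanSpace ℝ (Fin k) → ℝ := fun z => ∑ i ∈ s, (z.2.ofLp ⬝ᵥ x i z.1) ^ 2 with hQ
  have hQm : Measurable Q := by
    refine Finset.measurable_sum _ fun i _ => Measurable.pow_const ?_ 2
    simp only [dotProduct]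
    refine Finset.measurable_sum _ fun j _ => ?_
    have h1 : Measurable fun z : Ω × EuclideanSpace ℝ (Fin k) => x i z.1 j :=
      (measurable_pi_apply j).comp ((h.measurable_x i).comp measurable_fst)
    have h2 : Measurable fun z : Ω × EuclideanSpace ℝ (Fin k) => z.2.ofLp j := by fun_prop
    exact h2.mul h1
  set m : ℝ := (s.card : ℝ) with hm
  have hm0 : 0 ≤ m := Nat.cast_nonneg _
  set r := Real.exp (-(m / (768 * κ ^ 4))) with hr
  have hfr : Module.finrank ℝ (EuclideanSpace ℝ (Fin k)) = k := by simp
  have hdir : ∀ v : EuclideanSpace ℝ (Fin k), iIndepFun (fun i ω => v.ofLp ⬝ᵥ x i ω) P := fun v =>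
    h.indep_comp (F := fun z => v.ofLp ⬝ᵥ z.1) (by simp only [dotProduct]; fun_prop)
  have hdm : ∀ (v : EuclideanSpace ℝ (Fin k)) i, Measurable fun ω => v.ofLp ⬝ᵥ x i ω := fun v i => by
    have := h.measurable_x i
    simp only [dotProduct]; fun_prop
  have hV2 : ∀ (v : EuclideanSpace ℝ (Fin k)) i, ∫ ω, (v.ofLp ⬝ᵥ x i ω) ^ 2 ∂P = v.ofLp ⬝ᵥ Sig *ᵥ v.ofLp := fun v i => by
    rw [← h.integral_mul hκ hCmin hC i]; simp only [sq]
  have hVlo : ∀ v : EuclideanSpace ℝ (Fin k), Cmin * ‖v‖ ^ 2 ≤ v.ofLp ⬝ᵥ Sig *ᵥ v.ofLp := fun v => h.cov_min v.ofLp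
  have hVhi : ∀ v : EuclideanSpace ℝ (Fin k), v.ofLp ⬝ᵥ Sig *ᵥ v.ofLp ≤ Cmax * ‖v‖ ^ 2 := fun v => h.cov_max v.ofLp
  have hshell : ∀ v : EuclideanSpace ℝ (Fin k), 1 / 2 ≤ ‖v‖ → ‖v‖ ≤ 2 → Cmin / 4 ≤ v.ofLp ⬝ᵥ Sig *ᵥ v.ofLp ∧
      v.ofLp ⬝ᵥ Sig *ᵥ v.ofLp ≤ 4 * Cmax := fun v h1 h2 => by
    have h3 : (1 / 4 : ℝ) ≤ ‖v‖ ^ 2 := by nlinarith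
    have h4 : ‖v‖ ^ 2 ≤ 4 := by nlinarith [norm_nonneg v]
    constructor
    · nlinarith [hVlo v]
    · nlinarith [hVhi v]
  -- Controls the largest eigenvalue: on the shell the variance is at most 4 Cmax, so 8 Cmax m is at
  -- least twice the mean of Q.
  have hB1 := measure_exists_ball_subset_le (P := P) (E := EuclideanSpace ℝ (Fin k)) (A := {z | 8 * Cmax * m ≤ Q z})
    (δ := 1 / 2) (q := r) (measurableSet_le measurable_const hQm) (by norm_num) le_rfl
    (Real.exp_pos _).le fun v h1 h2 => by
      obtain ⟨hlo, hhi⟩ := hshell v h1 h2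
      refine le_trans (measureReal_mono fun ω hω => ?_) (measure_two_mul_le_sum_sq hκ
        (by linarith : 0 < v.ofLp ⬝ᵥ Sig *ᵥ v.ofLp) (hdir v) (hdm v)
        (fun i => h.design_subgaussian i v.ofLp) (fun i => h.subgaussian_le hCmin v.ofLp)
        (hV2 v) s)
      simp only [Set.mem_ofPred_eq, hQ] at hω ⊢
      refine le_trans ?_ hω
      nlinarith
  have hδ : 0 < Cmin / (32 * Cmax) := by positivity
  have hδ' : Cmin / (32 * Cmax) ≤ 1 / 2 := by
    rw [div_le_div_iff₀ (by positivity) (by norm_num)]; linarith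
  -- Controls the least eigenvalue: on the shell the variance is at least Cmin/4, so m Cmin/8 is at
  -- most half the mean of Q. The radius is small enough for a largest eigenvalue of 32 Cmax m to be
  -- harmless.
  have hB2 := measure_exists_ball_subset_le (P := P) (E := EuclideanSpace ℝ (Fin k)) (A := {z | Q z ≤ m * Cmin / 8})
    (δ := Cmin / (32 * Cmax)) (q := r) (measurableSet_le hQm measurable_const) hδ hδ'
    (Real.exp_pos _).le fun v h1 h2 => by
      obtain ⟨hlo, hhi⟩ := hshell v h1 h2
      refine le_trans (measureReal_mono fun ω hω => ?_) (measure_sum_sq_le_half hκ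
        (by linarith : 0 < v.ofLp ⬝ᵥ Sig *ᵥ v.ofLp) (hdir v) (hdm v)
        (fun i => h.design_subgaussian i v.ofLp) (fun i => h.subgaussian_le hCmin v.ofLp)
        (hV2 v) s)
      simp only [Set.mem_ofPred_eq, hQ] at hω ⊢
      refine hω.trans ?_
      nlinarith
  rw [hfr] at hB1 hB2
  refine le_trans (le_trans (measureReal_mono ?_ (measure_ne_top _ _)) (measureReal_union_le _ _))
    ((add_le_add hB1 hB2).trans (le_of_eq ?_))
  · intro ω hω
    simp only [Set.mem_ofPred_eq, not_forall, not_le] at hω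
    obtain ⟨w, hw⟩ := hω
    have hw0 : w ≠ 0 := by rintro rfl; simp at hw
    have hww : 0 < w ⬝ᵥ w := (dotProduct_self_nonneg' w).lt_of_ne'
      fun h0 => hw0 (dotProduct_self_eq_zero.1 h0)
    set W : EuclideanSpace ℝ (Fin k) := WithLp.toLp 2 w with hW
    have hWn : ‖W‖ ^ 2 = w ⬝ᵥ w := norm_sq_eq_dotProduct W
    have hWp : 0 < ‖W‖ := norm_pos_iff.2 fun h0 => hw0 (by simpa [hW] using h0)
    set u : EuclideanSpace ℝ (Fin k) := ‖W‖⁻¹ • W with hu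
    have hun : ‖u‖ = 1 := by rw [hu, norm_smul, norm_inv, norm_norm, inv_mul_cancel₀ hWp.ne']
    have hQu : Q (ω, u) ≤ m * Cmin / 32 := by
      simp only [hQ, hu, WithLp.ofLp_smul, sum_sq_smul, hW]
      rw [inv_pow, inv_mul_le_iff₀ (by positivity), hWn]
      linarith
    obtain ⟨u₀, hu₀, hmax⟩ := exists_unit_forall_sum_sq_le hk s (fun i => x i ω)
    have hsub : ∀ a b : EuclideanSpace ℝ (Fin k), Q (ω, a) ≤ 2 * Q (ω, b) + 2 * (‖a - b‖ ^ 2 * Q (ω, u₀)) := fun a b => by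
      have h1 := sum_sq_add_le s (fun i => x i ω) b.ofLp (a - b).ofLp
      rw [← WithLp.ofLp_add, add_sub_cancel] at h1
      linarith [hmax (a - b)]
    have hQ0 : 0 ≤ Q (ω, u₀) := Finset.sum_nonneg fun i _ => sq_nonneg _
    -- If the largest eigenvalue is huge, Q stays above a quarter of it on the ball of radius 1/2
    -- around the maximiser. Otherwise Q varies so little near u that smallness at u spreads to a
    -- ball: Q(v) ≤ m Cmin/16 + m Cmin/16.
    by_cases hN : 32 * Cmax * m ≤ Q (ω, u₀)
    · refine Or.inl ⟨u₀, hu₀, fun v hv => ?_⟩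
      rw [Metric.mem_ball, dist_comm, dist_eq_norm] at hv
      have h2 : ‖u₀ - v‖ ^ 2 ≤ 1 / 4 := by nlinarith [norm_nonneg (u₀ - v)]
      have := hsub u₀ v
      simp only [Set.mem_ofPred_eq]
      nlinarith
    · refine Or.inr ⟨u, hun, fun v hv => ?_⟩
      rw [Metric.mem_ball, dist_eq_norm] at hv
      have h2 : ‖v - u‖ ^ 2 ≤ (Cmin / (32 * Cmax)) ^ 2 :=
        pow_le_pow_left₀ (norm_nonneg _) hv.le 2
      have h3 := hsub v u
      simp only [Set.mem_ofPred_eq]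
      have h4 : ‖v - u‖ ^ 2 * Q (ω, u₀) ≤ (Cmin / (32 * Cmax)) ^ 2 * (32 * Cmax * m) :=
        mul_le_mul h2 (not_le.1 hN).le hQ0 (by positivity)
      have h5 : (Cmin / (32 * Cmax)) ^ 2 * (32 * Cmax * m) = Cmin * m / 32 * (Cmin / Cmax) := by
        field_simp
      have h6 : Cmin / Cmax ≤ 1 := (div_le_one hC').2 hC
      have h7 : Cmin * m / 32 * (Cmin / Cmax) ≤ Cmin * m / 32 := mul_le_of_le_one_right
        (by positivity) h6
      linarith
  · have e1 : (2 : ℝ) / (1 / 2) = 4 := by norm_num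
    have e2 : 2 / (Cmin / (32 * Cmax)) = 64 * (Cmax / Cmin) := by field_simp; norm_num
    rw [e1, e2]; ring

/-- With c = Cmax/Cmin ≥ 1 the volume factor (64c)^k is at most e^{5ck}, which the sample size
bounds by exp(N/(3200 κ⁴)). The Chernoff exponent is N/(1536 κ⁴), and 1/1536 ≥ 2/3200, so one share
1/3200 survives. -/
theorem LinearModel.measure_gram_le_exp [IsProbabilityMeasure P]
    (h : LinearModel P κ Cmin Cmax σε Sig β₀ x ε y)
    (hκ : 1 ≤ κ) (hCmin : 0 < Cmin) (hC : Cmin ≤ Cmax) (hk : 0 < k) (s : Finset (Fin n))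
    {N : ℝ} (hN : s.card = N / 2) (hsize : 16000 * κ ^ 4 * (Cmax / Cmin) ^ 2 * k ≤ N) :
    P.real {ω | ¬ ∀ v : Fin k → ℝ,
        s.card * Cmin / 32 * (v ⬝ᵥ v) ≤ ∑ i ∈ s, (v ⬝ᵥ x i ω) ^ 2} ≤
      2 * Real.exp (-(N / (κ ^ 4 * (Cmax / Cmin) ^ 2) / 3200)) := by
  refine (h.measure_gram_le hκ hCmin hC hk s).trans ?_
  set c := Cmax / Cmin with hc
  have hc1 : 1 ≤ c := (one_le_div hCmin).2 hC
  have h4 : (4 : ℝ) ^ k ≤ (64 * c) ^ k := pow_le_pow_left₀ (by norm_num) (by linarith) k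
  have hexp : 64 * c ≤ Real.exp (5 * c) := by
    have h1 : c ≤ Real.exp (c - 1) := by linarith [Real.add_one_le_exp (c - 1)]
    have h2 : (64 : ℝ) ≤ Real.exp 5 := by
      have := Real.exp_one_gt_d9
      have e : Real.exp 5 = Real.exp 1 ^ 5 := by rw [← Real.exp_nat_mul]; norm_num
      rw [e]
      calc (64 : ℝ) ≤ 2.7 ^ 5 := by norm_num
        _ ≤ _ := pow_le_pow_left₀ (by norm_num) (by linarith) 5
    calc 64 * c ≤ Real.exp 5 * Real.exp (c - 1) := by gcongr
      _ = Real.exp (4 + c) := by rw [← Real.exp_add]; congr 1; ring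
      _ ≤ _ := Real.exp_le_exp.2 (by linarith)
  have hpow : (64 * c) ^ k ≤ Real.exp (k * (5 * c)) := by
    rw [Real.exp_nat_mul]; exact pow_le_pow_left₀ (by positivity) hexp k
  have hκ4 : 0 < κ ^ 4 := by positivity
  have hNpos : 0 ≤ N := by
    have : (0 : ℝ) ≤ s.card := Nat.cast_nonneg _
    linarith
  calc (4 ^ k + (64 * c) ^ k) * Real.exp (-(s.card / (768 * κ ^ 4)))
      ≤ (2 * Real.exp (k * (5 * c))) * Real.exp (-(s.card / (768 * κ ^ 4))) := by
        gcongr; linarith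
    _ = 2 * Real.exp (k * (5 * c) - s.card / (768 * κ ^ 4)) := by
        rw [mul_assoc, ← Real.exp_add]; rfl
    _ ≤ _ := by
        gcongr
        have h1 : N / (κ ^ 4 * c ^ 2) / 3200 ≤ N / κ ^ 4 / 3200 := by
          gcongr
          exact le_mul_of_one_le_right hκ4.le (one_le_pow₀ hc1)
        have h2 : (k : ℝ) * (5 * c) ≤ N / κ ^ 4 / 3200 := by
          rw [div_div, le_div_iff₀ (by positivity)]
          have : c ≤ c ^ 2 := by nlinarith
          calc k * (5 * c) * (κ ^ 4 * 3200) = 16000 * κ ^ 4 * c * k := by ring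
            _ ≤ 16000 * κ ^ 4 * c ^ 2 * k := by gcongr
            _ ≤ N := hsize
        have h3 : (s.card : ℝ) / (768 * κ ^ 4) = N / κ ^ 4 / 1536 := by
          rw [hN]; field_simp; ring
        have h4 : 0 ≤ N / κ ^ 4 := by positivity
        rw [h3]; linarith

end

end OMRidge

/-! ### Ridge regression: error inequalities, closed form, and fourth moment of the error. -/

namespace OMRidge

variable {Ω : Type*} [MeasurableSpace Ω] {P : Measure Ω}

theorem dotProduct_sq_le {k : ℕ} (a b : Fin k → ℝ) : (a ⬝ᵥ b) ^ 2 ≤ (a ⬝ᵥ a) * (b ⬝ᵥ b) := by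
  simp only [dotProduct, ← sq]
  exact Finset.sum_mul_sq_le_sq_mul_sq _ _ _

theorem sub_dotProduct_sub_le {k : ℕ} (a b : Fin k → ℝ) :
    (a - b) ⬝ᵥ (a - b) ≤ 2 * (a ⬝ᵥ a) + 2 * (b ⬝ᵥ b) := by
  have := dotProduct_self_nonneg' (a + b)
  simp only [sub_dotProduct, dotProduct_sub, add_dotProduct, dotProduct_add] at this ⊢
  linarith

theorem dotProduct_self_sq_le {k : ℕ} (a : Fin k → ℝ) :
    (a ⬝ᵥ a) ^ 2 ≤ k * ∑ j, a j ^ 4 := by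
  have := sq_sum_le_card_mul_sum_sq (s := Finset.univ) (f := fun j => a j ^ 2)
  have e : ∀ j, (a j ^ 2) ^ 2 = a j ^ 4 := fun j => by ring
  simp only [Finset.card_univ, Fintype.card_fin, e] at this
  simpa only [dotProduct, ← sq] using this

section Ridge

variable {n k : ℕ} {s : Finset (Fin n)} {lam : ℝ} {X : Fin n → Fin k → ℝ} {y e : Fin n → ℝ}
  {b b₀ : Fin k → ℝ}

/-- Optimality of b tested against b₀, with both squares expanded around b₀. -/
theorem IsRidge.basic_inequality (hb : IsRidge s lam X y b)
    (hy : ∀ i, y i = X i ⬝ᵥ b₀ + e i) :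
    ∑ i ∈ s, (X i ⬝ᵥ (b - b₀)) ^ 2 + lam * ((b - b₀) ⬝ᵥ (b - b₀)) ≤
      2 * ((∑ i ∈ s, e i • X i - lam • b₀) ⬝ᵥ (b - b₀)) := by
  have h := hb b₀
  simp only [ridgeObjective, l2norm_sq] at h
  set D := b - b₀ with hD
  have hb' : b = b₀ + D := by rw [hD]; abel
  clear_value D
  have h1 : ∑ i ∈ s, (y i - X i ⬝ᵥ b) ^ 2 =
      ∑ i ∈ s, (y i - X i ⬝ᵥ b₀) ^ 2 - 2 * ∑ i ∈ s, e i * (X i ⬝ᵥ D) +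
        ∑ i ∈ s, (X i ⬝ᵥ D) ^ 2 := by
    rw [Finset.mul_sum, ← Finset.sum_sub_distrib, ← Finset.sum_add_distrib]
    refine Finset.sum_congr rfl fun i _ => ?_
    rw [hy, hb', dotProduct_add]; ring
  have h2 : b ⬝ᵥ b = b₀ ⬝ᵥ b₀ + 2 * (b₀ ⬝ᵥ D) + D ⬝ᵥ D := by
    rw [hb']; simp only [add_dotProduct, dotProduct_add]; rw [dotProduct_comm D b₀]; ring
  have h3 : (∑ i ∈ s, e i • X i) ⬝ᵥ D = ∑ i ∈ s, e i * (X i ⬝ᵥ D) := by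
    rw [sum_dotProduct]; simp [smul_dotProduct]
  rw [sub_dotProduct _ _ D, smul_dotProduct, h3, smul_eq_mul]
  rw [h1, h2] at h
  linarith

/-- The basic inequality gives a‖D‖² ≤ 2 w·D for the error D and w the score minus the bias term,
and Cauchy–Schwarz removes one factor ‖D‖. -/
theorem IsRidge.error_le_of_gram (hb : IsRidge s lam X y b) (hlam : 0 ≤ lam)
    (hy : ∀ i, y i = X i ⬝ᵥ b₀ + e i) {a : ℝ} (ha : 0 < a)
    (hgram : ∀ v : Fin k → ℝ, a * (v ⬝ᵥ v) ≤ ∑ i ∈ s, (v ⬝ᵥ X i) ^ 2) :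
    a ^ 2 * ((b - b₀) ⬝ᵥ (b - b₀)) ≤
      8 * ((∑ i ∈ s, e i • X i) ⬝ᵥ (∑ i ∈ s, e i • X i) + lam ^ 2 * (b₀ ⬝ᵥ b₀)) := by
  have h := hb.basic_inequality hy
  have hg := hgram (b - b₀)
  simp only [dotProduct_comm (b - b₀) (X _)] at hg
  set D := b - b₀
  set w := ∑ i ∈ s, e i • X i - lam • b₀ with hw
  have hq := dotProduct_self_nonneg' D
  have hcs := dotProduct_sq_le w D
  have hww : w ⬝ᵥ w ≤ 2 * ((∑ i ∈ s, e i • X i) ⬝ᵥ (∑ i ∈ s, e i • X i)) +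
      2 * (lam ^ 2 * (b₀ ⬝ᵥ b₀)) := by
    refine (sub_dotProduct_sub_le _ _).trans (le_of_eq ?_)
    rw [smul_dotProduct, dotProduct_smul, smul_eq_mul, smul_eq_mul]; ring
  suffices a ^ 2 * (D ⬝ᵥ D) ≤ 4 * (w ⬝ᵥ w) by linarith
  have h1 : a * (D ⬝ᵥ D) ≤ 2 * (w ⬝ᵥ D) := by nlinarith [mul_nonneg hlam hq]
  rcases hq.eq_or_lt with h0 | h0
  · rw [← h0]; simpa using dotProduct_self_nonneg' w
  · have h2 : (a * (D ⬝ᵥ D)) ^ 2 ≤ (2 * (w ⬝ᵥ D)) ^ 2 := pow_le_pow_left₀ (by positivity) h1 2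
    refine le_of_mul_le_mul_right ?_ h0
    nlinarith

/-- The crude bound for the exceptional event, free of any condition on the design: AM-GM makes the
fitted quadratic form cancel, and half of the penalty term absorbs the bias. -/
theorem IsRidge.error_le (hb : IsRidge s lam X y b) (hlam : 0 < lam)
    (hy : ∀ i, y i = X i ⬝ᵥ b₀ + e i) :
    (b - b₀) ⬝ᵥ (b - b₀) ≤ 2 / lam * ∑ i ∈ s, e i ^ 2 + 4 * (b₀ ⬝ᵥ b₀) := by
  have h := hb.basic_inequality hy
  generalize b - b₀ = D at h ⊢
  have h3 : (∑ i ∈ s, e i • X i) ⬝ᵥ D = ∑ i ∈ s, e i * (X i ⬝ᵥ D) := by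
    rw [sum_dotProduct]; simp [smul_dotProduct]
  rw [sub_dotProduct _ _ D, smul_dotProduct, h3, smul_eq_mul] at h
  have h4 : 2 * ∑ i ∈ s, e i * (X i ⬝ᵥ D) ≤ ∑ i ∈ s, e i ^ 2 + ∑ i ∈ s, (X i ⬝ᵥ D) ^ 2 := by
    rw [Finset.mul_sum, ← Finset.sum_add_distrib]
    exact Finset.sum_le_sum fun i _ => by nlinarith [sq_nonneg (e i - X i ⬝ᵥ D)]
  have h5 : -(4 * (b₀ ⬝ᵥ D)) ≤ 4 * (b₀ ⬝ᵥ b₀) + D ⬝ᵥ D := by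
    have := dotProduct_self_nonneg' ((2 : ℝ) • b₀ + D)
    simp only [add_dotProduct, dotProduct_add, smul_dotProduct, dotProduct_smul,
      smul_eq_mul] at this
    rw [dotProduct_comm D b₀] at this
    linarith
  have h6 := mul_le_mul_of_nonneg_left h5 hlam.le
  have h7 : lam * (D ⬝ᵥ D) ≤ 2 * ∑ i ∈ s, e i ^ 2 + 4 * (lam * (b₀ ⬝ᵥ b₀)) := by linarith
  refine le_of_mul_le_mul_left ?_ hlam
  refine h7.trans (le_of_eq ?_)
  field_simp

/-- The closed form of the ridge estimate. -/
noncomputable def ridgeSolution (s : Finset (Fin n)) (lam : ℝ) (X : Fin n → Fin k → ℝ)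
    (y : Fin n → ℝ) : Fin k → ℝ :=
  (∑ i ∈ s, Matrix.vecMulVec (X i) (X i) + lam • (1 : Matrix (Fin k) (Fin k) ℝ))⁻¹ *ᵥ
    ∑ i ∈ s, y i • X i

theorem gram_add_mulVec (v : Fin k → ℝ) :
    (∑ i ∈ s, Matrix.vecMulVec (X i) (X i) + lam • (1 : Matrix (Fin k) (Fin k) ℝ)) *ᵥ v =
      ∑ i ∈ s, (X i ⬝ᵥ v) • X i + lam • v := by
  rw [Matrix.add_mulVec, Matrix.smul_mulVec, Matrix.one_mulVec, Matrix.sum_mulVec]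
  congr 1
  refine Finset.sum_congr rfl fun i _ => ?_
  rw [Matrix.vecMulVec_mulVec]; simp

/-- The regularised Gram matrix is injective because it is positive definite, hence invertible. -/
theorem ridgeSolution_normal_equations (hlam : 0 < lam) :
    ∑ i ∈ s, (X i ⬝ᵥ ridgeSolution s lam X y) • X i + lam • ridgeSolution s lam X y =
      ∑ i ∈ s, y i • X i := by
  rw [← gram_add_mulVec, ridgeSolution, Matrix.mulVec_mulVec, Matrix.mul_nonsing_inv,
    Matrix.one_mulVec]
  rw [← Matrix.isUnit_iff_isUnit_det, ← Matrix.mulVec_injective_iff_isUnit]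
  intro v w hvw
  have h0 : (∑ i ∈ s, Matrix.vecMulVec (X i) (X i) + lam • (1 : Matrix (Fin k) (Fin k) ℝ)) *ᵥ
      (v - w) = 0 := by rw [Matrix.mulVec_sub]; exact sub_eq_zero.2 hvw
  rw [gram_add_mulVec] at h0
  have h1 := congrArg (fun z => z ⬝ᵥ (v - w)) h0
  simp only [add_dotProduct, sum_dotProduct, smul_dotProduct, smul_eq_mul, zero_dotProduct] at h1
  have h2 : 0 ≤ ∑ i ∈ s, X i ⬝ᵥ (v - w) * X i ⬝ᵥ (v - w) :=
    Finset.sum_nonneg fun i _ => mul_self_nonneg _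
  have h3 := dotProduct_self_nonneg' (v - w)
  have h4 : (v - w) ⬝ᵥ (v - w) = 0 := by
    by_contra hne
    have := mul_pos hlam (h3.lt_of_ne' hne)
    linarith
  exact sub_eq_zero.1 (dotProduct_self_eq_zero.1 h4)

/-- With the closed form as reference vector, the normal equations annihilate the right side of the
basic inequality. Through this uniqueness any minimiser is a measurable function of its own fold. -/
theorem IsRidge.eq_ridgeSolution (hb : IsRidge s lam X y b) (hlam : 0 < lam) :
    b = ridgeSolution s lam X y := by
  set c := ridgeSolution s lam X y with hc
  have hn := ridgeSolution_normal_equations (s := s) (X := X) (y := y) hlam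
  rw [← hc] at hn
  have h := hb.basic_inequality (b₀ := c) (e := fun i => y i - X i ⬝ᵥ c) fun i => by ring
  have h0 : ∑ i ∈ s, (y i - X i ⬝ᵥ c) • X i - lam • c = 0 := by
    simp only [sub_smul, Finset.sum_sub_distrib]
    rw [← hn]; abel
  rw [h0, zero_dotProduct, mul_zero] at h
  have h2 : 0 ≤ ∑ i ∈ s, (X i ⬝ᵥ (b - c)) ^ 2 := Finset.sum_nonneg fun i _ => sq_nonneg _
  have h3 := dotProduct_self_nonneg' (b - c)
  have h4 : (b - c) ⬝ᵥ (b - c) = 0 := by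
    by_contra hne
    have := mul_pos hlam (h3.lt_of_ne' hne)
    linarith
  exact sub_eq_zero.1 (dotProduct_self_eq_zero.1 h4)

theorem measurable_matrix_det {α : Type*} [MeasurableSpace α] {A : α → Matrix (Fin k) (Fin k) ℝ}
    (hA : ∀ i j, Measurable fun a => A a i j) : Measurable fun a => (A a).det := by
  simp only [Matrix.det_apply]
  exact Finset.measurable_sum _ fun σ _ => (Finset.measurable_prod _ fun i _ => hA _ _).const_smul _

theorem measurable_matrix_inv {α : Type*} [MeasurableSpace α] {A : α → Matrix (Fin k) (Fin k) ℝ}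
    (hA : ∀ i j, Measurable fun a => A a i j) (i j : Fin k) :
    Measurable fun a => (A a)⁻¹ i j := by
  simp only [Matrix.inv_def, Ring.inverse_eq_inv', Matrix.smul_apply, smul_eq_mul,
    Matrix.adjugate_apply]
  refine (measurable_matrix_det hA).inv.mul (measurable_matrix_det fun i' j' => ?_)
  simp only [Matrix.updateRow_apply]
  split_ifs
  · exact measurable_const
  · exact hA _ _

theorem measurable_ridgeSolution {α : Type*} [MeasurableSpace α] {X : Fin n → α → Fin k → ℝ}
    {y : Fin n → α → ℝ} (hX : ∀ i, Measurable (X i)) (hy : ∀ i, Measurable (y i)) :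
    Measurable fun a => ridgeSolution s lam (fun i => X i a) (fun i => y i a) := by
  have hXj : ∀ i j, Measurable fun a => X i a j := fun i j => (measurable_pi_apply j).comp (hX i)
  refine measurable_pi_lambda _ fun j => ?_
  simp only [ridgeSolution, Matrix.mulVec, dotProduct]
  refine Finset.measurable_sum _ fun l _ => Measurable.mul ?_ ?_
  · refine measurable_matrix_inv (fun i' j' => ?_) j l
    simp only [Matrix.add_apply, Matrix.sum_apply, Matrix.vecMulVec_apply]
    exact (Finset.measurable_sum _ fun i _ => (hXj i i').mul (hXj i j')).add_const _
  · simp only [Finset.sum_apply, Pi.smul_apply, smul_eq_mul]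
    exact Finset.measurable_sum _ fun i _ => (hy i).mul (hXj i l)

end Ridge

/-- Fourth moment of the error of a ridge estimate whose Gram matrix is bounded below outside an
event of probability `r ^ 2`. -/
theorem expLe_ridge_error [IsProbabilityMeasure P] {n k : ℕ} {s : Finset (Fin n)}
    {lam σ a B E₈ r : ℝ} {w : Fin n → Ω → Fin k → ℝ} {e y : Fin n → Ω → ℝ} {b₀ : Fin k → ℝ}
    {b : Ω → Fin k → ℝ} (hb : ∀ ω, IsRidge s lam (fun i => w i ω) (fun i => y i ω) (b ω))
    (hbm : Measurable b) (hlam : 0 < lam) (hσ : 0 < σ) (ha : 0 < a) (hr : 0 < r)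
    (hy : ∀ i ω, y i ω = w i ω ⬝ᵥ b₀ + e i ω)
    (hgram : P.real {ω | ¬ ∀ v : Fin k → ℝ, a * (v ⬝ᵥ v) ≤ ∑ i ∈ s, (v ⬝ᵥ w i ω) ^ 2} ≤ r ^ 2)
    (hS : ∀ j, ExpLe P (fun ω => (∑ i ∈ s, e i ω * w i ω j) ^ 4) B)
    (h8 : ∀ i, ExpLe P (fun ω => e i ω ^ 8) (E₈ * σ ^ 8)) :
    ExpLe P (fun ω => ((b ω - b₀) ⬝ᵥ (b ω - b₀)) ^ 2)
      (128 / a ^ 4 * (k ^ 2 * B + lam ^ 4 * (b₀ ⬝ᵥ b₀) ^ 2) +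
        (4 / lam ^ 2 * (s.card ^ 2 * ((E₈ + 1) * σ ^ 4 * r)) + 32 * (b₀ ⬝ᵥ b₀) ^ 2 * r ^ 2)) := by
  classical
  set bad := {ω | ¬ ∀ v : Fin k → ℝ, a * (v ⬝ᵥ v) ≤ ∑ i ∈ s, (v ⬝ᵥ w i ω) ^ 2} with hbad
  -- The bad event quantifies over all vectors; its measurable hull has the same probability and
  -- spares a proof of measurability.
  set T := toMeasurable P bad with hT
  have hTm : MeasurableSet T := measurableSet_toMeasurable _ _
  have hTr : P.real T ≤ r ^ 2 := by
    rw [measureReal_def, hT, measure_toMeasurable]; exact hgram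
  set I : Ω → ℝ := T.indicator 1 with hI
  have hI01 : ∀ ω, I ω = 0 ∨ I ω = 1 := fun ω => by
    by_cases h : ω ∈ T
    · exact Or.inr (by simp [hI, h])
    · exact Or.inl (by simp [hI, h])
  have hI0 : ∀ ω, 0 ≤ I ω := fun ω => by rcases hI01 ω with h | h <;> simp [h]
  have hIe : ExpLe P I (r ^ 2) :=
    ⟨(integrable_const (1 : ℝ)).indicator hTm, by
      rw [hI, integral_indicator_one hTm]; exact hTr⟩
  have hb2 : 0 ≤ b₀ ⬝ᵥ b₀ := dotProduct_self_nonneg' b₀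
  have e1 : ExpLe P (fun ω => 128 / a ^ 4 * (k * ∑ j, (∑ i ∈ s, e i ω * w i ω j) ^ 4 +
      lam ^ 4 * (b₀ ⬝ᵥ b₀) ^ 2)) (128 / a ^ 4 * (k ^ 2 * B + lam ^ 4 * (b₀ ⬝ᵥ b₀) ^ 2)) := by
    have h1 := ((ExpLe.sum (s := Finset.univ) fun j _ => hS j).const_mul
      (c := (k : ℝ)) (by positivity))
    refine ((h1.add (ExpLe.const _)).const_mul (c := 128 / a ^ 4) (by positivity)).mono_bound
      (le_of_eq ?_)
    rw [Finset.card_univ, Fintype.card_fin]; ring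
  -- Weighted AM-GM in place of Cauchy–Schwarz for E[e⁴; T]: since P(T) ≤ r², the weights r/(2σ⁴)
  -- and σ⁴/(2r) make both contributions of order σ⁴ r.
  have e2 : ExpLe P (fun ω => 8 / lam ^ 2 * (s.card * ∑ i ∈ s,
      (r / (2 * σ ^ 4) * e i ω ^ 8 + σ ^ 4 / (2 * r) * I ω)))
      (4 / lam ^ 2 * (s.card ^ 2 * ((E₈ + 1) * σ ^ 4 * r))) := by
    have h1 : ∀ i ∈ s, ExpLe P (fun ω => r / (2 * σ ^ 4) * e i ω ^ 8 + σ ^ 4 / (2 * r) * I ω)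
        ((E₈ + 1) * σ ^ 4 * r / 2) := fun i _ => by
      refine (((h8 i).const_mul (c := r / (2 * σ ^ 4)) (by positivity)).add
        (hIe.const_mul (c := σ ^ 4 / (2 * r)) (by positivity))).mono_bound (le_of_eq ?_)
      field_simp
    refine (((ExpLe.sum h1).const_mul (c := (s.card : ℝ)) (by positivity)).const_mul
      (c := 8 / lam ^ 2) (by positivity)).mono_bound (le_of_eq ?_)
    ring
  have e3 : ExpLe P (fun ω => 32 * (b₀ ⬝ᵥ b₀) ^ 2 * I ω) (32 * (b₀ ⬝ᵥ b₀) ^ 2 * r ^ 2) :=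
    hIe.const_mul (by positivity)
  have hbj : ∀ j, Measurable fun ω => b ω j := fun j => (measurable_pi_apply j).comp hbm
  refine (e1.add (e2.add e3)).mono ?_ (fun ω => by positivity) fun ω => ?_
  · refine Measurable.aestronglyMeasurable (Measurable.pow_const ?_ 2)
    simp only [dotProduct, Pi.sub_apply]
    exact Finset.measurable_sum _ fun j _ => ((hbj j).sub_const _).mul ((hbj j).sub_const _)
  have p1 : 0 ≤ 128 / a ^ 4 * (k * ∑ j, (∑ i ∈ s, e i ω * w i ω j) ^ 4 +
      lam ^ 4 * (b₀ ⬝ᵥ b₀) ^ 2) := by positivity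
  have p2 : 0 ≤ 8 / lam ^ 2 * (s.card * ∑ i ∈ s,
      (r / (2 * σ ^ 4) * e i ω ^ 8 + σ ^ 4 / (2 * r) * I ω)) := by
    have : 0 ≤ ∑ i ∈ s, (r / (2 * σ ^ 4) * e i ω ^ 8 + σ ^ 4 / (2 * r) * I ω) :=
      Finset.sum_nonneg fun i _ => by have := hI0 ω; positivity
    positivity
  have p3 : 0 ≤ 32 * (b₀ ⬝ᵥ b₀) ^ 2 * I ω := by have := hI0 ω; positivity
  have hq := dotProduct_self_nonneg' (b ω - b₀)
  by_cases hω : ω ∈ T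
  · have hIω : I ω = 1 := by simp [hI, hω]
    have h := (hb ω).error_le hlam (fun i => hy i ω)
    have h2 : (∑ i ∈ s, e i ω ^ 2) ^ 2 ≤ s.card * ∑ i ∈ s, e i ω ^ 4 := by
      have := sq_sum_le_card_mul_sum_sq (s := s) (f := fun i => e i ω ^ 2)
      simpa only [← pow_mul] using this
    have h3 : ∑ i ∈ s, e i ω ^ 4 ≤
        ∑ i ∈ s, (r / (2 * σ ^ 4) * e i ω ^ 8 + σ ^ 4 / (2 * r) * I ω) := by
      refine Finset.sum_le_sum fun i _ => ?_
      rw [hIω]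
      have : r / (2 * σ ^ 4) * e i ω ^ 8 + σ ^ 4 / (2 * r) * 1 - e i ω ^ 4 =
          (r * e i ω ^ 4 - σ ^ 4) ^ 2 / (2 * r * σ ^ 4) := by field_simp; ring
      have h0 : 0 ≤ (r * e i ω ^ 4 - σ ^ 4) ^ 2 / (2 * r * σ ^ 4) := by positivity
      linarith
    have h4 : ((b ω - b₀) ⬝ᵥ (b ω - b₀)) ^ 2 ≤
        8 / lam ^ 2 * (∑ i ∈ s, e i ω ^ 2) ^ 2 + 32 * (b₀ ⬝ᵥ b₀) ^ 2 := by
      have h5 := pow_le_pow_left₀ hq h 2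
      have h6 : (2 / lam * ∑ i ∈ s, e i ω ^ 2 + 4 * (b₀ ⬝ᵥ b₀)) ^ 2 ≤
          2 * (2 / lam * ∑ i ∈ s, e i ω ^ 2) ^ 2 + 2 * (4 * (b₀ ⬝ᵥ b₀)) ^ 2 := by
        nlinarith [sq_nonneg (2 / lam * ∑ i ∈ s, e i ω ^ 2 - 4 * (b₀ ⬝ᵥ b₀))]
      refine h5.trans (h6.trans (le_of_eq ?_))
      rw [mul_pow, div_pow]; ring
    have h7 : 8 / lam ^ 2 * (∑ i ∈ s, e i ω ^ 2) ^ 2 ≤ 8 / lam ^ 2 * (s.card * ∑ i ∈ s,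
        (r / (2 * σ ^ 4) * e i ω ^ 8 + σ ^ 4 / (2 * r) * I ω)) := by
      refine mul_le_mul_of_nonneg_left (h2.trans ?_) (by positivity)
      exact mul_le_mul_of_nonneg_left h3 (by positivity)
    have h8 : 32 * (b₀ ⬝ᵥ b₀) ^ 2 * I ω = 32 * (b₀ ⬝ᵥ b₀) ^ 2 := by rw [hIω, mul_one]
    linarith
  · have hgood : ∀ v : Fin k → ℝ, a * (v ⬝ᵥ v) ≤ ∑ i ∈ s, (v ⬝ᵥ w i ω) ^ 2 := by
      by_contra hc
      exact hω (subset_toMeasurable P bad hc)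
    have h := (hb ω).error_le_of_gram hlam.le (fun i => hy i ω) ha hgood
    set S : Fin k → ℝ := ∑ i ∈ s, e i ω • w i ω with hSdef
    have hSj : ∀ j, S j = ∑ i ∈ s, e i ω * w i ω j := fun j => by simp [hSdef]
    have h2 := dotProduct_self_sq_le S
    simp only [hSj] at h2
    have h3 : (a ^ 2 * ((b ω - b₀) ⬝ᵥ (b ω - b₀))) ^ 2 ≤
        128 * (k * ∑ j, (∑ i ∈ s, e i ω * w i ω j) ^ 4 + lam ^ 4 * (b₀ ⬝ᵥ b₀) ^ 2) := by
      refine (pow_le_pow_left₀ (by positivity) h 2).trans ?_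
      nlinarith [sq_nonneg (S ⬝ᵥ S - lam ^ 2 * (b₀ ⬝ᵥ b₀))]
    have h4 : ((b ω - b₀) ⬝ᵥ (b ω - b₀)) ^ 2 ≤ 128 / a ^ 4 *
        (k * ∑ j, (∑ i ∈ s, e i ω * w i ω j) ^ 4 + lam ^ 4 * (b₀ ⬝ᵥ b₀) ^ 2) := by
      rw [div_mul_eq_mul_div, le_div_iff₀ (by positivity)]
      refine le_trans (le_of_eq ?_) h3
      ring
    linarith

end OMRidge

/-! ### Orthonormal coordinates adapted to the prediction direction. -/

namespace OMRidge

section Reparametrization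

variable {n d : ℕ} {xs : Fin (d + 1) → ℝ} {R : Matrix (Fin d) (Fin (d + 1)) ℝ}

/-- The unit vector in direction `xs`. -/
noncomputable def unitDir (xs : Fin (d + 1) → ℝ) : Fin (d + 1) → ℝ := (l2norm xs)⁻¹ • xs

theorem l2norm_pos (hxs : xs ≠ 0) : 0 < l2norm xs :=
  norm_pos_iff.2 fun h => hxs (by simpa using h)

theorem smul_unitDir (hxs : xs ≠ 0) : l2norm xs • unitDir xs = xs := by
  rw [unitDir, smul_smul, mul_inv_cancel₀ (l2norm_pos hxs).ne', one_smul]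

theorem unitDir_dotProduct_self (hxs : xs ≠ 0) : unitDir xs ⬝ᵥ unitDir xs = 1 := by
  have h := l2norm_pos hxs
  rw [unitDir, smul_dotProduct, dotProduct_smul, ← l2norm_sq, smul_eq_mul, smul_eq_mul]
  field_simp

theorem IsOrthoComplement.mulVec_unitDir (hR : IsOrthoComplement xs R) :
    R *ᵥ unitDir xs = 0 := by
  rw [unitDir, Matrix.mulVec_smul, hR.2, smul_zero]

theorem IsOrthoComplement.frame_mul_transpose (hR : IsOrthoComplement xs R) (hxs : xs ≠ 0) :
    (Matrix.of (Matrix.vecCons (unitDir xs) R)) * (Matrix.of (Matrix.vecCons (unitDir xs) R))ᵀ =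
      1 := by
  have h0 : ∀ j, R j ⬝ᵥ unitDir xs = 0 := fun j => congrFun hR.mulVec_unitDir j
  have h1 : ∀ i j, R i ⬝ᵥ R j = (1 : Matrix (Fin d) (Fin d) ℝ) i j := fun i j => by
    rw [← hR.1]; rfl
  have hs : ∀ i, Matrix.vecCons (unitDir xs) R (Fin.succ i) = R i := fun i => rfl
  ext i j
  change Matrix.vecCons (unitDir xs) R i ⬝ᵥ Matrix.vecCons (unitDir xs) R j = _
  refine Fin.cases ?_ (fun i => ?_) i <;> refine Fin.cases ?_ (fun j => ?_) j
  · simpa using unitDir_dotProduct_self hxs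
  · rw [hs, dotProduct_comm, Matrix.one_apply_ne (Fin.succ_ne_zero j).symm]; exact h0 j
  · rw [hs, Matrix.one_apply_ne (Fin.succ_ne_zero i)]; exact h0 i
  · rw [hs, hs, h1 i j]; simp [Matrix.one_apply]

theorem IsOrthoComplement.dotProduct_eq (hR : IsOrthoComplement xs R) (hxs : xs ≠ 0)
    (a b : Fin (d + 1) → ℝ) :
    a ⬝ᵥ b = (unitDir xs ⬝ᵥ a) * (unitDir xs ⬝ᵥ b) + (R *ᵥ a) ⬝ᵥ (R *ᵥ b) := by
  set Q := Matrix.of (Matrix.vecCons (unitDir xs) R) with hQ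
  have h : Qᵀ * Q = 1 := mul_eq_one_comm.1 (hR.frame_mul_transpose hxs)
  have h2 : (Q *ᵥ a) ⬝ᵥ (Q *ᵥ b) = a ⬝ᵥ b := by
    rw [Matrix.dotProduct_mulVec, ← Matrix.mulVec_transpose, Matrix.mulVec_mulVec, h,
      Matrix.one_mulVec]
  rw [← h2, dotProduct, Fin.sum_univ_succ]
  rfl

/-- `reparam xs R` is a scalar multiple of an orthogonal matrix, so its inverse transpose is that
matrix with the reciprocal scalar. -/
theorem IsOrthoComplement.newCov_eq (hR : IsOrthoComplement xs R) (hxs : xs ≠ 0)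
    (x : Fin (d + 1) → ℝ) :
    newCov xs R x = (l2norm xs)⁻¹ • (Matrix.of (Matrix.vecCons (unitDir xs) R) *ᵥ x) := by
  have hL := l2norm_pos hxs
  set Q := Matrix.of (Matrix.vecCons (unitDir xs) R) with hQ
  have h1 : reparam xs R = l2norm xs • Q := rfl
  have h2 : (reparam xs R)⁻¹ = (l2norm xs)⁻¹ • Qᵀ := by
    refine Matrix.inv_eq_right_inv ?_
    rw [h1, Matrix.smul_mul, Matrix.mul_smul, hR.frame_mul_transpose hxs, smul_smul,
      mul_inv_cancel₀ hL.ne', one_smul]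
  rw [newCov, h2, Matrix.transpose_smul, Matrix.transpose_transpose, Matrix.smul_mulVec]

theorem IsOrthoComplement.tPart_eq (hR : IsOrthoComplement xs R) (hxs : xs ≠ 0)
    (x : Fin (d + 1) → ℝ) : tPart xs R x = (l2norm xs)⁻¹ * (unitDir xs ⬝ᵥ x) := by
  rw [tPart, hR.newCov_eq hxs]; rfl

theorem IsOrthoComplement.zPart_eq (hR : IsOrthoComplement xs R) (hxs : xs ≠ 0)
    (x : Fin (d + 1) → ℝ) : zPart xs R x = (l2norm xs)⁻¹ • (R *ᵥ x) := by
  rw [zPart, hR.newCov_eq hxs]; rfl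

theorem fPart_eq (b : Fin (d + 1) → ℝ) : fPart xs R b = l2norm xs • (R *ᵥ b) := by
  rw [fPart, reparam, Matrix.smul_mulVec]; rfl

/-- The direction whose inner product with the covariate is the rescaled residual `η`. -/
noncomputable def residualDir (xs : Fin (d + 1) → ℝ) (R : Matrix (Fin d) (Fin (d + 1)) ℝ)
    (g : Fin d → ℝ) : Fin (d + 1) → ℝ := unitDir xs - g ᵥ* R

theorem residualDir_dotProduct (g : Fin d → ℝ) (x : Fin (d + 1) → ℝ) :
    residualDir xs R g ⬝ᵥ x = unitDir xs ⬝ᵥ x - (R *ᵥ x) ⬝ᵥ g := by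
  rw [residualDir, sub_dotProduct, dotProduct_comm (R *ᵥ x), Matrix.dotProduct_mulVec]

theorem IsOrthoComplement.mulVec_dotProduct_self_le (hR : IsOrthoComplement xs R) (hxs : xs ≠ 0)
    (a : Fin (d + 1) → ℝ) : (R *ᵥ a) ⬝ᵥ (R *ᵥ a) ≤ a ⬝ᵥ a := by
  rw [hR.dotProduct_eq hxs a a]
  nlinarith [mul_self_nonneg (unitDir xs ⬝ᵥ a)]

theorem IsOrthoComplement.vecMul_dotProduct_self (hR : IsOrthoComplement xs R) (g : Fin d → ℝ) :
    (g ᵥ* R) ⬝ᵥ (g ᵥ* R) = g ⬝ᵥ g := by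
  rw [← Matrix.dotProduct_mulVec, ← Matrix.mulVec_transpose, Matrix.mulVec_mulVec, hR.1,
    Matrix.one_mulVec]

theorem IsOrthoComplement.residualDir_dotProduct_self (hR : IsOrthoComplement xs R) (hxs : xs ≠ 0)
    (g : Fin d → ℝ) : residualDir xs R g ⬝ᵥ residualDir xs R g = 1 + g ⬝ᵥ g := by
  have h : (g ᵥ* R) ⬝ᵥ unitDir xs = 0 := by
    rw [← Matrix.dotProduct_mulVec, hR.mulVec_unitDir, dotProduct_zero]
  rw [residualDir, sub_dotProduct, dotProduct_sub, dotProduct_sub, h,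
    dotProduct_comm (unitDir xs) (g ᵥ* R), h, hR.vecMul_dotProduct_self,
    unitDir_dotProduct_self hxs]
  ring

theorem IsOrthoComplement.row_dotProduct_self (hR : IsOrthoComplement xs R) (j : Fin d) :
    R j ⬝ᵥ R j = 1 := by
  have := congrFun (congrFun hR.1 j) j
  rw [Matrix.one_apply_eq] at this
  exact this

theorem IsOrthoComplement.etaPart_eq (hR : IsOrthoComplement xs R) (hxs : xs ≠ 0)
    (g : Fin d → ℝ) (x : Fin (d + 1) → ℝ) :
    etaPart xs R g x = (l2norm xs)⁻¹ * (residualDir xs R g ⬝ᵥ x) := by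
  rw [etaPart, hR.tPart_eq hxs, hR.zPart_eq hxs, residualDir_dotProduct, smul_dotProduct,
    smul_eq_mul]
  ring

/-- Treatment and controls carry the same factor 1/‖xs‖₂, so the coefficient is unchanged and only
the penalty rescales. This is why the hypotheses bound ‖xs‖₂² times the penalty. -/
theorem IsOrthoComplement.isRidge_rescale (hR : IsOrthoComplement xs R) (hxs : xs ≠ 0)
    {s : Finset (Fin n)} {lam : ℝ} {X : Fin n → Fin (d + 1) → ℝ} {g : Fin d → ℝ}
    (hg : IsRidge s lam (fun i => zPart xs R (X i)) (fun i => tPart xs R (X i)) g) :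
    IsRidge s (l2norm xs ^ 2 * lam) (fun i => R *ᵥ X i) (fun i => unitDir xs ⬝ᵥ X i) g := by
  have hL := l2norm_pos hxs
  have key : ∀ g, ridgeObjective s (l2norm xs ^ 2 * lam) (fun i => R *ᵥ X i)
      (fun i => unitDir xs ⬝ᵥ X i) g = l2norm xs ^ 2 *
        ridgeObjective s lam (fun i => zPart xs R (X i)) (fun i => tPart xs R (X i)) g := fun g => by
    rw [ridgeObjective, ridgeObjective, mul_add, Finset.mul_sum]
    congr 1
    · refine Finset.sum_congr rfl fun i _ => ?_
      simp only [hR.tPart_eq hxs, hR.zPart_eq hxs, smul_dotProduct, smul_eq_mul]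
      field_simp
    · ring
  intro g'
  rw [key, key]
  exact mul_le_mul_of_nonneg_left (hg g') (by positivity)

/-- The second moment statistic in the normalized coordinates. -/
theorem IsOrthoComplement.secondMoment_eq (hR : IsOrthoComplement xs R) (hxs : xs ≠ 0)
    (X : Fin n → Fin (d + 1) → ℝ) (g₀ g : Fin d → ℝ) :
    l2norm xs ^ 2 * secondMoment xs R X g = ((n : ℝ) / 2)⁻¹ * ∑ i ∈ fold2 n,
      (unitDir xs ⬝ᵥ X i) * (residualDir xs R g₀ ⬝ᵥ X i - (R *ᵥ X i) ⬝ᵥ (g - g₀)) := by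
  have hL := l2norm_pos hxs
  rw [secondMoment, mul_left_comm, Finset.mul_sum]
  congr 1
  refine Finset.sum_congr rfl fun i _ => ?_
  simp only [hR.tPart_eq hxs, hR.zPart_eq hxs, smul_dotProduct, smul_eq_mul,
    residualDir_dotProduct, dotProduct_sub]
  field_simp
  ring

/-- The normalized prediction error of the orthogonal moment estimate. -/
theorem IsOrthoComplement.omPrediction_sub (hR : IsOrthoComplement xs R) (hxs : xs ≠ 0)
    {ση : ℝ} {X : Fin n → Fin (d + 1) → ℝ} {y e : Fin n → ℝ} {β₀ b : Fin (d + 1) → ℝ}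
    {g₀ g : Fin d → ℝ} (hy : ∀ i, y i = X i ⬝ᵥ β₀ + e i) (hσ : l2norm xs * ση ≠ 0) :
    (omPrediction xs R (ση ^ 2 / 4) X y b g - xs ⬝ᵥ β₀) =
      l2norm xs * if ((n : ℝ) / 2)⁻¹ * ∑ i ∈ fold2 n,
          (unitDir xs ⬝ᵥ X i) * (residualDir xs R g₀ ⬝ᵥ X i - (R *ᵥ X i) ⬝ᵥ (g - g₀)) ≤
          (l2norm xs * ση) ^ 2 / 4 then unitDir xs ⬝ᵥ (b - β₀)
      else (((n : ℝ) / 2)⁻¹ * ∑ i ∈ fold2 n, (e i - (R *ᵥ X i) ⬝ᵥ (R *ᵥ (b - β₀))) *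
          (residualDir xs R g₀ ⬝ᵥ X i - (R *ᵥ X i) ⬝ᵥ (g - g₀))) /
        (((n : ℝ) / 2)⁻¹ * ∑ i ∈ fold2 n,
          (unitDir xs ⬝ᵥ X i) * (residualDir xs R g₀ ⬝ᵥ X i - (R *ᵥ X i) ⬝ᵥ (g - g₀))) := by
  have hL := l2norm_pos hxs
  rw [← hR.secondMoment_eq hxs X g₀ g]
  have hiff : l2norm xs ^ 2 * secondMoment xs R X g ≤ (l2norm xs * ση) ^ 2 / 4 ↔
      secondMoment xs R X g ≤ ση ^ 2 / 4 := by
    rw [mul_pow, mul_div_assoc, mul_le_mul_iff_right₀ (by positivity)]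
  have hxs' : ∀ v, xs ⬝ᵥ v = l2norm xs * (unitDir xs ⬝ᵥ v) := fun v => by
    conv_lhs => rw [← smul_unitDir hxs]
    rw [smul_dotProduct, smul_eq_mul]
  rw [omPrediction]
  by_cases h : secondMoment xs R X g ≤ ση ^ 2 / 4
  · rw [if_pos h, if_pos (hiff.2 h), hxs', hxs', dotProduct_sub]; ring
  · rw [if_neg h, if_neg (fun h' => h (hiff.1 h'))]
    have hση : 0 < ση ^ 2 := by
      have : ση ≠ 0 := by rintro rfl; simp at hσ
      positivity
    have hM : 0 < secondMoment xs R X g := by linarith [not_le.1 h]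
    set M := secondMoment xs R X g with hMdef
    have hMeq := hR.secondMoment_eq hxs X g₀ g
    rw [← hMdef] at hMeq
    set c : ℝ := ((n : ℝ) / 2)⁻¹ with hc
    clear_value c
    -- By Parseval the partial residual of the outcome is e − Z·R(b − β₀) + (u·x)(u·β₀). The last
    -- term contributes u·β₀ times the denominator, which becomes exactly the target after division.
    have key : l2norm xs * (c * ∑ i ∈ fold2 n, (y i - zPart xs R (X i) ⬝ᵥ fPart xs R b) *
        (tPart xs R (X i) - zPart xs R (X i) ⬝ᵥ g)) =
        c * ∑ i ∈ fold2 n, (e i - (R *ᵥ X i) ⬝ᵥ (R *ᵥ (b - β₀))) *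
          (residualDir xs R g₀ ⬝ᵥ X i - (R *ᵥ X i) ⬝ᵥ (g - g₀)) +
        (unitDir xs ⬝ᵥ β₀) * (c * ∑ i ∈ fold2 n,
          (unitDir xs ⬝ᵥ X i) * (residualDir xs R g₀ ⬝ᵥ X i - (R *ᵥ X i) ⬝ᵥ (g - g₀))) := by
      simp only [Finset.mul_sum]
      rw [← Finset.sum_add_distrib]
      refine Finset.sum_congr rfl fun i _ => ?_
      rw [hy, hR.dotProduct_eq hxs (X i) β₀]
      simp only [hR.tPart_eq hxs, hR.zPart_eq hxs, fPart_eq, smul_dotProduct, dotProduct_smul,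
        smul_eq_mul, residualDir_dotProduct, dotProduct_sub, Matrix.mulVec_sub]
      field_simp
      ring
    rw [← hMeq] at key
    have key2 : c * ∑ i ∈ fold2 n, (y i - zPart xs R (X i) ⬝ᵥ fPart xs R b) *
        (tPart xs R (X i) - zPart xs R (X i) ⬝ᵥ g) = (l2norm xs)⁻¹ *
        (c * ∑ i ∈ fold2 n, (e i - (R *ᵥ X i) ⬝ᵥ (R *ᵥ (b - β₀))) *
          (residualDir xs R g₀ ⬝ᵥ X i - (R *ᵥ X i) ⬝ᵥ (g - g₀)) +
        (unitDir xs ⬝ᵥ β₀) * (l2norm xs ^ 2 * M)) := by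
      rw [← key, inv_mul_cancel_left₀ hL.ne']
    rw [key2, hxs']
    field_simp
    ring

end Reparametrization

end OMRidge

/-! ### Independence across the folds, moments of centred products, population identities. -/

namespace OMRidge

variable {Ω : Type*} [MeasurableSpace Ω] {P : Measure Ω}

/-- Integrating out one of two independent random variables. -/
theorem expLe_of_indepFun [IsProbabilityMeasure P] {α δ : Type*} [MeasurableSpace α]
    [MeasurableSpace δ] {X : Ω → α} {D : Ω → δ} (hX : Measurable X) (hD : Measurable D)
    (hind : IndepFun X D P) {F : α → δ → ℝ} (hF : Measurable (Function.uncurry F))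
    (hF0 : ∀ a d, 0 ≤ F a d) {G : δ → ℝ} (hG : Measurable G)
    (h : ∀ d, ExpLe P (fun ω => F (X ω) d) (G d)) {B : ℝ} (hB : ExpLe P (fun ω => G (D ω)) B) :
    ExpLe P (fun ω => F (X ω) (D ω)) B := by
  have hG0 : ∀ d, 0 ≤ G d := fun d => (h d).nonneg fun ω => hF0 _ _
  have hB0 : 0 ≤ B := hB.nonneg fun ω => hG0 _
  have hXD : Measurable fun ω => (X ω, D ω) := hX.prodMk hD
  have hlin : ∫⁻ ω, ENNReal.ofReal (F (X ω) (D ω)) ∂P ≤ ENNReal.ofReal B := by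
    have e1 : ∫⁻ ω, ENNReal.ofReal (F (X ω) (D ω)) ∂P =
        ∫⁻ z, ENNReal.ofReal (Function.uncurry F z) ∂(P.map fun ω => (X ω, D ω)) := by
      rw [lintegral_map hF.ennreal_ofReal hXD]; rfl
    have := Measure.isProbabilityMeasure_map (μ := P) hX.aemeasurable
    have := Measure.isProbabilityMeasure_map (μ := P) hD.aemeasurable
    rw [e1, (indepFun_iff_map_prod_eq_prod_map_map hX.aemeasurable hD.aemeasurable).1 hind,
      lintegral_prod_symm' _ hF.ennreal_ofReal]
    have e2 : ∫⁻ d, ∫⁻ a, ENNReal.ofReal (Function.uncurry F (a, d)) ∂(P.map X) ∂(P.map D) ≤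
        ∫⁻ d, ENNReal.ofReal (G d) ∂(P.map D) := by
      refine lintegral_mono fun d => ?_
      rw [lintegral_map (f := fun a => ENNReal.ofReal (Function.uncurry F (a, d)))
        (hF.comp (measurable_id.prodMk measurable_const)).ennreal_ofReal hX]
      change ∫⁻ ω, ENNReal.ofReal (F (X ω) d) ∂P ≤ _
      rw [← ofReal_integral_eq_lintegral_ofReal (h d).1
        (Filter.Eventually.of_forall fun ω => hF0 _ _)]
      exact ENNReal.ofReal_le_ofReal (h d).2
    refine e2.trans ?_
    rw [lintegral_map hG.ennreal_ofReal hD, ← ofReal_integral_eq_lintegral_ofReal hB.1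
        (Filter.Eventually.of_forall fun ω => hG0 _)]
    exact ENNReal.ofReal_le_ofReal hB.2
  have hm : Measurable fun ω => F (X ω) (D ω) := hF.comp hXD
  have hint : Integrable (fun ω => F (X ω) (D ω)) P := by
    refine ⟨hm.aestronglyMeasurable, ?_⟩
    rw [hasFiniteIntegral_iff_ofReal (Filter.Eventually.of_forall fun ω => hF0 _ _)]
    exact hlin.trans_lt ENNReal.ofReal_lt_top
  refine ⟨hint, ?_⟩
  rwa [← ENNReal.ofReal_le_ofReal_iff hB0, ofReal_integral_eq_lintegral_ofReal hint
    (Filter.Eventually.of_forall fun ω => hF0 _ _)]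

/-- AM-GM weighted by σ⁴, so that a factor f of scale σ and a factor g of scale 1 contribute
equally; no independence is involved. -/
theorem expLe_mul_pow_four [IsProbabilityMeasure P] {f g : Ω → ℝ} {F G σ : ℝ} (hσ : 0 < σ)
    (hf : AEStronglyMeasurable f P) (hg : AEStronglyMeasurable g P)
    (hf8 : ExpLe P (fun ω => f ω ^ 8) (F * σ ^ 8)) (hg8 : ExpLe P (fun ω => g ω ^ 8) G) :
    ExpLe P (fun ω => (f ω * g ω) ^ 4) ((F + G) / 2 * σ ^ 4) := by
  have h := (hf8.const_mul (c := 1 / (2 * σ ^ 4)) (by positivity)).add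
    (hg8.const_mul (c := σ ^ 4 / 2) (by positivity))
  have hm : AEStronglyMeasurable (fun ω => (f ω * g ω) ^ 4) P := (hf.mul hg).pow 4
  refine (h.mono hm (fun ω => by positivity) fun ω => ?_).mono_bound (le_of_eq (by field_simp))
  have : 1 / (2 * σ ^ 4) * f ω ^ 8 + σ ^ 4 / 2 * g ω ^ 8 - (f ω * g ω) ^ 4 =
      (f ω ^ 4 - σ ^ 4 * g ω ^ 4) ^ 2 / (2 * σ ^ 4) := by field_simp; ring
  have h0 : 0 ≤ (f ω ^ 4 - σ ^ 4 * g ω ^ 4) ^ 2 / (2 * σ ^ 4) := by positivity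
  linarith

theorem ridgeSolution_congr {n k : ℕ} {s : Finset (Fin n)} {lam : ℝ} {X X' : Fin n → Fin k → ℝ}
    {y y' : Fin n → ℝ} (hX : ∀ i ∈ s, X i = X' i) (hy : ∀ i ∈ s, y i = y' i) :
    ridgeSolution s lam X y = ridgeSolution s lam X' y' := by
  have h1 : ∑ i ∈ s, Matrix.vecMulVec (X i) (X i) = ∑ i ∈ s, Matrix.vecMulVec (X' i) (X' i) :=
    Finset.sum_congr rfl fun i hi => by rw [hX i hi]
  have h2 : ∑ i ∈ s, y i • X i = ∑ i ∈ s, y' i • X' i :=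
    Finset.sum_congr rfl fun i hi => by rw [hX i hi, hy i hi]
  rw [ridgeSolution, ridgeSolution, h1, h2]

/-- The closed form reads only the observations indexed by s, so it factors through a block
independent of observation i. -/
theorem indepFun_ridgeSolution {n k k' : ℕ} {α : Type*} [MeasurableSpace α] {A : Fin n → Ω → α}
    (hA : ∀ i, Measurable (A i)) (hind : iIndepFun A P) {s : Finset (Fin n)} {lam : ℝ}
    {f : α → Fin k' → ℝ} {g : α → ℝ} (hf : Measurable f) (hg : Measurable g)
    {φ : α → Fin k → ℝ} (hφ : Measurable φ) {i : Fin n} (hi : i ∉ s) :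
    IndepFun (fun ω => φ (A i ω))
      (fun ω => ridgeSolution s lam (fun j => f (A j ω)) (fun j => g (A j ω))) P := by
  classical
  have h := (hind.indepFun_finset {i} s (by simpa using hi) hA)
  -- Data indexed by s extended by 0 to all indices; `ridgeSolution_congr` says that the filler is
  -- never read.
  let f' : Fin n → (s → α) → Fin k' → ℝ := fun j a => if hj : j ∈ s then f (a ⟨j, hj⟩) else 0
  let g' : Fin n → (s → α) → ℝ := fun j a => if hj : j ∈ s then g (a ⟨j, hj⟩) else 0
  have hf' : ∀ j, Measurable (f' j) := fun j => by
    by_cases hj : j ∈ s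
    · have e : f' j = f ∘ fun a => a ⟨j, hj⟩ := by ext a : 1; exact dif_pos hj
      rw [e]; exact hf.comp (measurable_pi_apply _)
    · have e : f' j = fun _ => 0 := by ext a : 1; exact dif_neg hj
      rw [e]; exact measurable_const
  have hg' : ∀ j, Measurable (g' j) := fun j => by
    by_cases hj : j ∈ s
    · have e : g' j = g ∘ fun a => a ⟨j, hj⟩ := by ext a : 1; exact dif_pos hj
      rw [e]; exact hg.comp (measurable_pi_apply _)
    · have e : g' j = fun _ => 0 := by ext a : 1; exact dif_neg hj
      rw [e]; exact measurable_const
  let Ψ : (s → α) → Fin k' → ℝ := fun a =>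
    ridgeSolution s lam (fun j => f' j a) (fun j => g' j a)
  have hΨ : Measurable Ψ := measurable_ridgeSolution hf' hg'
  have h2 := h.comp (φ := fun a : (({i} : Finset (Fin n)) → α) =>
    φ (a ⟨i, Finset.mem_singleton_self i⟩)) (ψ := Ψ) (by fun_prop) hΨ
  have e : ∀ ω, ridgeSolution s lam (fun j => f (A j ω)) (fun j => g (A j ω)) =
      Ψ (fun j => A j ω) := fun ω => by
    have e1 : ∀ j ∈ s, f (A j ω) = f' j (fun j => A j ω) := fun j hj => by simp [f', hj]
    have e2 : ∀ j ∈ s, g (A j ω) = g' j (fun j => A j ω) := fun j hj => by simp [g', hj]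
    exact ridgeSolution_congr e1 e2
  simp only [e]
  exact h2

section

variable {n k : ℕ} {κ Cmin Cmax σε : ℝ} {Sig : Matrix (Fin k) (Fin k) ℝ} {β₀ : Fin k → ℝ}
  {x : Fin n → Ω → Fin k → ℝ} {ε y : Fin n → Ω → ℝ}

theorem LinearModel.eighth_moment (h : LinearModel P κ Cmin Cmax σε Sig β₀ x ε y)
    (hκ : 1 ≤ κ) (hCmin : 0 < Cmin) (hC : Cmin ≤ Cmax) (i : Fin n) {v : Fin k → ℝ} {c : ℝ}
    (hv : v ⬝ᵥ v ≤ c) :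
    ExpLe P (fun ω => (v ⬝ᵥ x i ω) ^ 8) (161280 * (κ ^ 2 * Cmax) ^ 4 * c ^ 4) := by
  have h8 := h.even_moment hκ hCmin hC i v (q := 4) (by norm_num)
  have hC' : 0 < Cmax := hCmin.trans_le hC
  refine h8.mono_bound ?_
  have e : (4 : ℝ) * (2 * 4).factorial = 161280 := by norm_num [Nat.factorial]
  rw [e, mul_pow, mul_assoc]
  have := pow_le_pow_left₀ (dotProduct_self_nonneg' v) hv 4
  gcongr

theorem LinearModel.fourth_moment (h : LinearModel P κ Cmin Cmax σε Sig β₀ x ε y)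
    (hκ : 1 ≤ κ) (hCmin : 0 < Cmin) (hC : Cmin ≤ Cmax) (i : Fin n) (v : Fin k → ℝ) :
    ExpLe P (fun ω => (v ⬝ᵥ x i ω) ^ 4) (96 * (κ ^ 2 * Cmax) ^ 2 * (v ⬝ᵥ v) ^ 2) := by
  have h4 := h.even_moment hκ hCmin hC i v (q := 2) (by norm_num)
  refine h4.mono_bound (le_of_eq ?_)
  have e : (4 : ℝ) * (2 * 2).factorial = 96 := by norm_num [Nat.factorial]
  rw [e, mul_pow, mul_assoc]

theorem LinearModel.noise_eighth_moment (h : LinearModel P κ Cmin Cmax σε Sig β₀ x ε y)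
    (hσ : 0 < σε) (i : Fin n) : ExpLe P (fun ω => ε i ω ^ 8) (161280 * σε ^ 8) := by
  have h8 := HasSubgaussianMGF.even_moment (h.noise_subgaussian i) (T := σε ^ 2) (by positivity)
    (le_of_eq (Real.coe_toNNReal _ (by positivity))) 4
  refine h8.mono_bound (le_of_eq ?_)
  have e : (4 : ℝ) * (2 * 4).factorial = 161280 := by norm_num [Nat.factorial]
  rw [e]; ring

theorem LinearModel.measurable_dir (h : LinearModel P κ Cmin Cmax σε Sig β₀ x ε y) (i : Fin n)
    (v : Fin k → ℝ) : Measurable fun ω => v ⬝ᵥ x i ω := by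
  have := h.measurable_x i
  simp only [dotProduct]; fun_prop

theorem LinearModel.integrable_dir (h : LinearModel P κ Cmin Cmax σε Sig β₀ x ε y) (i : Fin n)
    (v : Fin k → ℝ) : Integrable (fun ω => v ⬝ᵥ x i ω) P :=
  (h.design_subgaussian i v).integrable

/-- Moments of a sum of centred products of the noise and a linear form of the covariate. -/
theorem LinearModel.sum_noise_mul [IsProbabilityMeasure P]
    (h : LinearModel P κ Cmin Cmax σε Sig β₀ x ε y)
    (hκ : 1 ≤ κ) (hCmin : 0 < Cmin) (hC : Cmin ≤ Cmax) (hσ : 0 < σε) {v : Fin k → ℝ} {c A : ℝ}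
    (hv : v ⬝ᵥ v ≤ c) (hA : 0 < A)
    (hA2 : (161280 + 161280 * (κ ^ 2 * Cmax) ^ 4 * c ^ 4) / 2 ≤ A ^ 2) (s : Finset (Fin n)) :
    ExpLe P (fun ω => (∑ i ∈ s, ε i ω * (v ⬝ᵥ x i ω)) ^ 2) (s.card * (A * σε ^ 2)) ∧
    ExpLe P (fun ω => (∑ i ∈ s, ε i ω * (v ⬝ᵥ x i ω)) ^ 4) (3 * (s.card * (A * σε ^ 2)) ^ 2) := by
  refine (expLe_sum_fourth (W := fun i ω => ε i ω * (v ⬝ᵥ x i ω)) (by positivity)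
    (h.indep_comp (F := fun z => z.2 * (v ⬝ᵥ z.1)) (by simp only [dotProduct]; fun_prop))
    (fun i => (h.measurable_noise i).mul (h.measurable_dir i v)) (fun i => ?_) (fun i => ?_) s).2
  · have hi : IndepFun (ε i) (fun ω => v ⬝ᵥ x i ω) P :=
      (h.indep_noise i).symm.comp (φ := id) (ψ := fun z : Fin k → ℝ => v ⬝ᵥ z) measurable_id
        (by simp only [dotProduct]; fun_prop)
    rw [hi.integral_fun_mul_eq_mul_integral (h.measurable_noise i).aestronglyMeasurable
      (h.measurable_dir i v).aestronglyMeasurable, h.noise_mean i, zero_mul]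
  · refine (expLe_mul_pow_four hσ (h.measurable_noise i).aestronglyMeasurable
      (h.measurable_dir i v).aestronglyMeasurable (h.noise_eighth_moment hσ i)
      (h.eighth_moment hκ hCmin hC i hv)).mono_bound ?_
    calc _ ≤ A ^ 2 * σε ^ 4 := by gcongr
      _ = _ := by ring

/-- Moments of a sum of centred products of two linear forms of the covariate. -/
theorem LinearModel.sum_mul_sub [IsProbabilityMeasure P]
    (h : LinearModel P κ Cmin Cmax σε Sig β₀ x ε y)
    (hκ : 1 ≤ κ) (hCmin : 0 < Cmin) (hC : Cmin ≤ Cmax) {v w : Fin k → ℝ} {c c' A m : ℝ}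
    (hv : v ⬝ᵥ v ≤ c) (hw : w ⬝ᵥ w ≤ c') (hA : 0 < A)
    (hm : ∀ i, ∫ ω, (v ⬝ᵥ x i ω) * (w ⬝ᵥ x i ω) ∂P = m)
    (hA2 : 4 * (161280 * (κ ^ 2 * Cmax) ^ 4 * c ^ 4 + 161280 * (κ ^ 2 * Cmax) ^ 4 * c' ^ 4) +
      8 * m ^ 4 ≤ A ^ 2) (s : Finset (Fin n)) :
    ExpLe P (fun ω => (∑ i ∈ s, ((v ⬝ᵥ x i ω) * (w ⬝ᵥ x i ω) - m)) ^ 2) (s.card * A) ∧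
    ExpLe P (fun ω => (∑ i ∈ s, ((v ⬝ᵥ x i ω) * (w ⬝ᵥ x i ω) - m)) ^ 4)
      (3 * (s.card * A) ^ 2) := by
  have hmeas : ∀ i, Measurable fun ω => (v ⬝ᵥ x i ω) * (w ⬝ᵥ x i ω) :=
    fun i => (h.measurable_dir i v).mul (h.measurable_dir i w)
  have h4 : ∀ i, ExpLe P (fun ω => ((v ⬝ᵥ x i ω) * (w ⬝ᵥ x i ω)) ^ 4)
      ((161280 * (κ ^ 2 * Cmax) ^ 4 * c ^ 4 + 161280 * (κ ^ 2 * Cmax) ^ 4 * c' ^ 4) / 2) :=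
    fun i => by
      have h8 := h.eighth_moment hκ hCmin hC i hv
      refine (expLe_mul_pow_four one_pos (h.measurable_dir i v).aestronglyMeasurable
        (h.measurable_dir i w).aestronglyMeasurable (by simpa using h8)
        (h.eighth_moment hκ hCmin hC i hw)).mono_bound (le_of_eq ?_)
      ring
  refine (expLe_sum_fourth (W := fun i ω => (v ⬝ᵥ x i ω) * (w ⬝ᵥ x i ω) - m) (by positivity)
    (h.indep_comp (F := fun z => (v ⬝ᵥ z.1) * (w ⬝ᵥ z.1) - m)
      (by simp only [dotProduct]; fun_prop))
    (fun i => (hmeas i).sub_const m) (fun i => ?_) (fun i => ?_) s).2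
  · have hi : Integrable (fun ω => (v ⬝ᵥ x i ω) * (w ⬝ᵥ x i ω)) P := by
      simpa using integrable_pow_of_fourth (hmeas i).aestronglyMeasurable (h4 i).1
        (q := 1) (by norm_num)
    rw [integral_sub hi (integrable_const _), hm i]; simp
  · have := ((h4 i).const_mul (c := 8) (by norm_num)).add (ExpLe.const (P := P) (8 * m ^ 4))
    refine (this.mono (((hmeas i).sub_const m).pow_const 4).aestronglyMeasurable
      (fun ω => by positivity) fun ω => ?_).mono_bound (le_trans (le_of_eq (by ring)) hA2)
    generalize (v ⬝ᵥ x i ω) * (w ⬝ᵥ x i ω) = z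
    have h1 : (z - m) ^ 2 ≤ 2 * z ^ 2 + 2 * m ^ 2 := by nlinarith [sq_nonneg (z + m)]
    have h2 := pow_le_pow_left₀ (sq_nonneg _) h1 2
    nlinarith [sq_nonneg (z ^ 2 - m ^ 2)]

end

section

variable {n d : ℕ} {κ Cmin Cmax σε ση : ℝ} {Sig : Matrix (Fin (d + 1)) (Fin (d + 1)) ℝ}
  {β₀ xs : Fin (d + 1) → ℝ} {R : Matrix (Fin d) (Fin (d + 1)) ℝ} {g₀ : Fin d → ℝ}
  {x : Fin n → Ω → Fin (d + 1) → ℝ} {ε y : Fin n → Ω → ℝ}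

theorem mulVec_dotProduct (R : Matrix (Fin d) (Fin (d + 1)) ℝ) (a : Fin (d + 1) → ℝ)
    (v : Fin d → ℝ) : (R *ᵥ a) ⬝ᵥ v = (v ᵥ* R) ⬝ᵥ a := by
  rw [dotProduct_comm, Matrix.dotProduct_mulVec]

theorem TreatmentModel.variance_eq (ht : TreatmentModel P ση xs R g₀ x)
    (hR : IsOrthoComplement xs R) (hxs : xs ≠ 0) (i : Fin n) :
    ∫ ω, (residualDir xs R g₀ ⬝ᵥ x i ω) ^ 2 ∂P = (l2norm xs * ση) ^ 2 := by
  have hL := l2norm_pos hxs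
  have h := ht.eta_var i
  simp only [hR.etaPart_eq hxs, mul_pow] at h
  rw [integral_const_mul] at h
  rw [mul_pow, ← h]; field_simp

/-- The residual direction has squared length 1 + ‖g₀‖², so the residual variance is at least Cmin(1
+ ‖g₀‖²). Comparing the minimiser g₀ with 0 bounds it above by the variance along u, at most Cmax.
-/
theorem TreatmentModel.residual_bounds (ht : TreatmentModel P ση xs R g₀ x)
    (h : LinearModel P κ Cmin Cmax σε Sig β₀ x ε y)
    (hκ : 1 ≤ κ) (hCmin : 0 < Cmin) (hC : Cmin ≤ Cmax)
    (hR : IsOrthoComplement xs R) (hxs : xs ≠ 0) (i : Fin n) :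
    Cmin ≤ (l2norm xs * ση) ^ 2 ∧ (l2norm xs * ση) ^ 2 ≤ Cmax ∧
      1 + g₀ ⬝ᵥ g₀ ≤ Cmax / Cmin := by
  have hL := l2norm_pos hxs
  have hv := ht.variance_eq hR hxs i
  have hmin := h.cov_min (residualDir xs R g₀)
  rw [l2norm_sq, hR.residualDir_dotProduct_self hxs] at hmin
  have e : ∫ ω, (residualDir xs R g₀ ⬝ᵥ x i ω) ^ 2 ∂P =
      residualDir xs R g₀ ⬝ᵥ Sig *ᵥ residualDir xs R g₀ := by
    rw [← h.integral_mul hκ hCmin hC i]; simp only [sq]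
  have eu : ∫ ω, (unitDir xs ⬝ᵥ x i ω) ^ 2 ∂P = unitDir xs ⬝ᵥ Sig *ᵥ unitDir xs := by
    rw [← h.integral_mul hκ hCmin hC i]; simp only [sq]
  have hmax := h.cov_max (unitDir xs)
  rw [l2norm_sq, unitDir_dotProduct_self hxs, mul_one] at hmax
  have harg := ht.argmin i 0
  have e1 : ∀ ω, (tPart xs R (x i ω) - zPart xs R (x i ω) ⬝ᵥ g₀) ^ 2 =
      ((l2norm xs)⁻¹) ^ 2 * (residualDir xs R g₀ ⬝ᵥ x i ω) ^ 2 := fun ω => by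
    rw [← mul_pow, ← hR.etaPart_eq hxs]; rfl
  have e2 : ∀ ω, (tPart xs R (x i ω) - zPart xs R (x i ω) ⬝ᵥ (0 : Fin d → ℝ)) ^ 2 =
      ((l2norm xs)⁻¹) ^ 2 * (unitDir xs ⬝ᵥ x i ω) ^ 2 := fun ω => by
    rw [dotProduct_zero, sub_zero, hR.tPart_eq hxs, mul_pow]
  simp only [e1, e2] at harg
  rw [integral_const_mul, integral_const_mul] at harg
  have harg' := le_of_mul_le_mul_left harg (by positivity)
  have hg := dotProduct_self_nonneg' g₀
  refine ⟨?_, ?_, ?_⟩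
  · nlinarith
  · linarith
  · rw [le_div_iff₀ hCmin]; linarith

/-- The orthogonality behind the estimator. The conditional mean makes the residual centred, and its
independence from z then factors the expectation. -/
theorem TreatmentModel.integral_residual_mul (ht : TreatmentModel P ση xs R g₀ x)
    (h : LinearModel P κ Cmin Cmax σε Sig β₀ x ε y)
    [IsProbabilityMeasure P] (hR : IsOrthoComplement xs R) (hxs : xs ≠ 0) (i : Fin n)
    (v : Fin d → ℝ) :
    ∫ ω, (residualDir xs R g₀ ⬝ᵥ x i ω) * ((v ᵥ* R) ⬝ᵥ x i ω) ∂P = 0 := by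
  have hL := l2norm_pos hxs
  have hzg : ∀ (w : Fin d → ℝ) ω, zPart xs R (x i ω) ⬝ᵥ w =
      (l2norm xs)⁻¹ * ((w ᵥ* R) ⬝ᵥ x i ω) := fun w ω => by
    rw [hR.zPart_eq hxs, smul_dotProduct, mulVec_dotProduct, smul_eq_mul]
  have hzm : Measurable fun ω => zPart xs R (x i ω) := by
    refine measurable_pi_lambda _ fun j => ?_
    simp only [hR.zPart_eq hxs, Pi.smul_apply, smul_eq_mul]
    exact (h.measurable_dir i (R j)).const_mul _
  have hmean : ∫ ω, residualDir xs R g₀ ⬝ᵥ x i ω ∂P = 0 := by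
    have h1 : ∫ ω, tPart xs R (x i ω) ∂P = ∫ ω, zPart xs R (x i ω) ⬝ᵥ g₀ ∂P := by
      rw [← integral_condExp hzm.comap_le, integral_congr_ae (ht.condExp_eq i)]
    simp only [hzg, hR.tPart_eq hxs] at h1
    rw [integral_const_mul, integral_const_mul] at h1
    have h2 := mul_left_cancel₀ (inv_ne_zero hL.ne') h1
    simp only [residualDir_dotProduct, mulVec_dotProduct]
    rw [integral_sub (h.integrable_dir i _) (h.integrable_dir i _), h2, sub_self]
  have hind := (ht.indep_eta i).comp (φ := fun r => l2norm xs * r)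
    (ψ := fun z : Fin d → ℝ => l2norm xs * (z ⬝ᵥ v)) (by fun_prop)
    (by simp only [dotProduct]; fun_prop)
  have e1 : (fun r => l2norm xs * r) ∘ (fun ω => etaPart xs R g₀ (x i ω)) =
      fun ω => residualDir xs R g₀ ⬝ᵥ x i ω := by
    ext ω; simp only [Function.comp, hR.etaPart_eq hxs]; rw [mul_inv_cancel_left₀ hL.ne']
  have e2 : (fun z : Fin d → ℝ => l2norm xs * (z ⬝ᵥ v)) ∘ (fun ω => zPart xs R (x i ω)) =
      fun ω => (v ᵥ* R) ⬝ᵥ x i ω := by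
    ext ω; simp only [Function.comp, hzg]; rw [mul_inv_cancel_left₀ hL.ne']
  rw [e1, e2] at hind
  rw [hind.integral_fun_mul_eq_mul_integral (h.measurable_dir i _).aestronglyMeasurable
    (h.measurable_dir i _).aestronglyMeasurable, hmean, zero_mul]

/-- The treatment is the residual plus a linear form in z, which is orthogonal to the residual. -/
theorem TreatmentModel.integral_treatment_mul (ht : TreatmentModel P ση xs R g₀ x)
    (h : LinearModel P κ Cmin Cmax σε Sig β₀ x ε y) [IsProbabilityMeasure P]
    (hκ : 1 ≤ κ) (hCmin : 0 < Cmin) (hC : Cmin ≤ Cmax)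
    (hR : IsOrthoComplement xs R) (hxs : xs ≠ 0) (i : Fin n) :
    ∫ ω, (unitDir xs ⬝ᵥ x i ω) * (residualDir xs R g₀ ⬝ᵥ x i ω) ∂P = (l2norm xs * ση) ^ 2 := by
  have h1 := ht.variance_eq hR hxs i
  have h2 := ht.integral_residual_mul h hR hxs i g₀
  have e : unitDir xs = residualDir xs R g₀ + g₀ ᵥ* R := by rw [residualDir]; abel
  simp only [sq] at h1
  rw [h.integral_mul hκ hCmin hC] at h1 h2 ⊢
  have hsymm : (g₀ ᵥ* R) ⬝ᵥ Sig *ᵥ residualDir xs R g₀ =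
      residualDir xs R g₀ ⬝ᵥ Sig *ᵥ (g₀ ᵥ* R) := by
    rw [← h.integral_mul hκ hCmin hC i, ← h.integral_mul hκ hCmin hC i]
    simp only [mul_comm]
  rw [e, add_dotProduct, hsymm, h2, h1, add_zero, sq]

end

end OMRidge

/-! ### The deterministic error inequality, and arithmetic of the ridge constants. -/

namespace OMRidge

section Deterministic

theorem avg_sq_le {ι : Type*} (s : Finset ι) {c : ℝ} (hc : 0 < c) (hcs : c * s.card = 1)
    (f : ι → ℝ) : (c * ∑ i ∈ s, f i) ^ 2 ≤ c * ∑ i ∈ s, f i ^ 2 := by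
  have h := sq_sum_le_card_mul_sum_sq (s := s) (f := f)
  calc (c * ∑ i ∈ s, f i) ^ 2 = c ^ 2 * (∑ i ∈ s, f i) ^ 2 := by ring
    _ ≤ c ^ 2 * (s.card * ∑ i ∈ s, f i ^ 2) := by gcongr
    _ = c * (c * s.card) * ∑ i ∈ s, f i ^ 2 := by ring
    _ = _ := by rw [hcs, mul_one]

theorem avg_pow_four_le {ι : Type*} (s : Finset ι) {c : ℝ} (hc : 0 < c) (hcs : c * s.card = 1)
    (f : ι → ℝ) : (c * ∑ i ∈ s, f i) ^ 4 ≤ c * ∑ i ∈ s, f i ^ 4 := by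
  have h1 := avg_sq_le s hc hcs f
  have h2 := avg_sq_le s hc hcs fun i => f i ^ 2
  have e : ∀ i, (f i ^ 2) ^ 2 = f i ^ 4 := fun i => by ring
  simp only [e] at h2
  calc (c * ∑ i ∈ s, f i) ^ 4 = ((c * ∑ i ∈ s, f i) ^ 2) ^ 2 := by ring
    _ ≤ (c * ∑ i ∈ s, f i ^ 2) ^ 2 := by gcongr
    _ ≤ _ := h2

/-- The weight matches the scales: outcome quantities squared are of order σ², treatment quantities
of order 1. It turns products of dependent estimates into sums whose expectations are bounded
separately. -/
theorem mul_le_half_sq_add {a b σ : ℝ} (hσ : 0 < σ) :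
    a * b ≤ 1 / (2 * σ ^ 2) * a ^ 2 + σ ^ 2 / 2 * b ^ 2 := by
  have e : 1 / (2 * σ ^ 2) * a ^ 2 + σ ^ 2 / 2 * b ^ 2 - a * b =
      (a - σ ^ 2 * b) ^ 2 / (2 * σ ^ 2) := by field_simp; ring
  have : 0 ≤ (a - σ ^ 2 * b) ^ 2 / (2 * σ ^ 2) := by positivity
  linarith

variable {n d : ℕ} {s : Finset (Fin n)} {c s2 σ q r₀ : ℝ} {T H e : Fin n → ℝ}
  {Z : Fin n → Fin d → ℝ} {Df Dg : Fin d → ℝ}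

/-- The product is expanded into one noise term, two terms linear in a first-stage error, and one
bilinear term. Each linear term pairs an average, itself small, with an error by Cauchy–Schwarz. -/
theorem sq_numerator_le (hc : 0 < c) (hcs : c * s.card = 1) (hσ : 0 < σ) (hq : Df ⬝ᵥ Df ≤ q) :
    (c * ∑ i ∈ s, (e i - Z i ⬝ᵥ Df) * (H i - Z i ⬝ᵥ Dg)) ^ 2 ≤
      4 * (c ^ 2 * (∑ i ∈ s, e i * H i) ^ 2 +
        ((1 / (2 * σ ^ 2) * (c ^ 4 * (d * ∑ j, (∑ i ∈ s, e i * Z i j) ^ 4)) +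
            σ ^ 2 / 2 * (Dg ⬝ᵥ Dg) ^ 2) +
          ((1 / (2 * σ ^ 2) * q ^ 2 +
              σ ^ 2 / 2 * (c ^ 4 * (d * ∑ j, (∑ i ∈ s, H i * Z i j) ^ 4))) +
            c * ∑ i ∈ s, (1 / (2 * σ ^ 2) * (Z i ⬝ᵥ Df) ^ 4 +
              σ ^ 2 / 2 * (Z i ⬝ᵥ Dg) ^ 4)))) := by
  set a1 := c * ∑ i ∈ s, e i * H i with ha1
  set v1 : Fin d → ℝ := c • ∑ i ∈ s, e i • Z i with hv1
  set v2 : Fin d → ℝ := c • ∑ i ∈ s, H i • Z i with hv2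
  set a4 := c * ∑ i ∈ s, (Z i ⬝ᵥ Df) * (Z i ⬝ᵥ Dg) with ha4
  have hN : c * ∑ i ∈ s, (e i - Z i ⬝ᵥ Df) * (H i - Z i ⬝ᵥ Dg) =
      a1 - v1 ⬝ᵥ Dg - v2 ⬝ᵥ Df + a4 := by
    rw [hv1, hv2, smul_dotProduct, smul_dotProduct, sum_dotProduct, sum_dotProduct, ha1, ha4]
    simp only [smul_eq_mul, smul_dotProduct]
    rw [← mul_sub, ← mul_sub, ← mul_add, ← Finset.sum_sub_distrib, ← Finset.sum_sub_distrib,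
      ← Finset.sum_add_distrib]
    congr 1
    exact Finset.sum_congr rfl fun i _ => by ring
  have hv : ∀ (f : Fin n → ℝ) (v : Fin d → ℝ), v = c • ∑ i ∈ s, f i • Z i →
      (v ⬝ᵥ v) ^ 2 ≤ c ^ 4 * (d * ∑ j, (∑ i ∈ s, f i * Z i j) ^ 4) := fun f v hv => by
    refine (dotProduct_self_sq_le v).trans (le_of_eq ?_)
    have e : ∀ j, v j = c * ∑ i ∈ s, f i * Z i j := fun j => by simp [hv]
    simp only [e, mul_pow]
    rw [← Finset.mul_sum]; ring
  have hb1 := hv e v1 hv1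
  have hb2 := hv H v2 hv2
  have h1 : (v1 ⬝ᵥ Dg) ^ 2 ≤ 1 / (2 * σ ^ 2) * (c ^ 4 * (d * ∑ j, (∑ i ∈ s, e i * Z i j) ^ 4)) +
      σ ^ 2 / 2 * (Dg ⬝ᵥ Dg) ^ 2 := by
    refine (dotProduct_sq_le _ _).trans ((mul_le_half_sq_add hσ).trans ?_)
    gcongr
  have h2 : (v2 ⬝ᵥ Df) ^ 2 ≤ 1 / (2 * σ ^ 2) * q ^ 2 +
      σ ^ 2 / 2 * (c ^ 4 * (d * ∑ j, (∑ i ∈ s, H i * Z i j) ^ 4)) := by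
    refine (dotProduct_sq_le _ _).trans ?_
    rw [mul_comm]
    refine (mul_le_half_sq_add hσ).trans ?_
    have := dotProduct_self_nonneg' Df
    gcongr
  have h4 : a4 ^ 2 ≤ c * ∑ i ∈ s, (1 / (2 * σ ^ 2) * (Z i ⬝ᵥ Df) ^ 4 +
      σ ^ 2 / 2 * (Z i ⬝ᵥ Dg) ^ 4) := by
    refine (avg_sq_le s hc hcs _).trans ?_
    refine mul_le_mul_of_nonneg_left (Finset.sum_le_sum fun i _ => ?_) hc.le
    have := mul_le_half_sq_add (a := (Z i ⬝ᵥ Df) ^ 2) (b := (Z i ⬝ᵥ Dg) ^ 2) hσ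
    calc _ = (Z i ⬝ᵥ Df) ^ 2 * (Z i ⬝ᵥ Dg) ^ 2 := by ring
      _ ≤ _ := this
      _ = _ := by ring
  have h0 : a1 ^ 2 = c ^ 2 * (∑ i ∈ s, e i * H i) ^ 2 := by rw [ha1]; ring
  rw [hN, ← h0]
  have hsq : ∀ a b x y : ℝ, (a - b - x + y) ^ 2 ≤ 4 * (a ^ 2 + (b ^ 2 + (x ^ 2 + y ^ 2))) :=
    fun a b x y => by
      nlinarith [sq_nonneg (a + b), sq_nonneg (a + x), sq_nonneg (a - y), sq_nonneg (b - x),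
        sq_nonneg (b + y), sq_nonneg (x + y)]
  refine (hsq _ _ _ _).trans ?_
  gcongr

/-- The error of the thresholded estimate is controlled by moments of order four. -/
theorem sq_error_le (hc : 0 < c) (hcs : c * s.card = 1) (hs2 : 0 < s2) (hσ : 0 < σ)
    (hr : r₀ ^ 2 ≤ q) (hq : Df ⬝ᵥ Df ≤ q) :
    (if c * ∑ i ∈ s, T i * (H i - Z i ⬝ᵥ Dg) ≤ s2 / 4 then r₀ else
      (c * ∑ i ∈ s, (e i - Z i ⬝ᵥ Df) * (H i - Z i ⬝ᵥ Dg)) /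
        (c * ∑ i ∈ s, T i * (H i - Z i ⬝ᵥ Dg))) ^ 2 ≤
      (1 / (2 * σ ^ 2) * q ^ 2 + (8 * σ ^ 2 / s2 ^ 2 * (c ^ 2 * (∑ i ∈ s, (T i * H i - s2)) ^ 2) +
        8 * σ ^ 2 / s2 ^ 4 * (c * ∑ i ∈ s, (T i * (Z i ⬝ᵥ Dg)) ^ 4))) +
      64 / s2 ^ 2 * (c ^ 2 * (∑ i ∈ s, e i * H i) ^ 2 +
        ((1 / (2 * σ ^ 2) * (c ^ 4 * (d * ∑ j, (∑ i ∈ s, e i * Z i j) ^ 4)) +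
            σ ^ 2 / 2 * (Dg ⬝ᵥ Dg) ^ 2) +
          ((1 / (2 * σ ^ 2) * q ^ 2 +
              σ ^ 2 / 2 * (c ^ 4 * (d * ∑ j, (∑ i ∈ s, H i * Z i j) ^ 4))) +
            c * ∑ i ∈ s, (1 / (2 * σ ^ 2) * (Z i ⬝ᵥ Df) ^ 4 +
              σ ^ 2 / 2 * (Z i ⬝ᵥ Dg) ^ 4)))) := by
  have hN := sq_numerator_le (e := e) (H := H) (Z := Z) (Dg := Dg) hc hcs hσ hq
  set N := c * ∑ i ∈ s, (e i - Z i ⬝ᵥ Df) * (H i - Z i ⬝ᵥ Dg)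
  set G := (c ^ 2 * (∑ i ∈ s, e i * H i) ^ 2 +
        ((1 / (2 * σ ^ 2) * (c ^ 4 * (d * ∑ j, (∑ i ∈ s, e i * Z i j) ^ 4)) +
            σ ^ 2 / 2 * (Dg ⬝ᵥ Dg) ^ 2) +
          ((1 / (2 * σ ^ 2) * q ^ 2 +
              σ ^ 2 / 2 * (c ^ 4 * (d * ∑ j, (∑ i ∈ s, H i * Z i j) ^ 4))) +
            c * ∑ i ∈ s, (1 / (2 * σ ^ 2) * (Z i ⬝ᵥ Df) ^ 4 +
              σ ^ 2 / 2 * (Z i ⬝ᵥ Dg) ^ 4))))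
  set aW := c * ∑ i ∈ s, (T i * H i - s2) with haW
  set bT := c * ∑ i ∈ s, T i * (Z i ⬝ᵥ Dg) with hbT
  have hM : c * ∑ i ∈ s, T i * (H i - Z i ⬝ᵥ Dg) = s2 + aW - bT := by
    rw [haW, hbT, Finset.sum_sub_distrib, Finset.sum_const, nsmul_eq_mul]
    simp only [mul_sub, Finset.sum_sub_distrib]
    linear_combination s2 * hcs
  have hb4 := avg_pow_four_le s hc hcs fun i => T i * (Z i ⬝ᵥ Dg)
  rw [← hbT] at hb4
  have hW2 : c ^ 2 * (∑ i ∈ s, (T i * H i - s2)) ^ 2 = aW ^ 2 := by rw [haW]; ring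
  rw [hM, hW2]
  have hG0 : 0 ≤ G := by nlinarith [sq_nonneg N]
  set V := c * ∑ i ∈ s, (T i * (Z i ⬝ᵥ Dg)) ^ 4
  have hV0 : 0 ≤ V := le_trans (by positivity) hb4
  by_cases h : s2 + aW - bT ≤ s2 / 4
  · rw [if_pos h]
    -- Falling below s2/4 means aW − bT ≤ −3 s2/4, so aW ≤ −s2/4 or bT ≥ s2/2. The fourth power of
    -- bT is what yields the rate p²/n².
    have hone : 1 ≤ 16 / s2 ^ 2 * aW ^ 2 + 16 / s2 ^ 4 * bT ^ 4 := by
      by_cases h1 : aW ≤ -(s2 / 4)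
      · have : (s2 / 4) ^ 2 ≤ aW ^ 2 := by nlinarith
        have h2 : 1 ≤ 16 / s2 ^ 2 * aW ^ 2 := by
          rw [div_mul_eq_mul_div, le_div_iff₀ (by positivity)]; linarith
        have : 0 ≤ 16 / s2 ^ 4 * bT ^ 4 := by positivity
        linarith
      · have h1 : s2 / 2 ≤ bT := by linarith [not_le.1 h1]
        have : (s2 / 2) ^ 4 ≤ bT ^ 4 := pow_le_pow_left₀ (by positivity) h1 4
        have h2 : 1 ≤ 16 / s2 ^ 4 * bT ^ 4 := by
          rw [div_mul_eq_mul_div, le_div_iff₀ (by positivity)]; linarith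
        have : 0 ≤ 16 / s2 ^ 2 * aW ^ 2 := by positivity
        linarith
    -- The fallback error is split by AM-GM; the summand σ²/2 is then multiplied by the quantity
    -- just shown to be at least 1.
    have h3 : q ≤ 1 / (2 * σ ^ 2) * q ^ 2 + σ ^ 2 / 2 := by
      simpa using mul_le_half_sq_add (a := q) (b := 1) hσ
    have h4 : σ ^ 2 / 2 * 1 ≤ σ ^ 2 / 2 * (16 / s2 ^ 2 * aW ^ 2 + 16 / s2 ^ 4 * V) := by
      refine mul_le_mul_of_nonneg_left (hone.trans ?_) (by positivity)
      gcongr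
    have h5 : σ ^ 2 / 2 * (16 / s2 ^ 2 * aW ^ 2 + 16 / s2 ^ 4 * V) =
        8 * σ ^ 2 / s2 ^ 2 * aW ^ 2 + 8 * σ ^ 2 / s2 ^ 4 * V := by ring
    have h6 : 0 ≤ 64 / s2 ^ 2 * G := by positivity
    linarith
  · rw [if_neg h]
    rw [not_le] at h
    set M := s2 + aW - bT
    have hMp : 0 < M := by linarith
    have h1 : (N / M) ^ 2 ≤ 64 / s2 ^ 2 * G := by
      rw [div_pow, div_le_iff₀ (by positivity)]
      have hM2 : s2 ^ 2 / 16 ≤ M ^ 2 := by nlinarith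
      calc N ^ 2 ≤ 4 * G := hN
        _ = 64 / s2 ^ 2 * G * (s2 ^ 2 / 16) := by field_simp; ring
        _ ≤ _ := by gcongr
    have : 0 ≤ 1 / (2 * σ ^ 2) * q ^ 2 + (8 * σ ^ 2 / s2 ^ 2 * aW ^ 2 +
      8 * σ ^ 2 / s2 ^ 4 * V) := by positivity
    linarith

end Deterministic

/-- The constant in the fourth moment bound for the ridge estimates. -/
noncomputable def ridgeConst (κ Cmin c A E₈ L₁ L₂ : ℝ) : ℝ :=
  128 * 64 ^ 4 / Cmin ^ 4 * (A ^ 2 + L₁) + (2 * (E₈ + 1) * c ^ 2 / Cmin ^ 2 +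
    256 * 3200 ^ 2 * L₂ * κ ^ 8 * c ^ 4)

/-- The three summands are the error on the good event, the noise on the bad event, and the bias on
the bad event. In the second, λ² ≥ (N⁴ Cmin²/(p² c²)) e^{−ρ/6400} cancels the exponential exactly.
-/
theorem ridge_bound_le {κ Cmin c A E₈ L₁ L₂ N p k m lam b2 σ ρ : ℝ}
    (hκ : 1 ≤ κ) (hCmin : 0 < Cmin) (hc : 1 ≤ c) (hE : 0 ≤ E₈) (hN : 0 < N)
    (hp : 0 < p) (hk0 : 0 ≤ k) (hkp : k ≤ p) (hm : m = N / 2) (hσ : 0 < σ)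
    (hρ : ρ = N / (κ ^ 4 * c ^ 2))
    (hlam : N ^ 2 * Cmin / (p * c) * Real.exp (-(ρ / 12800)) ≤ lam)
    (hb1 : lam ^ 4 * b2 ^ 2 ≤ L₁ * σ ^ 4 * p ^ 2 * N ^ 2) (hb2 : b2 ^ 2 ≤ L₂ * σ ^ 4 * p ^ 2) :
    128 / (m * Cmin / 32) ^ 4 * (k ^ 2 * (3 * (m * (A * σ ^ 2)) ^ 2) + lam ^ 4 * b2 ^ 2) +
        (4 / lam ^ 2 * (m ^ 2 * ((E₈ + 1) * σ ^ 4 * (2 * Real.exp (-(ρ / 6400))))) +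
          32 * b2 ^ 2 * (2 * Real.exp (-(ρ / 6400))) ^ 2) ≤
      ridgeConst κ Cmin c A E₈ L₁ L₂ * σ ^ 4 * (p ^ 2 / N ^ 2) := by
  have hc0 : 0 < c := by linarith
  have hρ0 : 0 < ρ := by rw [hρ]; positivity
  have t1 : 128 / (m * Cmin / 32) ^ 4 * (k ^ 2 * (3 * (m * (A * σ ^ 2)) ^ 2) + lam ^ 4 * b2 ^ 2) ≤
      128 * 64 ^ 4 / Cmin ^ 4 * (A ^ 2 + L₁) * σ ^ 4 * (p ^ 2 / N ^ 2) := by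
    have h1 : k ^ 2 * (3 * (m * (A * σ ^ 2)) ^ 2) ≤ A ^ 2 * σ ^ 4 * p ^ 2 * N ^ 2 := by
      have h2 : k ^ 2 ≤ p ^ 2 := pow_le_pow_left₀ hk0 hkp 2
      calc k ^ 2 * (3 * (m * (A * σ ^ 2)) ^ 2) ≤ p ^ 2 * (3 * (m * (A * σ ^ 2)) ^ 2) := by gcongr
        _ = 3 / 4 * (A ^ 2 * σ ^ 4 * p ^ 2 * N ^ 2) := by rw [hm]; ring
        _ ≤ _ := by
          have : 0 ≤ A ^ 2 * σ ^ 4 * p ^ 2 * N ^ 2 := by positivity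
          linarith
    have h3 : 128 / (m * Cmin / 32) ^ 4 = 128 * 64 ^ 4 / Cmin ^ 4 / N ^ 4 := by
      rw [hm]; field_simp; ring
    rw [h3]
    calc 128 * 64 ^ 4 / Cmin ^ 4 / N ^ 4 *
          (k ^ 2 * (3 * (m * (A * σ ^ 2)) ^ 2) + lam ^ 4 * b2 ^ 2)
        ≤ 128 * 64 ^ 4 / Cmin ^ 4 / N ^ 4 *
          (A ^ 2 * σ ^ 4 * p ^ 2 * N ^ 2 + L₁ * σ ^ 4 * p ^ 2 * N ^ 2) := by gcongr
      _ = _ := by field_simp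
  have hlo : 0 < N ^ 2 * Cmin / (p * c) * Real.exp (-(ρ / 12800)) := by positivity
  have hlam0 : 0 < lam := hlo.trans_le hlam
  have hlam2 : N ^ 4 * Cmin ^ 2 / (p ^ 2 * c ^ 2) * Real.exp (-(ρ / 6400)) ≤ lam ^ 2 := by
    refine le_trans (le_of_eq ?_) (pow_le_pow_left₀ hlo.le hlam 2)
    have : Real.exp (-(ρ / 6400)) = Real.exp (-(ρ / 12800)) ^ 2 := by
      rw [← Real.exp_nat_mul]; congr 1; push_cast; ring
    rw [this]; ring
  have t2 : 4 / lam ^ 2 * (m ^ 2 * ((E₈ + 1) * σ ^ 4 * (2 * Real.exp (-(ρ / 6400))))) ≤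
      2 * (E₈ + 1) * c ^ 2 / Cmin ^ 2 * σ ^ 4 * (p ^ 2 / N ^ 2) := by
    rw [div_mul_eq_mul_div, div_le_iff₀ (by positivity)]
    refine le_trans (le_of_eq ?_) (mul_le_mul_of_nonneg_left hlam2 (by positivity))
    rw [hm]; field_simp; ring
  have t3 : 32 * b2 ^ 2 * (2 * Real.exp (-(ρ / 6400))) ^ 2 ≤
      256 * 3200 ^ 2 * L₂ * κ ^ 8 * c ^ 4 * σ ^ 4 * (p ^ 2 / N ^ 2) := by
    have e1 : Real.exp (-(ρ / 6400)) ^ 2 = Real.exp (-(ρ / 3200)) := by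
      rw [← Real.exp_nat_mul]; congr 1; push_cast; ring
    -- Only polynomial decay is kept: e^{−t} ≤ 2/t² with t = ρ/3200.
    have e2 : Real.exp (-(ρ / 3200)) ≤ 2 * 3200 ^ 2 * (κ ^ 8 * c ^ 4 / N ^ 2) := by
      rw [Real.exp_neg, inv_le_comm₀ (Real.exp_pos _) (by positivity)]
      have h0 : 0 ≤ ρ / 3200 := by positivity
      have h1 := Real.quadratic_le_exp_of_nonneg h0
      refine le_trans ?_ (le_trans (by linarith : (ρ / 3200) ^ 2 / 2 ≤ _) h1)
      rw [hρ]
      refine le_of_eq ?_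
      field_simp
    have h0 : 0 ≤ b2 ^ 2 := sq_nonneg _
    calc 32 * b2 ^ 2 * (2 * Real.exp (-(ρ / 6400))) ^ 2
        = 128 * b2 ^ 2 * Real.exp (-(ρ / 3200)) := by rw [← e1]; ring
      _ ≤ 128 * (L₂ * σ ^ 4 * p ^ 2) * (2 * 3200 ^ 2 * (κ ^ 8 * c ^ 4 / N ^ 2)) :=
          mul_le_mul (by linarith) e2 (Real.exp_pos _).le (by linarith)
      _ = _ := by ring
  calc _ ≤ _ := add_le_add t1 (add_le_add t2 t3)
    _ = _ := by rw [ridgeConst]; ring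

/-- For use with cube-root bounds on the penalties: the wasteful x⁴ ≤ 1 + x⁶ avoids fractional
powers and still gives an adequate bias bound. -/
theorem pow_four_le_of_pow_three_le {x B : ℝ} (hx : 0 ≤ x) (h : x ^ 3 ≤ B) : x ^ 4 ≤ 1 + B ^ 2 := by
  rcases le_total x 1 with h1 | h1
  · have := pow_le_one₀ (n := 4) hx h1
    nlinarith [sq_nonneg B]
  · have h2 : x ^ 4 ≤ x ^ 6 := pow_le_pow_right₀ h1 (by norm_num)
    have h3 : (x ^ 3) ^ 2 ≤ B ^ 2 := pow_le_pow_left₀ (by positivity) h 2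
    nlinarith

theorem rpow_third_pow_three {x : ℝ} (hx : 0 ≤ x) : (x ^ (1 / 3 : ℝ)) ^ 3 = x := by
  rw [← Real.rpow_natCast, ← Real.rpow_mul hx]; norm_num

theorem card_fold2 {n : ℕ} (hn : Even n) : ((fold2 n).card : ℝ) = n / 2 := by
  obtain ⟨m, rfl⟩ := hn
  have h : (fold2 (m + m)).card = m := by
    have : fold2 (m + m) = Finset.univ.map (Fin.natAddEmb m) := by
      ext i
      simp only [fold2, Finset.mem_filter, Finset.mem_univ, true_and, Finset.mem_map]
      constructor
      · intro h
        exact ⟨⟨i - m, by omega⟩, by ext; simp; omega⟩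
      · rintro ⟨j, rfl⟩
        simp; omega
    rw [this]; simp
  rw [h]; push_cast; ring

theorem card_fold1 {n : ℕ} (hn : Even n) : ((fold1 n).card : ℝ) = n / 2 := by
  obtain ⟨m, rfl⟩ := hn
  have h : (fold1 (m + m)).card = m := by
    have : fold1 (m + m) = Finset.univ.map (Fin.castAddEmb m) := by
      ext i
      simp only [fold1, Finset.mem_filter, Finset.mem_univ, true_and, Finset.mem_map]
      constructor
      · intro h
        exact ⟨⟨i, by omega⟩, by ext; simp⟩
      · rintro ⟨j, rfl⟩
        simp; omega
    rw [this]; simp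
  rw [h]; push_cast; ring

end OMRidge

/-! ### Fourth moments of the two first-stage ridge errors. -/

namespace OMRidge

universe u

variable {Ω : Type u} [MeasurableSpace Ω] {P : Measure Ω}

/-- A bound for the fourth moments of the centred products occurring in the estimates. -/
noncomputable def momentConst (κ Cmin Cmax : ℝ) : ℝ :=
  161280 + 8 * (161280 * (κ ^ 2 * Cmax) ^ 4 * (Cmax / Cmin) ^ 4) + 8 * Cmax ^ 4

theorem momentConst_bounds {κ Cmin Cmax : ℝ} :
    0 < momentConst κ Cmin Cmax ∧
    (161280 + 161280 * (κ ^ 2 * Cmax) ^ 4 * (Cmax / Cmin) ^ 4) / 2 ≤ momentConst κ Cmin Cmax ^ 2 ∧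
    4 * (161280 * (κ ^ 2 * Cmax) ^ 4 * (Cmax / Cmin) ^ 4 +
      161280 * (κ ^ 2 * Cmax) ^ 4 * (Cmax / Cmin) ^ 4) + 8 * Cmax ^ 4 ≤
      momentConst κ Cmin Cmax ^ 2 := by
  have h1 : 0 ≤ 161280 * (κ ^ 2 * Cmax) ^ 4 * (Cmax / Cmin) ^ 4 := by
    have : 0 ≤ (κ ^ 2 * Cmax) ^ 4 := Even.pow_nonneg (by decide) _
    have : 0 ≤ (Cmax / Cmin) ^ 4 := Even.pow_nonneg (by decide) _
    positivity
  have h2 : 0 ≤ Cmax ^ 4 := Even.pow_nonneg (by decide) _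
  have hA : momentConst κ Cmin Cmax = 161280 + 8 * (161280 * (κ ^ 2 * Cmax) ^ 4 *
    (Cmax / Cmin) ^ 4) + 8 * Cmax ^ 4 := rfl
  -- Being at least 1, the constant is below its square, so bounds linear in it are enough.
  have hA1 : 1 ≤ momentConst κ Cmin Cmax := by linarith
  have hAA : momentConst κ Cmin Cmax ≤ momentConst κ Cmin Cmax ^ 2 := by nlinarith
  exact ⟨by linarith, by linarith, by linarith⟩

section

variable {n d : ℕ} {κ Cmin Cmax σε ση K lamβ lamg : ℝ}
  {Sig : Matrix (Fin (d + 1)) (Fin (d + 1)) ℝ}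
  {β₀ xs : Fin (d + 1) → ℝ} {R : Matrix (Fin d) (Fin (d + 1)) ℝ} {g₀ : Fin d → ℝ}
  {x : Fin n → Ω → Fin (d + 1) → ℝ} {ε y : Fin n → Ω → ℝ}
  {bhat : Ω → Fin (d + 1) → ℝ} {ghat : Ω → Fin d → ℝ}

theorem measurable_ridge {m k : ℕ} {s : Finset (Fin m)} {lam : ℝ} (hlam : 0 < lam)
    {w : Fin m → Ω → Fin k → ℝ} {t : Fin m → Ω → ℝ} (hw : ∀ i, Measurable (w i))
    (ht : ∀ i, Measurable (t i)) {b : Ω → Fin k → ℝ}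
    (hb : ∀ ω, IsRidge s lam (fun i => w i ω) (fun i => t i ω) (b ω)) : Measurable b := by
  have e : b = fun ω => ridgeSolution s lam (fun i => w i ω) (fun i => t i ω) := by
    ext ω : 1; exact (hb ω).eq_ridgeSolution hlam
  rw [e]; exact measurable_ridgeSolution hw ht

theorem LinearModel.measurable_response (h : LinearModel P κ Cmin Cmax σε Sig β₀ x ε y)
    (i : Fin n) : Measurable (y i) := by
  have e : y i = fun ω => β₀ ⬝ᵥ x i ω + ε i ω := by
    ext ω; rw [h.model, dotProduct_comm]
  rw [e]; exact (h.measurable_dir i β₀).add (h.measurable_noise i)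

theorem LinearModel.measurable_mulVec (h : LinearModel P κ Cmin Cmax σε Sig β₀ x ε y)
    (i : Fin n) : Measurable fun ω => R *ᵥ x i ω :=
  measurable_pi_lambda _ fun j => h.measurable_dir i (R j)

variable [IsProbabilityMeasure P]

/-- The failure probability is written as a square because `expLe_ridge_error` is stated with its
root r. -/
theorem gram_probability_le (h : LinearModel P κ Cmin Cmax σε Sig β₀ x ε y)
    (hκ : 1 ≤ κ) (hCmin : 0 < Cmin) (hC : Cmin ≤ Cmax) (hn : Even n)
    (hsize : 16000 * κ ^ 4 * (Cmax / Cmin) ^ 2 * ((d + 1 : ℕ) : ℝ) ≤ n) :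
    P.real {ω | ¬ ∀ v : Fin (d + 1) → ℝ,
        (fold1 n).card * Cmin / 32 * (v ⬝ᵥ v) ≤ ∑ i ∈ fold1 n, (v ⬝ᵥ x i ω) ^ 2} ≤
      (2 * Real.exp (-(n / (κ ^ 4 * (Cmax / Cmin) ^ 2) / 6400))) ^ 2 := by
  refine (h.measure_gram_le_exp hκ hCmin hC d.succ_pos (fold1 n) (card_fold1 hn) hsize).trans ?_
  rw [mul_pow, ← Real.exp_nat_mul]
  have e : ((2 : ℕ) : ℝ) * -(n / (κ ^ 4 * (Cmax / Cmin) ^ 2) / 6400) =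
      -(n / (κ ^ 4 * (Cmax / Cmin) ^ 2) / 3200) := by push_cast; ring
  rw [e]
  nlinarith [Real.exp_pos (-(n / (κ ^ 4 * (Cmax / Cmin) ^ 2) / 3200))]

/-- The bias is within the rate because ‖β₀‖₂⁴ ≤ K⁴σ⁴p² by the sup-norm bound, while λ³ ≲ n gives λ⁴
≲ n². -/
theorem expLe_outcome_ridge (h : LinearModel P κ Cmin Cmax σε Sig β₀ x ε y)
    (hκ : 1 ≤ κ) (hCmin : 0 < Cmin) (hC : Cmin ≤ Cmax) (hσ : 0 < σε) (hn : Even n) (hn0 : 0 < n)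
    (hK : ‖β₀‖ / σε ≤ K)
    (hsize : 16000 * κ ^ 4 * (Cmax / Cmin) ^ 2 * ((d + 1 : ℕ) : ℝ) ≤ n)
    (hlo : (n : ℝ) ^ 2 * Cmin / (((d + 1 : ℕ) : ℝ) * (Cmax / Cmin)) *
      Real.exp (-(n / (κ ^ 4 * (Cmax / Cmin) ^ 2) / 12800)) ≤ lamβ)
    (hhi : lamβ ≤ (Cmax / Cmin * Cmax * n) ^ (1 / 3 : ℝ))
    (hb : ∀ ω, IsRidge (fold1 n) lamβ (fun i => x i ω) (fun i => y i ω) (bhat ω)) :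
    ExpLe P (fun ω => ((bhat ω - β₀) ⬝ᵥ (bhat ω - β₀)) ^ 2)
      (ridgeConst κ Cmin (Cmax / Cmin) (momentConst κ Cmin Cmax) 161280
        (K ^ 4 * (1 + (Cmax / Cmin * Cmax) ^ 2)) (K ^ 4) * σε ^ 4 *
          (((d + 1 : ℕ) : ℝ) ^ 2 / (n : ℝ) ^ 2)) := by
  obtain ⟨hA0, hA1, hA2⟩ := momentConst_bounds (κ := κ) (Cmin := Cmin) (Cmax := Cmax)
  set A := momentConst κ Cmin Cmax
  have hC' : 0 < Cmax := hCmin.trans_le hC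
  set c := Cmax / Cmin with hc
  have hc1 : 1 ≤ c := (one_le_div hCmin).2 hC
  set p : ℝ := ((d + 1 : ℕ) : ℝ) with hp
  have hp0 : 0 < p := by rw [hp]; positivity
  have hN : (1 : ℝ) ≤ n := by exact_mod_cast hn0
  have hlam0 : 0 < lamβ := lt_of_lt_of_le (by positivity) hlo
  have hm := card_fold1 hn
  have ha : 0 < ((fold1 n).card : ℝ) * Cmin / 32 := by rw [hm]; positivity
  have hbm : Measurable bhat :=
    measurable_ridge hlam0 h.measurable_x h.measurable_response hb
  have hS : ∀ j, ExpLe P (fun ω => (∑ i ∈ fold1 n, ε i ω * x i ω j) ^ 4)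
      (3 * ((fold1 n).card * (A * σε ^ 2)) ^ 2) := fun j => by
    have := (h.sum_noise_mul hκ hCmin hC hσ (v := Pi.single j 1) (c := c) (by simpa using hc1) hA0
      hA1 (fold1 n)).2
    simpa only [single_one_dotProduct] using this
  have hmain := expLe_ridge_error (σ := σε) (E₈ := 161280)
    (r := 2 * Real.exp (-(n / (κ ^ 4 * c ^ 2) / 6400))) hb hbm hlam0 hσ ha
    (by positivity) (fun i ω => h.model i ω) (gram_probability_le h hκ hCmin hC hn hsize) hS
    (fun i => h.noise_eighth_moment hσ i)
  refine hmain.mono_bound ?_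
  have hβ : ‖β₀‖ ≤ K * σε := (div_le_iff₀ hσ).1 hK
  have hb2 : β₀ ⬝ᵥ β₀ ≤ p * (K * σε) ^ 2 := by
    rw [dotProduct, hp]
    have : ∀ j ∈ Finset.univ, β₀ j * β₀ j ≤ (K * σε) ^ 2 := fun j _ => by
      have h1 := (norm_le_pi_norm β₀ j).trans hβ
      rw [Real.norm_eq_abs] at h1
      rw [← sq, ← sq_abs]
      exact pow_le_pow_left₀ (abs_nonneg _) h1 2
    refine (Finset.sum_le_card_nsmul _ _ _ this).trans (le_of_eq ?_)
    rw [Finset.card_univ, Fintype.card_fin, nsmul_eq_mul]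
  have hb4 : (β₀ ⬝ᵥ β₀) ^ 2 ≤ K ^ 4 * σε ^ 4 * p ^ 2 := by
    refine (pow_le_pow_left₀ (dotProduct_self_nonneg' _) hb2 2).trans (le_of_eq (by ring))
  have hl3 : lamβ ^ 3 ≤ c * Cmax * n := by
    refine (pow_le_pow_left₀ hlam0.le hhi 3).trans (le_of_eq ?_)
    exact rpow_third_pow_three (by positivity)
  have hl4 : lamβ ^ 4 ≤ (1 + (c * Cmax) ^ 2) * n ^ 2 := by
    refine (pow_four_le_of_pow_three_le hlam0.le hl3).trans ?_
    have : (1 : ℝ) ≤ (n : ℝ) ^ 2 := one_le_pow₀ hN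
    nlinarith
  refine ridge_bound_le (κ := κ) (p := p) (N := n) hκ hCmin hc1 (by norm_num) (by linarith) hp0
    hp0.le le_rfl hm hσ rfl hlo ?_ hb4
  calc lamβ ^ 4 * (β₀ ⬝ᵥ β₀) ^ 2 ≤ ((1 + (c * Cmax) ^ 2) * n ^ 2) * (K ^ 4 * σε ^ 4 * p ^ 2) := by
        gcongr
    _ = _ := by ring

theorem single_vecMul (R : Matrix (Fin d) (Fin (d + 1)) ℝ) (j : Fin d) :
    Pi.single j (1 : ℝ) ᵥ* R = R j := by
  rw [Matrix.single_one_vecMul]; rfl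

/-- The treatment regression has noise H, uncorrelated with the controls. Here ‖g₀‖ is bounded
without a factor p, so the penalty may be larger: (λ/p)³ ≲ n/p yields λ⁴ ≲ p²n², using p ≤ n. -/
theorem expLe_treatment_ridge (h : LinearModel P κ Cmin Cmax σε Sig β₀ x ε y)
    (ht : TreatmentModel P ση xs R g₀ x) (hR : IsOrthoComplement xs R) (hxs : xs ≠ 0)
    (hκ : 1 ≤ κ) (hCmin : 0 < Cmin) (hC : Cmin ≤ Cmax) (hn : Even n) (hn0 : 0 < n)
    (hsize : 16000 * κ ^ 4 * (Cmax / Cmin) ^ 2 * ((d + 1 : ℕ) : ℝ) ≤ n)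
    (hlo : (n : ℝ) ^ 2 * Cmin / (((d + 1 : ℕ) : ℝ) * (Cmax / Cmin)) *
      Real.exp (-(n / (κ ^ 4 * (Cmax / Cmin) ^ 2) / 12800)) ≤ lamg)
    (hhi : lamg ≤ ((d + 1 : ℕ) : ℝ) * (Cmax / (Cmax / Cmin) * (n / ((d + 1 : ℕ) : ℝ)) *
      (l2norm xs * ση) ^ 4) ^ (1 / 3 : ℝ))
    (hg : ∀ ω, IsRidge (fold1 n) lamg (fun i => R *ᵥ x i ω) (fun i => unitDir xs ⬝ᵥ x i ω)
      (ghat ω)) :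
    ExpLe P (fun ω => ((ghat ω - g₀) ⬝ᵥ (ghat ω - g₀)) ^ 2)
      (ridgeConst κ Cmin (Cmax / Cmin) (momentConst κ Cmin Cmax)
        (161280 * (κ ^ 2 * Cmax) ^ 4 * (Cmax / Cmin) ^ 4)
        ((Cmax / Cmin) ^ 2 * (1 + (Cmin * Cmax ^ 2) ^ 2)) ((Cmax / Cmin) ^ 2) *
          (((d + 1 : ℕ) : ℝ) ^ 2 / (n : ℝ) ^ 2)) := by
  obtain ⟨hA0, hA1, hA2⟩ := momentConst_bounds (κ := κ) (Cmin := Cmin) (Cmax := Cmax)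
  set A := momentConst κ Cmin Cmax
  have hC' : 0 < Cmax := hCmin.trans_le hC
  obtain ⟨hs1, hs2, hgg⟩ := ht.residual_bounds h hκ hCmin hC hR hxs ⟨0, hn0⟩
  set c := Cmax / Cmin with hc
  have hc1 : 1 ≤ c := (one_le_div hCmin).2 hC
  set p : ℝ := ((d + 1 : ℕ) : ℝ) with hp
  have hp1 : 1 ≤ p := by rw [hp]; push_cast; linarith [(Nat.cast_nonneg d : (0 : ℝ) ≤ d)]
  have hp0 : 0 < p := by linarith
  have hN : (1 : ℝ) ≤ n := by exact_mod_cast hn0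
  have hlam0 : 0 < lamg := lt_of_lt_of_le (by positivity) hlo
  have hm := card_fold1 hn
  have ha : 0 < ((fold1 n).card : ℝ) * Cmin / 32 := by rw [hm]; positivity
  have hgm : Measurable ghat :=
    measurable_ridge hlam0 (fun i => h.measurable_mulVec i) (fun i => h.measurable_dir i _) hg
  have hres : residualDir xs R g₀ ⬝ᵥ residualDir xs R g₀ ≤ c := by
    rw [hR.residualDir_dotProduct_self hxs]; exact hgg
  have hS : ∀ j, ExpLe P (fun ω => (∑ i ∈ fold1 n, (residualDir xs R g₀ ⬝ᵥ x i ω) *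
      (R *ᵥ x i ω) j) ^ 4) (3 * ((fold1 n).card * (A * 1 ^ 2)) ^ 2) := fun j => by
    have := (h.sum_mul_sub hκ hCmin hC (c := c) (c' := c) (m := 0) hres
      ((hR.row_dotProduct_self j).trans_le hc1) hA0 (fun i => by
        rw [← single_vecMul R j]; exact ht.integral_residual_mul h hR hxs i _)
      (le_trans (by have : 0 ≤ Cmax ^ 4 := by positivity
                    linarith) hA2) (fold1 n)).2
    simp only [sub_zero] at this
    rw [one_pow, mul_one]
    exact this
  -- The Gram bound for Z is that for x on vectors v R, which have the norm of v.
  have hgram : P.real {ω | ¬ ∀ v : Fin d → ℝ, (fold1 n).card * Cmin / 32 * (v ⬝ᵥ v) ≤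
      ∑ i ∈ fold1 n, (v ⬝ᵥ (R *ᵥ x i ω)) ^ 2} ≤
      (2 * Real.exp (-(n / (κ ^ 4 * c ^ 2) / 6400))) ^ 2 := by
    refine (measureReal_mono ?_ (measure_ne_top _ _)).trans
      (gram_probability_le h hκ hCmin hC hn hsize)
    intro ω hω hall
    refine hω fun v => ?_
    have := hall (v ᵥ* R)
    rw [hR.vecMul_dotProduct_self] at this
    simpa only [Matrix.dotProduct_mulVec] using this
  have hmain := expLe_ridge_error (σ := 1)
    (E₈ := 161280 * (κ ^ 2 * Cmax) ^ 4 * c ^ 4) (e := fun i ω => residualDir xs R g₀ ⬝ᵥ x i ω)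
    (r := 2 * Real.exp (-(n / (κ ^ 4 * c ^ 2) / 6400))) (b₀ := g₀) hg hgm hlam0 one_pos ha
    (by positivity) (fun i ω => by rw [residualDir_dotProduct]; ring) hgram hS
    (fun i => by simpa using h.eighth_moment hκ hCmin hC i hres)
  refine hmain.mono_bound ?_
  have hg0 := dotProduct_self_nonneg' g₀
  have hb4' : (g₀ ⬝ᵥ g₀) ^ 2 ≤ c ^ 2 := pow_le_pow_left₀ hg0 (by linarith) 2
  have hb4 : (g₀ ⬝ᵥ g₀) ^ 2 ≤ c ^ 2 * 1 ^ 4 * p ^ 2 := by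
    refine hb4'.trans ?_
    rw [one_pow, mul_one]
    exact le_mul_of_one_le_right (by positivity) (one_le_pow₀ hp1)
  have hpn : p ≤ n := by
    refine le_trans (le_mul_of_one_le_left hp0.le ?_) hsize
    have h1 : 1 ≤ κ ^ 4 := one_le_pow₀ hκ
    have h2 : 1 ≤ c ^ 2 := one_le_pow₀ hc1
    nlinarith
  have hnp : 1 ≤ (n : ℝ) / p := (one_le_div hp0).2 hpn
  have hcc : Cmax / c = Cmin := by rw [hc]; field_simp
  rw [hcc] at hhi
  have hl3 : (lamg / p) ^ 3 ≤ Cmin * Cmax ^ 2 * (n / p) := by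
    have h1 : lamg / p ≤ (Cmin * (n / p) * (l2norm xs * ση) ^ 4) ^ (1 / 3 : ℝ) := by
      rw [div_le_iff₀ hp0, mul_comm]; exact hhi
    have h0 : 0 ≤ (l2norm xs * ση) ^ 4 := Even.pow_nonneg (by decide) _
    refine (pow_le_pow_left₀ (by positivity) h1 3).trans ?_
    rw [rpow_third_pow_three (by positivity)]
    have h2 : (l2norm xs * ση) ^ 4 ≤ Cmax ^ 2 := by
      calc (l2norm xs * ση) ^ 4 = ((l2norm xs * ση) ^ 2) ^ 2 := by ring
        _ ≤ Cmax ^ 2 := pow_le_pow_left₀ (sq_nonneg _) hs2 2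
    calc Cmin * (n / p) * (l2norm xs * ση) ^ 4 ≤ Cmin * (n / p) * Cmax ^ 2 := by gcongr
      _ = _ := by ring
  have hl4 : (lamg / p) ^ 4 ≤ (1 + (Cmin * Cmax ^ 2) ^ 2) * (n / p) ^ 2 := by
    refine (pow_four_le_of_pow_three_le (by positivity) hl3).trans ?_
    have : (1 : ℝ) ≤ ((n : ℝ) / p) ^ 2 := one_le_pow₀ hnp
    nlinarith
  have hl : lamg ^ 4 ≤ (1 + (Cmin * Cmax ^ 2) ^ 2) * p ^ 2 * n ^ 2 := by
    calc lamg ^ 4 = (lamg / p) ^ 4 * p ^ 4 := by field_simp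
      _ ≤ (1 + (Cmin * Cmax ^ 2) ^ 2) * (n / p) ^ 2 * p ^ 4 := by gcongr
      _ = _ := by field_simp
  have hfin := ridge_bound_le (κ := κ) (p := p) (k := d) (N := n) (A := A) (σ := 1) (b2 := g₀ ⬝ᵥ g₀)
    (L₁ := c ^ 2 * (1 + (Cmin * Cmax ^ 2) ^ 2)) (L₂ := c ^ 2)
    (E₈ := 161280 * (κ ^ 2 * Cmax) ^ 4 * c ^ 4) (lam := lamg) hκ hCmin hc1
    (by positivity) (by linarith) hp0 (Nat.cast_nonneg d) (by rw [hp]; push_cast; linarith) hm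
    one_pos rfl hlo ?_ hb4
  · simpa only [one_pow, mul_one] using hfin
  · calc lamg ^ 4 * (g₀ ⬝ᵥ g₀) ^ 2 ≤ ((1 + (Cmin * Cmax ^ 2) ^ 2) * p ^ 2 * n ^ 2) * c ^ 2 := by
          gcongr
      _ = _ := by ring

end

end OMRidge

/-! ### Second-fold expectations and the risk bound. -/

namespace OMRidge

universe u

variable {Ω : Type u} [MeasurableSpace Ω] {P : Measure Ω} {n d : ℕ}
  {κ Cmin Cmax σε ση K lamβ lamg B : ℝ}
  {Sig : Matrix (Fin (d + 1)) (Fin (d + 1)) ℝ}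
  {β₀ xs : Fin (d + 1) → ℝ} {R : Matrix (Fin d) (Fin (d + 1)) ℝ} {g₀ : Fin d → ℝ}
  {x : Fin n → Ω → Fin (d + 1) → ℝ} {ε y : Fin n → Ω → ℝ}
  {bhat : Ω → Fin (d + 1) → ℝ} {ghat : Ω → Fin d → ℝ} {i : Fin n}

theorem notMem_fold1 (hi : i ∈ fold2 n) : i ∉ fold1 n := by
  simp only [fold1, fold2, Finset.mem_filter, Finset.mem_univ, true_and] at hi ⊢
  omega

theorem LinearModel.indepFun_outcome_ridge (h : LinearModel P κ Cmin Cmax σε Sig β₀ x ε y)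
    (hlam : 0 < lamβ)
    (hb : ∀ ω, IsRidge (fold1 n) lamβ (fun i => x i ω) (fun i => y i ω) (bhat ω))
    (hi : i ∉ fold1 n) : IndepFun (x i) bhat P := by
  have e : bhat = fun ω => ridgeSolution (fold1 n) lamβ (fun j => x j ω)
      (fun j => x j ω ⬝ᵥ β₀ + ε j ω) := by
    ext ω : 1
    rw [(hb ω).eq_ridgeSolution hlam]
    exact ridgeSolution_congr (fun _ _ => rfl) fun j _ => h.model j ω
  rw [e]
  exact indepFun_ridgeSolution (A := fun j ω => (x j ω, ε j ω)) (f := Prod.fst)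
    (g := fun z => z.1 ⬝ᵥ β₀ + z.2) (φ := Prod.fst)
    (fun j => (h.measurable_x j).prodMk (h.measurable_noise j)) h.indep measurable_fst
    (by simp only [dotProduct]; fun_prop) measurable_fst hi

theorem LinearModel.indepFun_treatment_ridge (h : LinearModel P κ Cmin Cmax σε Sig β₀ x ε y)
    (hlam : 0 < lamg)
    (hg : ∀ ω, IsRidge (fold1 n) lamg (fun i => R *ᵥ x i ω) (fun i => unitDir xs ⬝ᵥ x i ω)
      (ghat ω))
    (hi : i ∉ fold1 n) : IndepFun (x i) ghat P := by
  have e : ghat = fun ω => ridgeSolution (fold1 n) lamg (fun j => R *ᵥ x j ω)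
      (fun j => unitDir xs ⬝ᵥ x j ω) := by
    ext ω : 1
    exact (hg ω).eq_ridgeSolution hlam
  rw [e]
  exact indepFun_ridgeSolution (A := fun j ω => (x j ω, ε j ω)) (f := fun z => R *ᵥ z.1)
    (g := fun z => unitDir xs ⬝ᵥ z.1) (φ := Prod.fst)
    (fun j => (h.measurable_x j).prodMk (h.measurable_noise j)) h.indep
    (by refine measurable_pi_lambda _ fun j => ?_
        simp only [Matrix.mulVec, dotProduct]; fun_prop)
    (by simp only [dotProduct]; fun_prop) measurable_fst hi

variable [IsProbabilityMeasure P]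

/-- With the estimate frozen this is a fourth moment of a linear form; the independent fold is
integrated out first, and R is a contraction. -/
theorem LinearModel.expLe_dotProduct_outcome (h : LinearModel P κ Cmin Cmax σε Sig β₀ x ε y)
    (hκ : 1 ≤ κ) (hCmin : 0 < Cmin) (hC : Cmin ≤ Cmax) (hR : IsOrthoComplement xs R) (hxs : xs ≠ 0)
    (hbm : Measurable bhat) (hind : IndepFun (x i) bhat P)
    (hB : ExpLe P (fun ω => ((bhat ω - β₀) ⬝ᵥ (bhat ω - β₀)) ^ 2) B) :
    ExpLe P (fun ω => ((R *ᵥ x i ω) ⬝ᵥ (R *ᵥ (bhat ω - β₀))) ^ 4)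
      (96 * (κ ^ 2 * Cmax) ^ 2 * B) := by
  refine expLe_of_indepFun (h.measurable_x i) hbm hind
    (F := fun a b => ((R *ᵥ a) ⬝ᵥ (R *ᵥ (b - β₀))) ^ 4)
    (G := fun b => 96 * (κ ^ 2 * Cmax) ^ 2 * ((b - β₀) ⬝ᵥ (b - β₀)) ^ 2) ?_
    (fun _ _ => by positivity) ?_ (fun b => ?_) (hB.const_mul (by positivity))
  · simp only [Matrix.mulVec, dotProduct, Pi.sub_apply]; fun_prop
  · simp only [dotProduct, Pi.sub_apply]; fun_prop
  · have h4 := h.fourth_moment hκ hCmin hC i ((R *ᵥ (b - β₀)) ᵥ* R)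
    simp only [← mulVec_dotProduct, hR.vecMul_dotProduct_self] at h4
    refine h4.mono_bound ?_
    have h1 := pow_le_pow_left₀ (dotProduct_self_nonneg' _)
      (hR.mulVec_dotProduct_self_le hxs (b - β₀)) 2
    gcongr

theorem LinearModel.expLe_dotProduct_treatment (h : LinearModel P κ Cmin Cmax σε Sig β₀ x ε y)
    (hκ : 1 ≤ κ) (hCmin : 0 < Cmin) (hC : Cmin ≤ Cmax) (hR : IsOrthoComplement xs R)
    (hgm : Measurable ghat) (hind : IndepFun (x i) ghat P)
    (hB : ExpLe P (fun ω => ((ghat ω - g₀) ⬝ᵥ (ghat ω - g₀)) ^ 2) B) :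
    ExpLe P (fun ω => ((R *ᵥ x i ω) ⬝ᵥ (ghat ω - g₀)) ^ 4) (96 * (κ ^ 2 * Cmax) ^ 2 * B) := by
  refine expLe_of_indepFun (h.measurable_x i) hgm hind
    (F := fun a b => ((R *ᵥ a) ⬝ᵥ (b - g₀)) ^ 4)
    (G := fun b => 96 * (κ ^ 2 * Cmax) ^ 2 * ((b - g₀) ⬝ᵥ (b - g₀)) ^ 2) ?_
    (fun _ _ => by positivity) ?_ (fun b => ?_) (hB.const_mul (by positivity))
  · simp only [Matrix.mulVec, dotProduct, Pi.sub_apply]; fun_prop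
  · simp only [dotProduct, Pi.sub_apply]; fun_prop
  · have h4 := h.fourth_moment hκ hCmin hC i ((b - g₀) ᵥ* R)
    simpa only [← mulVec_dotProduct, hR.vecMul_dotProduct_self] using h4

theorem LinearModel.expLe_treatment_mul (h : LinearModel P κ Cmin Cmax σε Sig β₀ x ε y)
    (hκ : 1 ≤ κ) (hCmin : 0 < Cmin) (hC : Cmin ≤ Cmax) (hR : IsOrthoComplement xs R) (hxs : xs ≠ 0)
    (hgm : Measurable ghat) (hind : IndepFun (x i) ghat P)
    (hB : ExpLe P (fun ω => ((ghat ω - g₀) ⬝ᵥ (ghat ω - g₀)) ^ 2) B) :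
    ExpLe P (fun ω => ((unitDir xs ⬝ᵥ x i ω) * ((R *ᵥ x i ω) ⬝ᵥ (ghat ω - g₀))) ^ 4)
      (161280 * (κ ^ 2 * Cmax) ^ 4 * B) := by
  refine expLe_of_indepFun (h.measurable_x i) hgm hind
    (F := fun a b => ((unitDir xs ⬝ᵥ a) * ((R *ᵥ a) ⬝ᵥ (b - g₀))) ^ 4)
    (G := fun b => 161280 * (κ ^ 2 * Cmax) ^ 4 * ((b - g₀) ⬝ᵥ (b - g₀)) ^ 2) ?_
    (fun _ _ => by positivity) ?_ (fun b => ?_) (hB.const_mul (by positivity))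
  · simp only [Matrix.mulVec, dotProduct, Pi.sub_apply]; fun_prop
  · simp only [dotProduct, Pi.sub_apply]; fun_prop
  · set v := b - g₀ with hv
    -- The AM-GM weight is ‖v‖, which keeps the bound homogeneous of degree 4 in v and must be
    -- positive.
    rcases eq_or_ne v 0 with h0 | h0
    · simpa [h0] using ExpLe.const (P := P) 0
    have hv0 : 0 < v ⬝ᵥ v := lt_of_le_of_ne (dotProduct_self_nonneg' v)
      fun e => h0 (dotProduct_self_eq_zero.1 e.symm)
    have hs : Real.sqrt (v ⬝ᵥ v) ^ 2 = v ⬝ᵥ v := Real.sq_sqrt hv0.le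
    have h8 := h.eighth_moment hκ hCmin hC i (hR.vecMul_dotProduct_self v).le
    have h8' := h.eighth_moment hκ hCmin hC i (unitDir_dotProduct_self hxs).le
    have := expLe_mul_pow_four (Real.sqrt_pos.2 hv0) (h.measurable_dir i _).aestronglyMeasurable
      (h.measurable_dir i _).aestronglyMeasurable
      (h8.mono_bound (B := 161280 * (κ ^ 2 * Cmax) ^ 4 * Real.sqrt (v ⬝ᵥ v) ^ 8)
        (le_of_eq (by rw [show Real.sqrt (v ⬝ᵥ v) ^ 8 = (Real.sqrt (v ⬝ᵥ v) ^ 2) ^ 4 by ring, hs])))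
      h8'
    simp only [← mulVec_dotProduct, mul_comm ((R *ᵥ _) ⬝ᵥ v)] at this
    refine this.mono_bound (le_of_eq ?_)
    rw [show Real.sqrt (v ⬝ᵥ v) ^ 4 = (Real.sqrt (v ⬝ᵥ v) ^ 2) ^ 2 by ring, hs]
    ring

/-- The constant in the bound of the risk by `σ² (1 / n + p² / n²)`. -/
noncomputable def riskConst (Cmin A D₄ D₈ Kβ Kg : ℝ) : ℝ :=
  Kβ / 2 + 16 * A / Cmin ^ 2 + 8 * D₈ * Kg / Cmin ^ 4 +
    64 / Cmin ^ 2 * (2 * A + 12 * A ^ 2 + (Kβ + Kg) / 2 * (1 + D₄))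

/-- The rate 1/N comes only from the second moments of the averages of TH − s2 and of the noise
times H; all else is of order p²/N². The AM-GM weights leave a common factor σ². -/
theorem risk_bound_le {Cmin A D₄ D₈ Kβ Kg σ s2 N p k m : ℝ} (hCmin : 0 < Cmin) (hA : 0 ≤ A)
    (hD₄ : 0 ≤ D₄) (hD₈ : 0 ≤ D₈) (hKβ : 0 ≤ Kβ) (hKg : 0 ≤ Kg) (hσ : 0 < σ) (hs2 : Cmin ≤ s2)
    (hN : 0 < N) (hk : 0 ≤ k) (hkp : k ≤ p) (hm : m = N / 2) :
    (1 / (2 * σ ^ 2) * (Kβ * σ ^ 4 * (p ^ 2 / N ^ 2)) +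
      (8 * σ ^ 2 / s2 ^ 2 * ((N / 2)⁻¹ ^ 2 * (m * A)) +
        8 * σ ^ 2 / s2 ^ 4 * ((N / 2)⁻¹ * (m * (D₈ * (Kg * (p ^ 2 / N ^ 2))))))) +
      64 / s2 ^ 2 * ((N / 2)⁻¹ ^ 2 * (m * (A * σ ^ 2)) +
        ((1 / (2 * σ ^ 2) * ((N / 2)⁻¹ ^ 4 * (k * (k * (3 * (m * (A * σ ^ 2)) ^ 2)))) +
            σ ^ 2 / 2 * (Kg * (p ^ 2 / N ^ 2))) +
          ((1 / (2 * σ ^ 2) * (Kβ * σ ^ 4 * (p ^ 2 / N ^ 2)) +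
              σ ^ 2 / 2 * ((N / 2)⁻¹ ^ 4 * (k * (k * (3 * (m * A) ^ 2))))) +
            (N / 2)⁻¹ * (m * (1 / (2 * σ ^ 2) * (D₄ * (Kβ * σ ^ 4 * (p ^ 2 / N ^ 2))) +
              σ ^ 2 / 2 * (D₄ * (Kg * (p ^ 2 / N ^ 2)))))))) ≤
    riskConst Cmin A D₄ D₈ Kβ Kg * σ ^ 2 * (1 / N + p ^ 2 / N ^ 2) := by
  subst hm
  have hs0 : 0 < s2 := hCmin.trans_le hs2
  have hρ : k ^ 2 / N ^ 2 ≤ p ^ 2 / N ^ 2 := by gcongr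
  have h1 : 0 ≤ 1 / N := by positivity
  have h2 : 0 ≤ p ^ 2 / N ^ 2 := by positivity
  have e : (1 / (2 * σ ^ 2) * (Kβ * σ ^ 4 * (p ^ 2 / N ^ 2)) +
      (8 * σ ^ 2 / s2 ^ 2 * ((N / 2)⁻¹ ^ 2 * (N / 2 * A)) +
        8 * σ ^ 2 / s2 ^ 4 * ((N / 2)⁻¹ * (N / 2 * (D₈ * (Kg * (p ^ 2 / N ^ 2))))))) +
      64 / s2 ^ 2 * ((N / 2)⁻¹ ^ 2 * (N / 2 * (A * σ ^ 2)) +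
        ((1 / (2 * σ ^ 2) * ((N / 2)⁻¹ ^ 4 * (k * (k * (3 * (N / 2 * (A * σ ^ 2)) ^ 2)))) +
            σ ^ 2 / 2 * (Kg * (p ^ 2 / N ^ 2))) +
          ((1 / (2 * σ ^ 2) * (Kβ * σ ^ 4 * (p ^ 2 / N ^ 2)) +
              σ ^ 2 / 2 * ((N / 2)⁻¹ ^ 4 * (k * (k * (3 * (N / 2 * A) ^ 2))))) +
            (N / 2)⁻¹ * (N / 2 * (1 / (2 * σ ^ 2) * (D₄ * (Kβ * σ ^ 4 * (p ^ 2 / N ^ 2))) +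
              σ ^ 2 / 2 * (D₄ * (Kg * (p ^ 2 / N ^ 2)))))))) =
      σ ^ 2 * (Kβ / 2 * (p ^ 2 / N ^ 2) + 16 * A / s2 ^ 2 * (1 / N) +
        8 * D₈ * Kg / s2 ^ 4 * (p ^ 2 / N ^ 2) +
        64 / s2 ^ 2 * (2 * A * (1 / N) + 12 * A ^ 2 * (k ^ 2 / N ^ 2) +
          (Kβ + Kg) / 2 * (1 + D₄) * (p ^ 2 / N ^ 2))) := by
    field_simp
    ring
  rw [e]
  set a := 1 / N
  set ρ := p ^ 2 / N ^ 2
  have ha : a ≤ a + ρ := by linarith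
  have hb : ρ ≤ a + ρ := by linarith
  calc _ ≤ σ ^ 2 * (Kβ / 2 * (a + ρ) + 16 * A / Cmin ^ 2 * (a + ρ) +
        8 * D₈ * Kg / Cmin ^ 4 * (a + ρ) +
        64 / Cmin ^ 2 * (2 * A * (a + ρ) + 12 * A ^ 2 * (a + ρ) +
          (Kβ + Kg) / 2 * (1 + D₄) * (a + ρ))) := by
        have hkρ := hρ.trans hb
        gcongr
    _ = _ := by rw [riskConst]; ring

theorem expLe_sq_error (h : LinearModel P κ Cmin Cmax σε Sig β₀ x ε y)
    (ht : TreatmentModel P ση xs R g₀ x) (hR : IsOrthoComplement xs R) (hxs : xs ≠ 0)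
    (hκ : 1 ≤ κ) (hCmin : 0 < Cmin) (hC : Cmin ≤ Cmax) (hσ : 0 < σε) (hn : Even n) (hn0 : 0 < n)
    {Kβ Kg : ℝ} (hKβ : 0 ≤ Kβ) (hKg : 0 ≤ Kg)
    (hlamβ : 0 < lamβ) (hlamg : 0 < lamg)
    (hb : ∀ ω, IsRidge (fold1 n) lamβ (fun i => x i ω) (fun i => y i ω) (bhat ω))
    (hg : ∀ ω, IsRidge (fold1 n) lamg (fun i => R *ᵥ x i ω) (fun i => unitDir xs ⬝ᵥ x i ω)
      (ghat ω))
    (hbB : ExpLe P (fun ω => ((bhat ω - β₀) ⬝ᵥ (bhat ω - β₀)) ^ 2)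
      (Kβ * σε ^ 4 * (((d + 1 : ℕ) : ℝ) ^ 2 / (n : ℝ) ^ 2)))
    (hgB : ExpLe P (fun ω => ((ghat ω - g₀) ⬝ᵥ (ghat ω - g₀)) ^ 2)
      (Kg * (((d + 1 : ℕ) : ℝ) ^ 2 / (n : ℝ) ^ 2)))
    (hs0 : l2norm xs * ση ≠ 0) :
    ExpLe P (fun ω => (omPrediction xs R (ση ^ 2 / 4) (fun i => x i ω) (fun i => y i ω)
        (bhat ω) (ghat ω) - xs ⬝ᵥ β₀) ^ 2)
      (l2norm xs ^ 2 * (riskConst Cmin (momentConst κ Cmin Cmax) (96 * (κ ^ 2 * Cmax) ^ 2)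
        (161280 * (κ ^ 2 * Cmax) ^ 4) Kβ Kg * σε ^ 2 *
          (1 / n + ((d + 1 : ℕ) : ℝ) ^ 2 / (n : ℝ) ^ 2))) := by
  obtain ⟨hA0, hA1, hA2⟩ := momentConst_bounds (κ := κ) (Cmin := Cmin) (Cmax := Cmax)
  set A := momentConst κ Cmin Cmax
  obtain ⟨hs1, hs2, hgg⟩ := ht.residual_bounds h hκ hCmin hC hR hxs ⟨0, hn0⟩
  have hC' : 0 < Cmax := hCmin.trans_le hC
  have hc1 : 1 ≤ Cmax / Cmin := (one_le_div hCmin).2 hC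
  have hN : (0 : ℝ) < n := by exact_mod_cast hn0
  have hm := card_fold2 hn
  have hres : residualDir xs R g₀ ⬝ᵥ residualDir xs R g₀ ≤ Cmax / Cmin := by
    rw [hR.residualDir_dotProduct_self hxs]; exact hgg
  have hbm : Measurable bhat := measurable_ridge hlamβ h.measurable_x h.measurable_response hb
  have hgm : Measurable ghat :=
    measurable_ridge hlamg (fun i => h.measurable_mulVec i) (fun i => h.measurable_dir i _) hg
  have hrow : ∀ j, R j ⬝ᵥ R j ≤ Cmax / Cmin := fun j => (hR.row_dotProduct_self j).trans_le hc1
  have hTH := (h.sum_mul_sub hκ hCmin hC (m := (l2norm xs * ση) ^ 2)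
    ((unitDir_dotProduct_self hxs).trans_le hc1) hres hA0
    (fun i => ht.integral_treatment_mul h hκ hCmin hC hR hxs i)
    (le_trans (by
      have := pow_le_pow_left₀ (sq_nonneg (l2norm xs * ση)) hs2 4
      linarith) hA2) (fold2 n)).1
  have heH := (h.sum_noise_mul hκ hCmin hC hσ hres hA0 hA1 (fold2 n)).1
  have heZ := fun j => (h.sum_noise_mul hκ hCmin hC hσ (hrow j) hA0 hA1 (fold2 n)).2
  have hHZ := fun j => (h.sum_mul_sub hκ hCmin hC (m := 0) hres (hrow j) hA0
    (fun i => by rw [← single_vecMul R j]; exact ht.integral_residual_mul h hR hxs i _)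
    (le_trans (by
      have : 0 ≤ Cmax ^ 4 := by positivity
      linarith) hA2) (fold2 n)).2
  simp only [sub_zero] at hHZ
  have hZf := fun i (hi : i ∈ fold2 n) => h.expLe_dotProduct_outcome hκ hCmin hC hR hxs hbm
    (h.indepFun_outcome_ridge hlamβ hb (notMem_fold1 hi)) hbB
  have hZg := fun i (hi : i ∈ fold2 n) => h.expLe_dotProduct_treatment hκ hCmin hC hR hgm
    (h.indepFun_treatment_ridge hlamg hg (notMem_fold1 hi)) hgB
  have hTZg := fun i (hi : i ∈ fold2 n) => h.expLe_treatment_mul hκ hCmin hC hR hxs hgm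
    (h.indepFun_treatment_ridge hlamg hg (notMem_fold1 hi)) hgB
  set c : ℝ := ((n : ℝ) / 2)⁻¹ with hc
  have hc0 : 0 < c := by positivity
  have hcs : c * (fold2 n).card = 1 := by rw [hm, hc]; field_simp
  set s2 := (l2norm xs * ση) ^ 2
  have hs20 : 0 < s2 := hCmin.trans_le hs1
  have hσ1 : 0 ≤ 1 / (2 * σε ^ 2) := by positivity
  have hσ2 : 0 ≤ σε ^ 2 / 2 := by positivity
  -- Built with the same nesting as the right side of `sq_error_le`, with q = ‖bhat − β₀‖², so the
  -- pointwise bound applies syntactically.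
  have hbig := ((hbB.const_mul hσ1).add
      (((hTH.const_mul (sq_nonneg c)).const_mul (c := 8 * σε ^ 2 / s2 ^ 2) (by positivity)).add
        (((ExpLe.sum hTZg).const_mul hc0.le).const_mul (c := 8 * σε ^ 2 / s2 ^ 4)
          (by positivity)))).add
    (((heH.const_mul (sq_nonneg c)).add
      (((((((ExpLe.sum (s := Finset.univ) fun j _ => heZ j).const_mul
          (Nat.cast_nonneg d)).const_mul (c := c ^ 4) (by positivity)).const_mul hσ1).add
          (hgB.const_mul hσ2))).add
        (((hbB.const_mul hσ1).add ((((ExpLe.sum (s := Finset.univ) fun j _ => hHZ j).const_mul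
          (Nat.cast_nonneg d)).const_mul (c := c ^ 4) (by positivity)).const_mul hσ2)).add
        ((ExpLe.sum fun i hi => ((hZf i hi).const_mul hσ1).add
          ((hZg i hi).const_mul hσ2)).const_mul hc0.le)))).const_mul (c := 64 / s2 ^ 2)
            (by positivity))
  have hmeas : Measurable fun ω => omPrediction xs R (ση ^ 2 / 4) (fun i => x i ω)
      (fun i => y i ω) (bhat ω) (ghat ω) - xs ⬝ᵥ β₀ := by
    simp only [fun ω => hR.omPrediction_sub hxs (X := fun i => x i ω) (y := fun i => y i ω)
      (e := fun i => ε i ω) (β₀ := β₀) (b := bhat ω) (g₀ := g₀) (g := ghat ω)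
      (fun i => h.model i ω) hs0]
    have hZm : ∀ (i : Fin n) (j : Fin d), Measurable fun ω => (R *ᵥ x i ω) j := fun i j =>
      h.measurable_dir i (R j)
    have hbj : ∀ j, Measurable fun ω => bhat ω j := fun j => (measurable_pi_apply j).comp hbm
    have hgj : ∀ j, Measurable fun ω => ghat ω j := fun j => (measurable_pi_apply j).comp hgm
    have hRb : ∀ j, Measurable fun ω => (R *ᵥ (bhat ω - β₀)) j := fun j => by
      simp only [Matrix.mulVec, dotProduct, Pi.sub_apply]; fun_prop
    have hH : ∀ i, Measurable fun ω => residualDir xs R g₀ ⬝ᵥ x i ω -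
        (R *ᵥ x i ω) ⬝ᵥ (ghat ω - g₀) := fun i => by
      refine (h.measurable_dir i _).sub ?_
      simp only [dotProduct, Pi.sub_apply]; fun_prop
    have hM : Measurable fun ω => c * ∑ i ∈ fold2 n, (unitDir xs ⬝ᵥ x i ω) *
        (residualDir xs R g₀ ⬝ᵥ x i ω - (R *ᵥ x i ω) ⬝ᵥ (ghat ω - g₀)) :=
      (Finset.measurable_sum _ fun i _ => (h.measurable_dir i _).mul (hH i)).const_mul c
    have hNum : Measurable fun ω => c * ∑ i ∈ fold2 n,
        (ε i ω - (R *ᵥ x i ω) ⬝ᵥ (R *ᵥ (bhat ω - β₀))) *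
        (residualDir xs R g₀ ⬝ᵥ x i ω - (R *ᵥ x i ω) ⬝ᵥ (ghat ω - g₀)) := by
      refine (Finset.measurable_sum _ fun i _ => Measurable.mul ?_ (hH i)).const_mul c
      refine (h.measurable_noise i).sub ?_
      simp only [dotProduct]; fun_prop
    have hr : Measurable fun ω => unitDir xs ⬝ᵥ (bhat ω - β₀) := by
      simp only [dotProduct, Pi.sub_apply]; fun_prop
    exact (Measurable.ite (measurableSet_le hM measurable_const) hr (hNum.div hM)).const_mul _
  refine ((hbig.const_mul (sq_nonneg (l2norm xs))).mono (hmeas.pow_const 2).aestronglyMeasurable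
    (fun ω => sq_nonneg _) fun ω => ?_).mono_bound ?_
  · rw [hR.omPrediction_sub hxs (X := fun i => x i ω) (y := fun i => y i ω)
      (e := fun i => ε i ω) (β₀ := β₀) (b := bhat ω) (g₀ := g₀) (g := ghat ω)
      (fun i => h.model i ω) hs0, mul_pow]
    refine mul_le_mul_of_nonneg_left ?_ (sq_nonneg _)
    refine sq_error_le hc0 hcs hs20 hσ ?_ (hR.mulVec_dotProduct_self_le hxs _)
    refine (dotProduct_sq_le _ _).trans_eq ?_
    rw [unitDir_dotProduct_self hxs, one_mul]
  · refine mul_le_mul_of_nonneg_left ?_ (sq_nonneg _)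
    rw [Finset.card_univ, Fintype.card_fin]
    exact risk_bound_le hCmin hA0.le (by positivity) (by positivity) hKβ hKg hσ hs1 hN
      (Nat.cast_nonneg d) (by push_cast; linarith) hm

theorem ridgeConst_nonneg {κ Cmin c A E₈ L₁ L₂ : ℝ} (hE : 0 ≤ E₈) (hL₁ : 0 ≤ L₁)
    (hL₂ : 0 ≤ L₂) (hκ : 1 ≤ κ) : 0 ≤ ridgeConst κ Cmin c A E₈ L₁ L₂ := by
  have h1 : 0 ≤ Cmin ^ 4 := Even.pow_nonneg (by decide) _
  have h2 : 0 ≤ c ^ 4 := Even.pow_nonneg (by decide) _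
  rw [ridgeConst]
  positivity

theorem riskConst_nonneg {Cmin A D₄ D₈ Kβ Kg : ℝ} (hA : 0 ≤ A) (hD₄ : 0 ≤ D₄) (hD₈ : 0 ≤ D₈)
    (hKβ : 0 ≤ Kβ) (hKg : 0 ≤ Kg) : 0 ≤ riskConst Cmin A D₄ D₈ Kβ Kg := by
  have h1 : 0 ≤ Cmin ^ 4 := Even.pow_nonneg (by decide) _
  rw [riskConst]
  positivity

/-- The three forms of the risk bound follow from a bound by `σ² (1 / n + p² / n²)`, as the
residual variance `s2` is bounded. -/
theorem risk_bounds_of_le {K₀ M L2 σ2 s2 p N risk : ℝ} (hK₀ : 0 ≤ K₀) (hM : 0 ≤ M) (hL : 0 ≤ L2)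
    (hσ : 0 ≤ σ2) (hs0 : 0 < s2) (hsM : s2 ≤ M) (hp : 0 ≤ p) (hN : 0 < N)
    (h : risk ≤ L2 * (K₀ * σ2 * (1 / N + p ^ 2 / N ^ 2))) :
    risk ≤ (K₀ + 1) * (1 + M + M ^ 2) * L2 * (σ2 / (s2 * N) + σ2 * p ^ 2 / (s2 ^ 2 * N ^ 2) +
      σ2 * (p * (s2 + 1)) / (s2 ^ 2 * N ^ 2)) ∧
    (∀ S : ℝ, 1 ≤ S → σ2 ≤ S → risk ≤ (K₀ + 1) * (1 + M + M ^ 2) * S * L2 *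
      (σ2 / (s2 * N) + p ^ 2 / (s2 ^ 2 * N ^ 2) + p * (s2 + σ2) / (s2 ^ 2 * N ^ 2))) ∧
    (∀ a : ℝ, 0 < a → a * p ^ 2 ≤ N →
      risk ≤ (K₀ + 1) * (1 + M + M ^ 2) * (1 + 1 / a) * L2 * (σ2 / N)) := by
  -- One factor dominating 1, s2 and s2², so that each claimed denominator costs at most E.
  set E := 1 + M + M ^ 2 with hE
  have hE0 : 0 ≤ E := by positivity
  have hE1 : 1 ≤ E := by nlinarith
  have hME : M ≤ E := by nlinarith
  have hM2E : M ^ 2 ≤ E := by linarith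
  have h1 : 1 / N ≤ E * (1 / (s2 * N)) := by
    rw [mul_one_div, div_le_div_iff₀ hN (by positivity), one_mul]
    exact mul_le_mul_of_nonneg_right (hsM.trans hME) hN.le
  have h2 : p ^ 2 / N ^ 2 ≤ E * (p ^ 2 / (s2 ^ 2 * N ^ 2)) := by
    have e : p ^ 2 / N ^ 2 = s2 ^ 2 * (p ^ 2 / (s2 ^ 2 * N ^ 2)) := by field_simp
    rw [e]
    refine mul_le_mul_of_nonneg_right ((pow_le_pow_left₀ hs0.le hsM 2).trans hM2E) (by positivity)
  have h0 : risk ≤ (K₀ + 1) * L2 * (σ2 * (1 / N) + σ2 * (p ^ 2 / N ^ 2)) := by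
    refine h.trans ?_
    have : 0 ≤ L2 * σ2 * (1 / N + p ^ 2 / N ^ 2) := by positivity
    nlinarith
  have hKL : 0 ≤ (K₀ + 1) * L2 := by positivity
  refine ⟨?_, fun S hS hσS => ?_, fun a ha hap => ?_⟩
  · refine h0.trans ?_
    have hx : 0 ≤ E * (σ2 * (p * (s2 + 1)) / (s2 ^ 2 * N ^ 2)) := by positivity
    calc _ ≤ (K₀ + 1) * L2 * (σ2 * (E * (1 / (s2 * N))) +
          σ2 * (E * (p ^ 2 / (s2 ^ 2 * N ^ 2))) +
          E * (σ2 * (p * (s2 + 1)) / (s2 ^ 2 * N ^ 2))) := by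
          refine mul_le_mul_of_nonneg_left ?_ hKL
          have h1' := mul_le_mul_of_nonneg_left h1 hσ
          have h2' := mul_le_mul_of_nonneg_left h2 hσ
          linarith
      _ = _ := by ring
  · refine h0.trans ?_
    have hx : 0 ≤ S * E * (p * (s2 + σ2) / (s2 ^ 2 * N ^ 2)) := by positivity
    calc _ ≤ (K₀ + 1) * L2 * (S * E * (σ2 / (s2 * N)) +
          S * E * (p ^ 2 / (s2 ^ 2 * N ^ 2)) + S * E * (p * (s2 + σ2) / (s2 ^ 2 * N ^ 2))) := by
          refine mul_le_mul_of_nonneg_left ?_ hKL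
          have h1' : σ2 * (1 / N) ≤ S * E * (σ2 / (s2 * N)) := by
            calc σ2 * (1 / N) ≤ σ2 * (E * (1 / (s2 * N))) := mul_le_mul_of_nonneg_left h1 hσ
              _ = 1 * (E * (σ2 / (s2 * N))) := by ring
              _ ≤ S * (E * (σ2 / (s2 * N))) := mul_le_mul_of_nonneg_right hS (by positivity)
              _ = _ := by ring
          have h2' : σ2 * (p ^ 2 / N ^ 2) ≤ S * E * (p ^ 2 / (s2 ^ 2 * N ^ 2)) := by
            rw [mul_assoc]
            exact mul_le_mul hσS h2 (by positivity) (by linarith)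
          linarith
      _ = _ := by ring
  · refine h0.trans ?_
    have h3 : p ^ 2 / N ^ 2 ≤ 1 / a * (1 / N) := by
      rw [div_mul_div_comm, one_mul, div_le_div_iff₀ (by positivity) (by positivity), one_mul]
      calc p ^ 2 * (a * N) = (a * p ^ 2) * N := by ring
        _ ≤ N * N := mul_le_mul_of_nonneg_right hap hN.le
        _ = N ^ 2 := by ring
    have hx : 0 ≤ (1 + 1 / a) * (σ2 / N) := by positivity
    calc _ ≤ (K₀ + 1) * L2 * (1 * ((1 + 1 / a) * (σ2 / N))) := by
          refine mul_le_mul_of_nonneg_left ?_ hKL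
          have := mul_le_mul_of_nonneg_left h3 hσ
          calc _ ≤ σ2 * (1 / N) + σ2 * (1 / a * (1 / N)) := by linarith
            _ = _ := by ring
      _ ≤ (K₀ + 1) * L2 * (E * ((1 + 1 / a) * (σ2 / N))) := by gcongr
      _ = _ := by ring

end OMRidge

/-! ### Choice of the constants and conclusion. -/

theorem corollary3p2 :
    ∃ c₁ c₂ c₃ c₄ c₅ : ℝ, 0 < c₁ ∧ 0 < c₂ ∧ 0 < c₃ ∧ 0 < c₄ ∧ 0 < c₅ ∧
    -- the constant `C` depends only on `κ`, `Cmin`, `Cmax` and the bound `K` on `‖β₀‖_∞ / σε`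
    ∀ κ Cmin Cmax K : ℝ, 1 ≤ κ → 0 < Cmin → Cmin ≤ Cmax → 0 < K →
    ∃ C : ℝ, 0 < C ∧
    ∀ (n d p : ℕ), Even n → p = d + 1 → 20 ≤ p →
    ∀ (Ω : Type*) [MeasurableSpace Ω] (P : Measure Ω) [IsProbabilityMeasure P]
      (σε ση lamβ lamg Ccond sηbar : ℝ)
      (Sig : Matrix (Fin (d + 1)) (Fin (d + 1)) ℝ) (β₀ xs : Fin (d + 1) → ℝ)
      (R : Matrix (Fin d) (Fin (d + 1)) ℝ) (g₀ : Fin d → ℝ)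
      (x : Fin n → Ω → Fin (d + 1) → ℝ) (ε y : Fin n → Ω → ℝ)
      (bhat : Ω → Fin (d + 1) → ℝ) (ghat : Ω → Fin d → ℝ),
      Ccond = Cmax / Cmin →
      0 < σε →
      -- the norm of `Fin (d + 1) → ℝ` is the sup norm
      ‖β₀‖ / σε ≤ K →
      xs ≠ 0 → OMRidge.IsOrthoComplement xs R →
      OMRidge.LinearModel P κ Cmin Cmax σε Sig β₀ x ε y →
      OMRidge.TreatmentModel P ση xs R g₀ x →
      -- the residual standard deviation in the coordinates of the unit vector `xs / ‖xs‖₂`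
      sηbar = OMRidge.l2norm xs * ση →
      c₅ * κ ^ 4 * Ccond ^ 2 * p ≤ n →
      c₁ * (n ^ 2 * Cmin / (p * Ccond)) * Real.exp (-(n * c₂) / (κ ^ 4 * Ccond ^ 2)) ≤ lamβ →
      lamβ ≤ c₃ * (Ccond * Cmax * n) ^ (1 / 3 : ℝ) →
      c₄ * (n ^ 2 * Cmin / (p * Ccond)) * Real.exp (-(n * c₂) / (κ ^ 4 * Ccond ^ 2)) ≤
        OMRidge.l2norm xs ^ 2 * lamg →
      OMRidge.l2norm xs ^ 2 * lamg ≤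
        p * (Cmax / Ccond * (n / p) * sηbar ^ 4) ^ (1 / 3 : ℝ) →
      (∀ ω, OMRidge.IsRidge (OMRidge.fold1 n) lamβ (fun i => x i ω) (fun i => y i ω) (bhat ω)) →
      (∀ ω, OMRidge.IsRidge (OMRidge.fold1 n) lamg (fun i => OMRidge.zPart xs R (x i ω))
        (fun i => OMRidge.tPart xs R (x i ω)) (ghat ω)) →
      ∀ (yhat : Ω → ℝ) (risk : ℝ),
      (∀ ω, yhat ω = OMRidge.omPrediction xs R (ση ^ 2 / 4) (fun i => x i ω) (fun i => y i ω)
        (bhat ω) (ghat ω)) →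
      risk = ∫ ω, (yhat ω - xs ⬝ᵥ β₀) ^ 2 ∂P →
      Integrable (fun ω => (yhat ω - xs ⬝ᵥ β₀) ^ 2) P ∧
      risk ≤ C * OMRidge.l2norm xs ^ 2 *
        (σε ^ 2 / (sηbar ^ 2 * n) + σε ^ 2 * p ^ 2 / (sηbar ^ 4 * n ^ 2)
          + σε ^ 2 * (p * (sηbar ^ 2 + 1)) / (sηbar ^ 4 * n ^ 2)) ∧
      (∀ S : ℝ, 1 ≤ S → σε ^ 2 ≤ S →
        risk ≤ C * S * OMRidge.l2norm xs ^ 2 *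
          (σε ^ 2 / (sηbar ^ 2 * n) + p ^ 2 / (sηbar ^ 4 * n ^ 2)
            + p * (sηbar ^ 2 + σε ^ 2) / (sηbar ^ 4 * n ^ 2))) ∧
      (∀ a : ℝ, 0 < a → a * p ^ 2 ≤ n →
        risk ≤ C * (1 + 1 / a) * OMRidge.l2norm xs ^ 2 * (σε ^ 2 / n)) := by
  -- The rate 1/12800 is 1/3200 from the Gram event, halved by the AM-GM step on the bad event and
  -- halved again because λ enters squared. And 16000 = 5 · 3200 absorbs the volume factor e^{5ck}.
  refine ⟨1, 1 / 12800, 1, 1, 16000, one_pos, by norm_num, one_pos, one_pos, by norm_num, ?_⟩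
  intro κ Cmin Cmax K hκ hCmin hC hK
  have hC' : 0 < Cmax := hCmin.trans_le hC
  have hKβ := OMRidge.ridgeConst_nonneg (Cmin := Cmin) (c := Cmax / Cmin)
    (A := OMRidge.momentConst κ Cmin Cmax) (E₈ := 161280)
    (L₁ := K ^ 4 * (1 + (Cmax / Cmin * Cmax) ^ 2)) (L₂ := K ^ 4)
    (by norm_num) (by positivity) (by positivity) hκ
  have hKg := OMRidge.ridgeConst_nonneg (Cmin := Cmin) (c := Cmax / Cmin)
    (A := OMRidge.momentConst κ Cmin Cmax)
    (E₈ := 161280 * (κ ^ 2 * Cmax) ^ 4 * (Cmax / Cmin) ^ 4)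
    (L₁ := (Cmax / Cmin) ^ 2 * (1 + (Cmin * Cmax ^ 2) ^ 2)) (L₂ := (Cmax / Cmin) ^ 2)
    (by positivity) (by positivity) (by positivity) hκ
  have hK₀ := OMRidge.riskConst_nonneg (Cmin := Cmin)
    (OMRidge.momentConst_bounds (κ := κ) (Cmin := Cmin) (Cmax := Cmax)).1.le
    (D₄ := 96 * (κ ^ 2 * Cmax) ^ 2) (D₈ := 161280 * (κ ^ 2 * Cmax) ^ 4)
    (by positivity) (by positivity) hKβ hKg
  refine ⟨(_ + 1) * (1 + Cmax + Cmax ^ 2), mul_pos (add_pos_of_nonneg_of_pos hK₀ one_pos)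
    (by positivity), ?_⟩
  intro n d p hn hp hp20 Ω _ P _ σε ση lamβ lamg Ccond sηbar Sig β₀ xs R g₀ x ε y bhat ghat hCc hσ
    hβ hxs hR h ht hsbar hsize hloβ hhiβ hlog hhig hb hg yhat risk hyhat hrisk
  subst hp hCc hsbar
  have hc1 : 1 ≤ Cmax / Cmin := (one_le_div hCmin).2 hC
  have hN : (0 : ℝ) < n := lt_of_lt_of_le (by positivity) hsize
  have hn0 : 0 < n := by exact_mod_cast hN
  obtain ⟨hs1, hs2, -⟩ := ht.residual_bounds h hκ hCmin hC hR hxs ⟨0, hn0⟩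
  have he : -((n : ℝ) * (1 / 12800)) / (κ ^ 4 * (Cmax / Cmin) ^ 2) =
      -(n / (κ ^ 4 * (Cmax / Cmin) ^ 2) / 12800) := by ring
  rw [he, one_mul] at hloβ hlog
  rw [one_mul] at hhiβ
  have hlamβ : 0 < lamβ := lt_of_lt_of_le (by positivity) hloβ
  have hlamg : 0 < OMRidge.l2norm xs ^ 2 * lamg := lt_of_lt_of_le (by positivity) hlog
  have hg' := fun ω => hR.isRidge_rescale hxs (hg ω)
  have hbB := OMRidge.expLe_outcome_ridge h hκ hCmin hC hσ hn hn0 hβ hsize hloβ hhiβ hb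
  have hgB := OMRidge.expLe_treatment_ridge h ht hR hxs hκ hCmin hC hn hn0 hsize hlog hhig hg'
  have hmain := OMRidge.expLe_sq_error h ht hR hxs hκ hCmin hC hσ hn hn0 hKβ hKg hlamβ hlamg hb hg'
    hbB hgB ?_
  swap
  · exact pow_ne_zero_iff two_ne_zero |>.1 (hCmin.trans_le hs1).ne'
  simp only [← hyhat] at hmain
  have hbound := hmain.2
  rw [← hrisk] at hbound
  have hfinal := OMRidge.risk_bounds_of_le hK₀ hC'.le (sq_nonneg _) (sq_nonneg σε)
    (hCmin.trans_le hs1) hs2 (Nat.cast_nonneg (d + 1)) hN hbound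
  rw [← pow_mul] at hfinal
  exact ⟨hmain.1, hfinal⟩
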